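/- Let $D=t\,\frac{d}{dt}$ and consider the differential operators $$\begin{aligned} V_{12}\ (N=6):&\quad L=D^3-t(1+2D)(17D^2+17D+5)+t^2(D+1)^3,\\ V_{16}\ (N=8):&\quad L=D^3-4t(1+2D)(3D^2+3D+1)+16t^2(D+1)^3,\\ V_{18}\ (N=9):&\quad L=D^3-3t(1+2D)(3D^2+3D+1)-27t^2(D+1)^3 . \end{aligned}$$ In each case let $A=\sum a_nt^n$ be the power series with $LA=0$, $a_0=1$; let $B=\sum b_nt^n$ be the power series with $(D-1)LB=0$, $b_0=0$, $b_1=1$; and let $G=\sum g_nt^n$ be the power series with $g_0=0$ and $L(A\log t+G)=0$. Let $q(t)=t\exp(G(t)/A(t))$ be the modular parameter, $t(q)$ its inverse near $q=0$, and $q=e^{2\pi i\tau}$. Put $$E_{2,i}=-\tfrac{i}{24}\Bigl(1-24\sum_{n\ge1}\sigma_1(n)q^{in}\Bigr),\qquad E_{4,i}=\tfrac{i^2}{240}\Bigl(1+240\sum_{n\ge1}\sigma_3(n)q^{in}\Bigr),$$ and let $\Phi$, $F$ be, respectively, $$\begin{aligned} V_{12}:&\quad \Phi=5E_{2,1}-E_{2,2}+E_{2,3}-5E_{2,6},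 & F&=E_{4,1}-7E_{4,2}+7E_{4,3}-E_{4,6},\\ V_{16}:&\quad \Phi=4E_{2,1}-2E_{2,2}+2E_{2,4}-4E_{2,8}, & F&=E_{4,1}-\tfrac{21}{4}E_{4,2}+\tfrac{21}{4}E_{4,4}-E_{4,8},\\ V_{18}:&\quad \Phi=3E_{2,1}-3E_{2,9}, & F&=\sum_{n\ge1}\bigl(\tfrac n3\bigr)\sigma_3(n)q^n . \end{aligned}$$ Then $t(q)$ extends holomorphically to $|q|<1$, and as a function of $\tau$ in the upper half-plane it is invariant under $\Gamma_0(N)$ and under $\tau\mapsto-1/(N\tau)$. Moreover: (i) $\sum a_n t(q)^n=\Phi$ near $q=0$, and $\Phi$ is a modular form of weight $2$ for $\Gamma_0(N)$ with $\Phi(-1/N\tau)=-N\tau^2\,\Phi(\tau)$. (ii) $F=\sum_{n\ge1}c_nq^n$ is a modular form of weight $4$ for $\Gamma_0(N)$ with $F(-1/N\tau)=-(\tau\sqrt N)^4F(\tau)$, and near $q=0$ $$\frac{\sum b_n t(q)^n}{\sum a_n t(q)^n}=f:=\sum_{i\ge1}\frac{c_i}{i^3}q^i .$$ The series $\sum c_nn^{-s}$,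 absolutely convergent for $\operatorname{Re}s>4$, extends to an entire function $L(F,s)$, which equals $(1-7\cdot2^{2-s}+7\cdot3^{2-s}-6^{2-s})\zeta(s)\zeta(s-3)$ for $V_{12}$ and $(1-\frac{21}4 2^{2-s}+\frac{21}4 4^{2-s}-8^{2-s})\zeta(s)\zeta(s-3)$ for $V_{16}$ (for $s\neq1,4$), and $\prod_p\bigl(1-(\frac p3)p^{3-s}\bigr)^{-1}\bigl(1-(\frac p3)p^{-s}\bigr)^{-1}$ for $V_{18}$ (for $\operatorname{Re}s>4$). (iii) For all $\tau$ in the upper half-plane, $$\Phi(-1/N\tau)\bigl(f(-1/N\tau)-L(F,3)\bigr)=\Phi(\tau)\bigl(f(\tau)-L(F,3)\bigr).$$ (iv) The point $t_0=t(\tau)|_{\tau=i/\sqrt N}$ is a singular point of $L$ (the coefficient of $D^3$ vanishes there), and $|t_0|$ is the radius of convergence of $\sum a_nt^n$. The series $\sum(b_n-L(F,3)a_n)t^n$, which equals $\Phi\cdot(f-L(F,3))$ near $q=0$, extends analytically beyond this singularity: its radius of convergence is greater than $|t_0|$, and $\sum(b_n-L(F,3)a_n)t(\tau)^n=\Phi(\tau)(f(\tau)-L(F,3))$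 also holds for $\tau$ near $i/\sqrt N$. -/

import Mathlib

open Filter Topology
open scoped PowerSeries UpperHalfPlane MatrixGroups CongruenceSubgroup

noncomputable section

/-- The three rational Mukai threefolds of degree `2N`, `N = 6, 8, 9`. -/
inductive MukaiCase
  | V12
  | V16
  | V18

namespace MukaiCase

/-- The level `N` of the threefold `V_{2N}`. -/
def level : MukaiCase → ℕ
  | V12 => 6
  | V16 => 8
  | V18 => 9

/-- The differential operator of the threefold, as a noncommutative polynomial in
`t` and `D = t d/dt`. It is evaluated below in rings of endomorphisms. -/
def op {R : Type*} [Ring R] (t D : R) : MukaiCase → R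
  | V12 => D ^ 3 - t * (1 + 2 * D) * (17 * D ^ 2 + 17 * D + 5) + t ^ 2 * (D + 1) ^ 3
  | V16 => D ^ 3 - 4 * t * (1 + 2 * D) * (3 * D ^ 2 + 3 * D + 1) + 16 * t ^ 2 * (D + 1) ^ 3
  | V18 => D ^ 3 - 3 * t * (1 + 2 * D) * (3 * D ^ 2 + 3 * D + 1) - 27 * t ^ 2 * (D + 1) ^ 3

/-- The coefficient of `D ^ 3` in the operator; its zeros are the singular points of the
differential equation other than `0` and `∞`. -/
def symbol : MukaiCase → ℂ → ℂ
  | V12, t => 1 - 34 * t + t ^ 2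
  | V16, t => 1 - 24 * t + 16 * t ^ 2
  | V18, t => 1 - 18 * t - 27 * t ^ 2

end MukaiCase

/-- Multiplication by `t` on formal power series in `t`. -/
def tMul : Module.End ℂ ℂ⟦X⟧ := LinearMap.mulLeft ℂ PowerSeries.X

/-- `D = t d/dt` on formal power series in `t`. -/
def theta : Module.End ℂ ℂ⟦X⟧ := tMul * (PowerSeries.derivative ℂ).toLinearMap

/-- Multiplication by `t` on expressions `f + h log t`, encoded as pairs `(f, h)`. -/
def tMulLog : Module.End ℂ (ℂ⟦X⟧ × ℂ⟦X⟧) := tMul.prodMap tMul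

/-- `D = t d/dt` on expressions `f + h log t`, encoded as pairs `(f, h)`:
`D (f + h log t) = (D f + h) + (D h) log t`. -/
def thetaLog : Module.End ℂ (ℂ⟦X⟧ × ℂ⟦X⟧) :=
  theta.prodMap theta + LinearMap.inl ℂ ℂ⟦X⟧ ℂ⟦X⟧ ∘ₗ LinearMap.snd ℂ ℂ⟦X⟧ ℂ⟦X⟧

namespace MukaiCase

/-- `∑ aₙ tⁿ` is the power series solution of the differential equation with `a₀ = 1`. -/
def IsSolutionA (v : MukaiCase) (a : ℕ → ℂ) : Prop :=
  a 0 = 1 ∧ v.op tMul theta (PowerSeries.mk a) = 0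

/-- `∑ bₙ tⁿ` satisfies `(D - 1) L B = 0` with `b₀ = 0`, `b₁ = 1`; that is, `bₙ` satisfies
the recurrence attached to `L` for all `n ≥ 2`. -/
def IsSolutionB (v : MukaiCase) (b : ℕ → ℂ) : Prop :=
  b 0 = 0 ∧ b 1 = 1 ∧ (theta - 1) (v.op tMul theta (PowerSeries.mk b)) = 0

/-- `∑ gₙ tⁿ + (∑ aₙ tⁿ) log t` is the logarithmic Frobenius solution, with `g₀ = 0`. -/
def IsSolutionLog (v : MukaiCase) (a g : ℕ → ℂ) : Prop :=
  g 0 = 0 ∧ v.op tMulLog thetaLog (PowerSeries.mk g, PowerSeries.mk a) = 0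

end MukaiCase

/-- The modular parameter `q(t)`: the exponential of the quotient of the logarithmic solution
by the holomorphic one, `exp ((A log t + G) / A) = t exp (G / A)`. -/
def modularParam (a g : ℕ → ℂ) (t : ℂ) : ℂ :=
  t * Complex.exp ((∑' n, g n * t ^ n) / ∑' n, a n * t ^ n)

/-- `q = exp (2 π i τ)`. -/
def nome (τ : ℂ) : ℂ := Complex.exp (2 * Real.pi * Complex.I * τ)

/-- `E_{2,i}`, as a function of `q`. -/
def eis2 (i : ℕ) (q : ℂ) : ℂ :=
  -(1 / 24) * i *
    (1 - 24 * ∑' n : ℕ, (ArithmeticFunction.sigma 1 (n + 1) : ℂ) * q ^ (i * (n + 1)))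

/-- `E_{4,i}`, as a function of `q`. -/
def eis4 (i : ℕ) (q : ℂ) : ℂ :=
  1 / 240 * (i : ℂ) ^ 2 *
    (1 + 240 * ∑' n : ℕ, (ArithmeticFunction.sigma 3 (n + 1) : ℂ) * q ^ (i * (n + 1)))

namespace MukaiCase

/-- The weight two form `Φ`, as a function of `q`. -/
def phi : MukaiCase → ℂ → ℂ
  | V12, q => 5 * eis2 1 q - eis2 2 q + eis2 3 q - 5 * eis2 6 q
  | V16, q => 4 * eis2 1 q - 2 * eis2 2 q + 2 * eis2 4 q - 4 * eis2 8 q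
  | V18, q => 3 * eis2 1 q - 3 * eis2 9 q

/-- The weight four form `F`, as a function of `q`. -/
def formF : MukaiCase → ℂ → ℂ
  | V12, q => eis4 1 q - 7 * eis4 2 q + 7 * eis4 3 q - eis4 6 q
  | V16, q => eis4 1 q - 21 / 4 * eis4 2 q + 21 / 4 * eis4 4 q - eis4 8 q
  | V18, q => ∑' n : ℕ, (legendreSym 3 ((n + 1 : ℕ) : ℤ) : ℂ) *
      (ArithmeticFunction.sigma 3 (n + 1) : ℂ) * q ^ (n + 1)

/-- The explicit shape of the `L`-function of `F`. -/
def LShape : MukaiCase → (ℂ → ℂ) → Prop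
  | V12, L => ∀ s : ℂ, s ≠ 1 → s ≠ 4 →
      L s = (1 - 7 * 2 ^ (2 - s) + 7 * 3 ^ (2 - s) - 6 ^ (2 - s)) *
        riemannZeta s * riemannZeta (s - 3)
  | V16, L => ∀ s : ℂ, s ≠ 1 → s ≠ 4 →
      L s = (1 - 21 / 4 * 2 ^ (2 - s) + 21 / 4 * 4 ^ (2 - s) - 8 ^ (2 - s)) *
        riemannZeta s * riemannZeta (s - 3)
  | V18, L => ∀ s : ℂ, 4 < s.re →
      HasProd (fun p : Nat.Primes =>
        (1 - (legendreSym 3 ((p : ℕ) : ℤ) : ℂ) * ((p : ℕ) : ℂ) ^ (3 - s))⁻¹ *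
        (1 - (legendreSym 3 ((p : ℕ) : ℤ) : ℂ) * ((p : ℕ) : ℂ) ^ (-s))⁻¹) (L s)

end MukaiCase

/-- `L` is the `L`-function of the weight four form with `q`-expansion coefficients `c`: the
entire function given by `∑ cₙ n⁻ˢ` where this series converges absolutely (`Re s > 4`). -/
def IsLFunction (c : ℕ → ℂ) (L : ℂ → ℂ) : Prop :=
  Differentiable ℂ L ∧ ∀ s : ℂ, 4 < s.re → LSeriesHasSum c s (L s)

/-- `f = ∑ (cₙ / n³) qⁿ` (the term `n = 0` is zero). -/
def eichler (c : ℕ → ℂ) (q : ℂ) : ℂ := ∑' n : ℕ, c n / (n : ℂ) ^ 3 * q ^ n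

/-- The radius of convergence of `∑ uₙ tⁿ`. -/
def convRadius (u : ℕ → ℂ) : ENNReal := (FormalMultilinearSeries.ofScalars ℂ u).radius

end

noncomputable section

open UpperHalfPlane ModularForm EisensteinSeries Derivative CongruenceSubgroup
open scoped Manifold OnePoint

/-! ### Holomorphic functions with modular transformation behaviour under `Γ₀(N)` -/

/-! Write θ = q d/dq, L = D³ − t(1+2D)(αD²+αD+β) + κt²(D+1)³ and P(t) = 1 − 2αt + κt². Everything
rests on four explicit Eisenstein series of weight two and level N: Φ, ψ = tΦ, w = θt/t and u =
θΦ/Φ, the last only quasimodular. `MukaiCase.relations` proves θΦ = uΦ, θψ = (u+w)ψ, w² = Φ² − 2αΦψ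
+ κψ², F = wψ and 2θu − u² = 2βΦψ − κψ². After the quasimodular terms are corrected by E₂, each is
an identity between weight-four forms on Γ₀(N), and five coefficients determine such a form
(`IsModular.eq_zero_of_isBigO`).

The equation θΦ = uΦ forbids zeros of Φ in the unit disc, so t = ψ/Φ is holomorphic there, with θt =
wt and w² = Φ²P(t). Three differentiations give θ³(y(t)/Φ) = Φ·w·(Ly)(t)
(`hasTheta_comp_t_div_phi`). For LA = 0 this makes A(t)/Φ constant. For B, where LB = t, it gives
θ³(B(t)/Φ) = Φwt = F, hence B/A = f. For the logarithmic solution it gives log(t/q) + G(t)/A(t) = 0,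
so t inverts the modular parameter.

Under τ ↦ −1/(Nτ) the series E_{2,i} and E_{2,N/i} are exchanged, which fixes the Fricke signs of Φ,
ψ, w and F and makes t invariant. Therefore f(τ) + Nτ²f(−1/(Nτ)) has vanishing third derivative, and
symmetry forces it to be K(1+Nτ²) (`exists_period`). The Mellin transform of f on the imaginary axis
identifies K, the limit of f at 0, with L(F,3) (`eq_of_mellin`, `period_eq`). This is (iii).

For (iv), w vanishes at the Fricke fixed point, so P(t₀) = 0. For real q in (0,1), P(t) ≥ 0 while
P(1/9) < 0, which traps t below 1/9; hence 0 < t₀ < 1/9 and |t| ≤ t₀ on [0,q₀]. The recurrence gives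
aₙt₀ⁿ ≤ 1. Apéry's Casoratian argument gives a real l with |bₙ − l·aₙ| = O((9/2)ⁿ), a radius of at
least 2/9 > t₀ (`exists_limit`). A series in t that converges beyond t₀ continues along [0,q₀] and
is Fricke invariant near the fixed point (`hasSum_near_tau0`, `exists_fricke_eq`). Φ is not
invariant, so the radius of A is exactly t₀; invariance of Φ(f − l), compared with the period
relation, forces l = L(F,3). -/

/-- `f` is a modular form of weight `k` for `Γ₀(N)`, as an unbundled function. -/
def IsModular (N : ℕ) (k : ℤ) (f : ℍ → ℂ) : Prop :=
  MDiff f ∧ (∀ γ ∈ Gamma0 N, f ∣[k] γ = f) ∧ ∀ γ : SL(2, ℤ), IsBoundedAtImInfty (f ∣[k] γ)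

/-- `f` transforms under `Γ₀(N)` like `s` times the Eisenstein series of weight two. -/
def IsQuasimodular (N : ℕ) (s : ℂ) (f : ℍ → ℂ) : Prop :=
  MDiff f ∧ (∀ γ ∈ Gamma0 N, f ∣[(2 : ℤ)] γ = f - (s * (1 / (2 * riemannZeta 2))) • D2 γ) ∧
    ∀ γ : SL(2, ℤ), IsBoundedAtImInfty (f ∣[(2 : ℤ)] γ)

lemma IsQuasimodular.isModular {N : ℕ} {s : ℂ} {f : ℍ → ℂ} (hf : IsQuasimodular N s f)
    (hs : s = 0) : IsModular N 2 f :=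
  ⟨hf.1, fun γ hγ => by rw [hf.2.1 γ hγ]; simp [hs], hf.2.2⟩

lemma isBoundedAtImInfty_add {f g : ℍ → ℂ} (hf : IsBoundedAtImInfty f)
    (hg : IsBoundedAtImInfty g) : IsBoundedAtImInfty (f + g) := Asymptotics.IsBigO.add hf hg

lemma isBoundedAtImInfty_smul {f : ℍ → ℂ} (c : ℂ) (hf : IsBoundedAtImInfty f) :
    IsBoundedAtImInfty (c • f) := Asymptotics.IsBigO.const_smul_left hf c

lemma isBoundedAtImInfty_mul {f g : ℍ → ℂ} (hf : IsBoundedAtImInfty f)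
    (hg : IsBoundedAtImInfty g) : IsBoundedAtImInfty (f * g) := by
  exact Filter.BoundedAtFilter.mul hf hg

lemma IsQuasimodular.add {N : ℕ} {s s' : ℂ} {f g : ℍ → ℂ} (hf : IsQuasimodular N s f)
    (hg : IsQuasimodular N s' g) : IsQuasimodular N (s + s') (f + g) := by
  refine ⟨hf.1.add hg.1, fun γ hγ => ?_, fun γ => ?_⟩
  · rw [SlashAction.add_slash, hf.2.1 γ hγ, hg.2.1 γ hγ]
    ext τ
    simp only [Pi.add_apply, Pi.sub_apply, Pi.smul_apply, smul_eq_mul]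
    ring
  · rw [SlashAction.add_slash]; exact isBoundedAtImInfty_add (hf.2.2 γ) (hg.2.2 γ)

lemma IsQuasimodular.smul {N : ℕ} {s : ℂ} {f : ℍ → ℂ} (c : ℂ) (hf : IsQuasimodular N s f) :
    IsQuasimodular N (c * s) (c • f) := by
  refine ⟨hf.1.const_smul c, fun γ hγ => ?_, fun γ => ?_⟩
  · rw [SL_smul_slash, hf.2.1 γ hγ, smul_sub, smul_smul, mul_assoc]
  · rw [SL_smul_slash]; exact isBoundedAtImInfty_smul c (hf.2.2 γ)

lemma IsModular.add {N : ℕ} {k : ℤ} {f g : ℍ → ℂ} (hf : IsModular N k f)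
    (hg : IsModular N k g) : IsModular N k (f + g) := by
  refine ⟨hf.1.add hg.1, fun γ hγ => ?_, fun γ => ?_⟩
  · rw [SlashAction.add_slash, hf.2.1 γ hγ, hg.2.1 γ hγ]
  · rw [SlashAction.add_slash]; exact isBoundedAtImInfty_add (hf.2.2 γ) (hg.2.2 γ)

lemma IsModular.smul {N : ℕ} {k : ℤ} {f : ℍ → ℂ} (c : ℂ) (hf : IsModular N k f) :
    IsModular N k (c • f) := by
  refine ⟨hf.1.const_smul c, fun γ hγ => ?_, fun γ => ?_⟩
  · rw [SL_smul_slash, hf.2.1 γ hγ]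
  · rw [SL_smul_slash]; exact isBoundedAtImInfty_smul c (hf.2.2 γ)

lemma IsModular.sub {N : ℕ} {k : ℤ} {f g : ℍ → ℂ} (hf : IsModular N k f)
    (hg : IsModular N k g) : IsModular N k (f - g) := by
  have := hf.add (hg.smul (-1))
  rwa [neg_one_smul, ← sub_eq_add_neg] at this

lemma IsModular.mul {N : ℕ} {k l : ℤ} {f g : ℍ → ℂ} (hf : IsModular N k f)
    (hg : IsModular N l g) : IsModular N (k + l) (f * g) := by
  refine ⟨hf.1.mul hg.1, fun γ hγ => ?_, fun γ => ?_⟩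
  · rw [mul_slash_SL2, hf.2.1 γ hγ, hg.2.1 γ hγ]
  · rw [mul_slash_SL2]; exact isBoundedAtImInfty_mul (hf.2.2 γ) (hg.2.2 γ)

/-- The bundled modular form attached to an unbundled one. -/
def IsModular.toModularForm {N : ℕ} [NeZero N] {k : ℤ} {f : ℍ → ℂ} (hf : IsModular N k f) :
    ModularForm (Gamma0 N) k where
  toFun := f
  slash_action_eq' := by
    rintro g ⟨γ, hγ, rfl⟩
    exact hf.2.1 γ hγ
  holo' := hf.1
  bdd_at_cusps' hc := by
    rw [OnePoint.isBoundedAt_iff_forall_SL2Z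
      ((Subgroup.IsArithmetic.isCusp_iff_isCusp_SL2Z _).mp hc)]
    exact fun γ _ => hf.2.2 γ

@[simp] lemma IsModular.coe_toModularForm {N : ℕ} [NeZero N] {k : ℤ} {f : ℍ → ℂ}
    (hf : IsModular N k f) : ⇑hf.toModularForm = f := rfl

/-! ### Derivatives -/

/-- Cauchy's estimate on a disc of radius one about a point high in the half-plane. -/
lemma isBoundedAtImInfty_normalizedDeriv {f : ℍ → ℂ} (hf : MDiff f)
    (hb : IsBoundedAtImInfty f) : IsBoundedAtImInfty (normalizedDerivOfComplex f) := by
  rw [isBoundedAtImInfty_iff] at hb ⊢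
  obtain ⟨M, A, h⟩ := hb
  -- The margin keeps the whole unit disc about z both inside the half-plane and above height A.
  refine ⟨‖(2 * Real.pi * Complex.I : ℂ)⁻¹‖ * M, max A 0 + 2, fun z hz => ?_⟩
  rw [normalizedDerivOfComplex, norm_mul]
  gcongr
  rw [UpperHalfPlane.mdifferentiable_iff] at hf
  have him : ∀ w ∈ Metric.closedBall (z : ℂ) 1, max A 0 + 1 ≤ w.im := by
    intro w hw
    have h1 : |(w - z).im| ≤ ‖w - z‖ := Complex.abs_im_le_norm _
    have h2 : ‖w - z‖ ≤ 1 := by simpa [dist_eq_norm] using hw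
    have h3 := abs_le.mp (h1.trans h2)
    simp only [Complex.sub_im, UpperHalfPlane.coe_im] at h3
    linarith [h3.1]
  have hpos : ∀ w ∈ Metric.closedBall (z : ℂ) 1, 0 < w.im := fun w hw => by
    have := him w hw
    linarith [le_max_right A 0]
  have hd : DiffContOnCl ℂ (f ∘ ofComplex) (Metric.ball (z : ℂ) 1) := by
    apply DifferentiableOn.diffContOnCl
    refine hf.mono ?_
    rw [closure_ball _ one_ne_zero]
    exact fun w hw => hpos w hw
  have := Complex.norm_deriv_le_of_forall_mem_sphere_norm_le one_pos hd (C := M) (by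
    intro w hw
    have hw' := Metric.sphere_subset_closedBall hw
    simp only [Function.comp_apply, ofComplex_apply_of_im_pos (hpos w hw')]
    apply h
    have := him w hw'
    change A ≤ w.im
    linarith [le_max_left A 0])
  simpa using this

/-- Since |cz + d| ≥ |c|·Im z, the quotient c/(cz + d) has norm at most one once Im z ≥ 1. -/
lemma isBoundedAtImInfty_D2 (γ : SL(2, ℤ)) : IsBoundedAtImInfty (D2 γ) := by
  rw [isBoundedAtImInfty_iff]
  refine ⟨‖(2 * Real.pi * Complex.I : ℂ)‖, 1, fun z hz => ?_⟩
  simp only [D2]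
  rw [mul_div_assoc, norm_mul]
  apply mul_le_of_le_one_right (norm_nonneg _)
  rw [norm_div]
  apply div_le_one_of_le₀ _ (norm_nonneg _)
  rw [ModularGroup.denom_apply]
  refine le_trans ?_ (Complex.abs_im_le_norm _)
  simp only [Complex.add_im, Complex.mul_im, Complex.intCast_re, Complex.intCast_im, zero_mul,
    add_zero, Complex.norm_intCast, abs_mul, UpperHalfPlane.coe_im]
  exact le_mul_of_one_le_right (abs_nonneg _) (hz.trans (le_abs_self _))

lemma IsModular.serreDerivative {N : ℕ} {k : ℤ} {f : ℍ → ℂ} (hf : IsModular N k f) :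
    IsModular N (k + 2) (Derivative.serreDerivative k f) := by
  refine ⟨serreDerivative_mdifferentiable _ hf.1, fun γ hγ => ?_, fun γ => ?_⟩
  · rw [serreDerivative_slash_equivariant hf.1, hf.2.1 γ hγ]
  · rw [serreDerivative_slash_equivariant hf.1]
    have hm : MDiff (f ∣[k] γ) := hf.1.slash k (γ : GL (Fin 2) ℝ)
    have h1 := isBoundedAtImInfty_normalizedDeriv hm (hf.2.2 γ)
    have h2 := isBoundedAtImInfty_smul (-(k * 12⁻¹ : ℂ))
      (isBoundedAtImInfty_mul isBoundedAtImInfty_E2 (hf.2.2 γ))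
    convert isBoundedAtImInfty_add h1 h2 using 1
    ext τ
    simp
    ring

/-! ### Slashing by rational matrices -/

/-- A rational matrix carries ∞ to a cusp of SL(2, ℤ), and the hypothesis is boundedness at all of
these. -/
lemma isBoundedAtImInfty_slash_rat {k : ℤ} {f : ℍ → ℂ}
    (hf : ∀ γ : SL(2, ℤ), IsBoundedAtImInfty (f ∣[k] γ)) (M : GL (Fin 2) ℚ) :
    IsBoundedAtImInfty (f ∣[k] (M.map (Rat.castHom ℝ))) := by
  have hc : IsCusp ((M.map (Rat.castHom ℝ)) • (∞ : OnePoint ℝ)) 𝒮ℒ := by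
    rw [isCusp_SL2Z_iff]
    exact ⟨M • ∞, by rw [← Rat.coe_castHom, OnePoint.map_smul, OnePoint.map_infty]⟩
  have := (OnePoint.isBoundedAt_iff_forall_SL2Z (k := k) (f := f) hc).mpr (fun γ _ => hf γ)
  exact this _ rfl

/-- The upper triangular matrix `(a b; 0 d)`. -/
def triMatrix (a b d : ℤ) (h : a * d ≠ 0) : GL (Fin 2) ℚ :=
  Matrix.GeneralLinearGroup.mkOfDetNeZero !![(a : ℚ), b; 0, d] (by
    rw [Matrix.det_fin_two_of]; exact_mod_cast by simpa using h)

lemma mdiff_slash {f : ℍ → ℂ} (k : ℤ) (g : GL (Fin 2) ℝ) (hf : MDiff f) : MDiff (f ∣[k] g) :=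
  hf.slash k g

lemma E2_slash_bounded (γ : SL(2, ℤ)) : IsBoundedAtImInfty (E2 ∣[(2 : ℤ)] γ) := by
  rw [E2_slash_action, sub_eq_add_neg, ← _root_.neg_smul]
  exact isBoundedAtImInfty_add isBoundedAtImInfty_E2
    (isBoundedAtImInfty_smul _ (isBoundedAtImInfty_D2 γ))

/-- `(a b; 0 d)` normalises `Γ₀(N)` into `SL(2, ℤ)`. -/
def TriGood (N : ℕ) (a b d : ℤ) : Prop :=
  ∀ γ ∈ Gamma0 N, ∃ γ' : SL(2, ℤ), !![a, b; 0, d] * γ.1 = γ'.1 * !![a, b; 0, d]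

lemma triMatrix_mul {a b d : ℤ} (h : a * d ≠ 0) {γ γ' : SL(2, ℤ)}
    (hγ : !![a, b; 0, d] * γ.1 = γ'.1 * !![a, b; 0, d]) :
    (triMatrix a b d h).map (Rat.castHom ℝ) * (γ : GL (Fin 2) ℝ) =
      (γ' : GL (Fin 2) ℝ) * (triMatrix a b d h).map (Rat.castHom ℝ) := by
  have h2 := congrArg (fun m : Matrix (Fin 2) (Fin 2) ℤ => m.map (Int.castRingHom ℝ)) hγ
  simp only [Matrix.map_mul] at h2
  ext i j
  have h3 := congrFun₂ h2 i j
  have hT : !![a, b; 0, d].map (Int.castRingHom ℝ) =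
    ((triMatrix a b d h).map (Rat.castHom ℝ)).1 := by
    ext i j
    fin_cases i <;> fin_cases j <;>
      simp [triMatrix, Matrix.GeneralLinearGroup.mkOfDetNeZero]
  rw [hT] at h3
  simpa using h3

lemma triMatrix_slash_bounded {k : ℤ} {f : ℍ → ℂ}
    (hf : ∀ γ : SL(2, ℤ), IsBoundedAtImInfty (f ∣[k] γ)) (M : GL (Fin 2) ℚ) (γ : SL(2, ℤ)) :
    IsBoundedAtImInfty ((f ∣[k] (M.map (Rat.castHom ℝ))) ∣[k] γ) := by
  have : M.map (Rat.castHom ℝ) * (γ : GL (Fin 2) ℝ) =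
      (M * Matrix.SpecialLinearGroup.mapGL ℚ γ).map (Rat.castHom ℝ) := by
    rw [map_mul]
    congr 1
    ext i j
    simp
  rw [SL_slash, ← SlashAction.slash_mul, this]
  exact isBoundedAtImInfty_slash_rat hf _

lemma slash_triMatrix_apply {a b d : ℤ} (ha : 0 < a) (hd : 0 < d) (h : a * d ≠ 0) (k : ℤ)
    (f : ℍ → ℂ) (τ : ℍ) : (f ∣[k] ((triMatrix a b d h).map (Rat.castHom ℝ))) τ =
      f (ofComplex ((a * τ + b) / d)) * ((a * d : ℂ)) ^ (k - 1) * (d : ℂ) ^ (-k) := by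
  set g := (triMatrix a b d h).map (Rat.castHom ℝ) with hg
  have hdet : g.det.val = a * d := by
    simp [hg, triMatrix, Matrix.GeneralLinearGroup.mkOfDetNeZero, Matrix.det_fin_two]
  have h00 : g 0 0 = a := by simp [hg, triMatrix, Matrix.GeneralLinearGroup.mkOfDetNeZero]
  have h01 : g 0 1 = b := by simp [hg, triMatrix, Matrix.GeneralLinearGroup.mkOfDetNeZero]
  have h10 : g 1 0 = 0 := by simp [hg, triMatrix, Matrix.GeneralLinearGroup.mkOfDetNeZero]
  have h11 : g 1 1 = d := by simp [hg, triMatrix, Matrix.GeneralLinearGroup.mkOfDetNeZero]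
  have hpos : (0 : ℝ) < a * d := by exact_mod_cast mul_pos ha hd
  rw [slash_apply, hdet, abs_of_pos hpos]
  have hσ : UpperHalfPlane.σ g = ContinuousAlgEquiv.refl ℝ ℂ := by
    rw [UpperHalfPlane.σ, if_pos]
    rw [hdet]; exact hpos
  have hden : denom g τ = d := by simp [denom, h10, h11]
  have hsm : g • τ = ofComplex ((a * τ + b) / d) := by
    have h1 : ((g • τ : ℍ) : ℂ) = (a * τ + b) / d := by
      rw [UpperHalfPlane.coe_smul_of_det_pos (by rw [hdet]; exact hpos), hden]
      simp [num, h00, h01]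
    rw [← h1, ofComplex_apply]
  rw [hσ, hden, hsm]
  simp

/-- Comparing bottom rows in Mγ = γ'M shows that the denominators of γ' at Mτ and of γ at τ agree,
while the determinant factor a/d turns the lower left entry of γ' into that of γ. So slashing E₂ by
M leaves its anomaly unchanged, and weight-two combinations are modular exactly when their anomaly
coefficients cancel. -/
lemma D2_slash_triMatrix {a b d : ℤ} (ha : 0 < a) (hd : 0 < d) (h : a * d ≠ 0)
    {γ γ' : SL(2, ℤ)} (hγ : !![a, b; 0, d] * γ.1 = γ'.1 * !![a, b; 0, d]) :
    D2 γ' ∣[(2 : ℤ)] ((triMatrix a b d h).map (Rat.castHom ℝ)) = D2 γ := by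
  ext τ
  rw [slash_triMatrix_apply ha hd]
  have e0 : d * γ 1 0 = γ' 1 0 * a := by
    have := congrFun₂ hγ 1 0
    simpa [Matrix.mul_apply, Fin.sum_univ_two] using this
  have e1 : d * γ 1 1 = γ' 1 0 * b + γ' 1 1 * d := by
    have := congrFun₂ hγ 1 1
    simpa [Matrix.mul_apply, Fin.sum_univ_two] using this
  have e0' : (d : ℂ) * γ 1 0 = γ' 1 0 * a := by exact_mod_cast e0
  have e1' : (d : ℂ) * γ 1 1 = γ' 1 0 * b + γ' 1 1 * d := by exact_mod_cast e1
  have hd0 : (d : ℂ) ≠ 0 := by exact_mod_cast hd.ne'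
  have him : 0 < ((a * τ + b) / d : ℂ).im := by
    have : ((a * τ + b) / d : ℂ) = ((a / d : ℝ) : ℂ) * τ + ((b / d : ℝ) : ℂ) := by
      push_cast; field_simp
    rw [this]
    simp only [Complex.add_im, Complex.ofReal_im, add_zero, Complex.im_ofReal_mul, UpperHalfPlane.coe_im]
    have : (0 : ℝ) < a / d := by
      apply div_pos <;> exact_mod_cast (by assumption)
    positivity
  simp only [D2]
  have hden : denom (γ' : GL (Fin 2) ℝ) (ofComplex ((a * τ + b) / d)) =
      denom (γ : GL (Fin 2) ℝ) τ := by
    rw [ModularGroup.denom_apply, ModularGroup.denom_apply, ofComplex_apply_of_im_pos him]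
    simp only []
    rw [← mul_left_inj' hd0]
    field_simp
    linear_combination (-τ : ℂ) * e0' - e1'
  rw [hden]
  have hn := denom_ne_zero (γ : GL (Fin 2) ℝ) τ
  have : (γ' 1 0 : ℂ) = d * γ 1 0 / a := by
    have : (a : ℂ) ≠ 0 := by exact_mod_cast ha.ne'
    field_simp; linear_combination -e0'
  rw [this]
  have ha0 : (a : ℂ) ≠ 0 := by exact_mod_cast ha.ne'
  norm_num
  field_simp

lemma isQuasimodular_E2_slash {N : ℕ} {a b d : ℤ} (ha : 0 < a) (hd : 0 < d) (h : a * d ≠ 0)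
    (hN : TriGood N a b d) :
    IsQuasimodular N 1 (E2 ∣[(2 : ℤ)] ((triMatrix a b d h).map (Rat.castHom ℝ))) := by
  refine ⟨mdiff_slash _ _ E2_mdifferentiable, fun γ hγ => ?_,
    triMatrix_slash_bounded E2_slash_bounded _⟩
  obtain ⟨γ', hγ'⟩ := hN γ hγ
  rw [SL_slash, ← SlashAction.slash_mul, triMatrix_mul h hγ', SlashAction.slash_mul]
  have h1 := E2_slash_action γ'
  rw [SL_slash] at h1
  rw [h1, sub_eq_add_neg, SlashAction.add_slash, SlashAction.neg_slash, smul_slash,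
    D2_slash_triMatrix ha hd h hγ', ← sub_eq_add_neg, one_mul]
  congr 2
  have hdet : ((triMatrix a b d h).map (Rat.castHom ℝ)).det.val = a * d := by
    simp [triMatrix, Matrix.GeneralLinearGroup.mkOfDetNeZero, Matrix.det_fin_two]
  rw [UpperHalfPlane.σ, if_pos]
  · rfl
  · rw [hdet]; exact_mod_cast mul_pos ha hd

lemma isModular_slash_triMatrix {N : ℕ} {a b d : ℤ} (h : a * d ≠ 0)
    (hN : TriGood N a b d) {k : ℤ} {f : ℍ → ℂ} (hf : MDiff f) (hi : ∀ γ : SL(2, ℤ), f ∣[k] γ = f)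
    (hb : IsBoundedAtImInfty f) :
    IsModular N k (f ∣[k] ((triMatrix a b d h).map (Rat.castHom ℝ))) := by
  refine ⟨mdiff_slash _ _ hf, fun γ hγ => ?_,
    triMatrix_slash_bounded (fun γ => by rw [hi]; exact hb) _⟩
  obtain ⟨γ', hγ'⟩ := hN γ hγ
  have h1 := hi γ'
  rw [SL_slash] at h1
  rw [SL_slash, ← SlashAction.slash_mul, triMatrix_mul h hγ', SlashAction.slash_mul, h1]

/-- `D E₂ - E₂² / 12` is modular of weight four. -/
lemma isModular_serreDerivative_E2 (N : ℕ) :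
    IsModular N 4 (Derivative.serreDerivative 1 E2) := by
  have hD : MDiff (normalizedDerivOfComplex E2) :=
    normalizedDerivOfComplex_mdifferentiable E2_mdifferentiable
  have hslash : ∀ γ : SL(2, ℤ), Derivative.serreDerivative 1 E2 ∣[(4 : ℤ)] γ =
      Derivative.serreDerivative 1 E2 := by
    intro γ
    have h1 := normalizedDerivOfComplex_SL_slash (k := 2) E2_mdifferentiable (γ := γ)
    have hDm : MDiff (D2 γ) := by
      -- Holomorphy of the anomaly is inherited from E₂ and its slash.
      have : D2 γ = (2 * riemannZeta 2) • (E2 - E2 ∣[(2 : ℤ)] γ) := by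
        rw [E2_slash_action, sub_sub_cancel, smul_smul, riemannZeta_two]
        have : (Real.pi : ℂ) ≠ 0 := by exact_mod_cast Real.pi_ne_zero
        field_simp
        simp
      rw [this]
      exact (E2_mdifferentiable.sub (mdiff_slash 2 _ E2_mdifferentiable)).const_smul _
    have h2 : normalizedDerivOfComplex (E2 ∣[(2 : ℤ)] γ) = normalizedDerivOfComplex E2 -
        (1 / (2 * riemannZeta 2)) • normalizedDerivOfComplex (D2 γ) := by
      rw [E2_slash_action, normalizedDerivOfComplex_sub _ _ E2_mdifferentiable
        (hDm.const_smul _), normalizedDerivOfComplex_smul _ _ hDm]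
    have h3 : ∀ z : ℍ, normalizedDerivOfComplex (D2 γ) z =
        -((γ 1 0 : ℂ) / denom (γ : GL (Fin 2) ℝ) z) ^ 2 := by
      intro z
      have hz := denom_ne_zero (γ : GL (Fin 2) ℝ) z
      have hder : HasDerivAt (fun w : ℂ => (2 * Real.pi * Complex.I * γ 1 0) /
          ((γ 1 0 : ℂ) * w + γ 1 1)) (-(2 * Real.pi * Complex.I * γ 1 0) * (γ 1 0) /
          ((γ 1 0 : ℂ) * z + γ 1 1) ^ 2) z := by
        have hl : HasDerivAt (fun w : ℂ => (γ 1 0 : ℂ) * w + γ 1 1) (γ 1 0 : ℂ) z := by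
          simpa using ((hasDerivAt_id (z : ℂ)).const_mul (γ 1 0 : ℂ)).add_const (γ 1 1 : ℂ)
        have := (hasDerivAt_const (z : ℂ) (2 * Real.pi * Complex.I * γ 1 0 : ℂ)).div hl
          (by rw [ModularGroup.denom_apply] at hz; exact hz)
        exact this.congr_deriv (by ring)
      have heq : (D2 γ) ∘ ofComplex =ᶠ[𝓝 (z : ℂ)] fun w : ℂ =>
          (2 * Real.pi * Complex.I * γ 1 0) / ((γ 1 0 : ℂ) * w + γ 1 1) := by
        filter_upwards [isOpen_upperHalfPlaneSet.mem_nhds z.im_pos] with w hw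
        simp [D2, ofComplex_apply_of_im_pos hw, denom]
      rw [normalizedDerivOfComplex, (hder.congr_of_eventuallyEq heq).deriv]
      rw [ModularGroup.denom_apply] at hz ⊢
      have : (Real.pi : ℂ) ≠ 0 := by exact_mod_cast Real.pi_ne_zero
      have hI := Complex.I_ne_zero
      field_simp
    ext z
    have h4 := congrFun (h2.symm.trans h1) z
    have h5 := congrFun (E2_slash_action γ) z
    have h6 := congrFun (mul_slash_SL2 2 2 γ E2 E2) z
    simp only [Pi.sub_apply, Pi.smul_apply, smul_eq_mul, Pi.mul_apply] at h4 h5 h6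
    rw [h3] at h4
    have hs : Derivative.serreDerivative 1 E2 =
        normalizedDerivOfComplex E2 + (-(12⁻¹ : ℂ)) • (E2 * E2) := by
      ext z; simp; ring
    rw [hs, SlashAction.add_slash, SL_smul_slash]
    simp only [Pi.add_apply, Pi.smul_apply, smul_eq_mul, Pi.mul_apply]
    change _ = ((normalizedDerivOfComplex E2) ∣[(4 : ℤ)] γ) z - _ at h4
    change ((E2 * E2) ∣[(4 : ℤ)] γ) z = _ at h6
    rw [h6]
    have h7 := eq_add_of_sub_eq h4.symm
    rw [h7, h5, D2, riemannZeta_two]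
    have : (Real.pi : ℂ) ≠ 0 := by exact_mod_cast Real.pi_ne_zero
    have hI := Complex.I_ne_zero
    have hz := denom_ne_zero (γ : GL (Fin 2) ℝ) z
    have hI2 : Complex.I ^ 2 = -1 := Complex.I_sq
    push_cast
    field_simp
    ring_nf
    simp only [show Complex.I ^ 3 = -Complex.I by rw [pow_succ, hI2]; ring, hI2]
    ring
  refine ⟨serreDerivative_mdifferentiable _ E2_mdifferentiable, fun γ _ => hslash γ, fun γ => ?_⟩
  rw [hslash γ]
  have h1 := isBoundedAtImInfty_normalizedDeriv E2_mdifferentiable isBoundedAtImInfty_E2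
  have h2 := isBoundedAtImInfty_smul (-(12⁻¹ : ℂ))
    (isBoundedAtImInfty_mul isBoundedAtImInfty_E2 isBoundedAtImInfty_E2)
  convert isBoundedAtImInfty_add h1 h2 using 1
  ext τ
  simp
  ring

/-! ### Vanishing criterion -/

/-- The n-th coefficient is an integral over a horizontal segment at any height t; the decay bounds
it by a multiple of exp(−2π(m − n)t), which tends to 0 as t grows. -/
lemma qExpansion_coeff_eq_zero_of_isBigO {f : ℍ → ℂ} (hper : Function.Periodic (f ∘ ofComplex) 1)
    (hf : MDiff f) (hb : IsBoundedAtImInfty f) (m : ℕ)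
    (h : f =O[atImInfty] fun τ => Real.exp (-2 * Real.pi * m * τ.im)) (n : ℕ) (hn : n < m) :
    (qExpansion 1 f).coeff n = 0 := by
  obtain ⟨C, hC⟩ := h.bound
  obtain ⟨A, hA⟩ := (atImInfty_mem _).mp hC
  have key : ∀ t : ℝ, max A 1 ≤ t →
      ‖(qExpansion 1 f).coeff n‖ ≤ |C| * Real.exp (-2 * Real.pi * t) := by
    intro t ht
    have ht0 : 0 < t := lt_of_lt_of_le one_pos ((le_max_right _ _).trans ht)
    have := qExpansion_coeff_eq_intervalIntegral (h := 1) one_pos (by simpa using hper) hf hb n ht0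
    rw [this]
    simp only [Complex.ofReal_one, div_one, one_mul]
    have hle := intervalIntegral.norm_integral_le_of_norm_le_const (a := (0 : ℝ)) (b := 1)
      (f := fun u : ℝ => 1 / Function.Periodic.qParam 1 (u + t * Complex.I) ^ n *
        f ⟨u + t * Complex.I, by simpa using ht0⟩) (C := |C| * Real.exp (-2 * Real.pi * t)) (by
      intro u _
      have h1 := hA ⟨u + t * Complex.I, by simpa using ht0⟩ (by
        change A ≤ (u + t * Complex.I).im
        simpa using (le_max_left _ _).trans ht)
      simp only [Set.mem_ofPred_eq] at h1
      have him : UpperHalfPlane.im ⟨u + t * Complex.I, by simpa using ht0⟩ = t := by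
        change (u + t * Complex.I).im = t
        simp
      rw [him] at h1
      rw [norm_mul, norm_div, norm_one, norm_pow, Function.Periodic.norm_qParam]
      simp only [Complex.add_im, Complex.ofReal_im, Complex.mul_im, Complex.ofReal_re,
        Complex.I_im, mul_one, Complex.I_re, mul_zero, add_zero, zero_add, div_one]
      rw [Real.norm_eq_abs, abs_of_pos (Real.exp_pos _)] at h1
      calc 1 / Real.exp (-2 * Real.pi * t) ^ n * _
          ≤ 1 / Real.exp (-2 * Real.pi * t) ^ n * (|C| * Real.exp (-2 * Real.pi * m * t)) := by
            gcongr
            exact h1.trans (by gcongr; exact le_abs_self C)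
        _ = |C| * Real.exp (-2 * Real.pi * (m - n) * t) := by
            rw [← Real.exp_nat_mul, one_div, ← Real.exp_neg, mul_left_comm, ← Real.exp_add]
            ring_nf
        _ ≤ _ := by
            gcongr _ * Real.exp ?_
            have : (1 : ℝ) ≤ m - n := by
              have : (n : ℝ) + 1 ≤ m := by exact_mod_cast hn
              linarith
            have h3 : 0 < 2 * Real.pi * t := by positivity
            nlinarith)
    simpa using hle
  have hlim : Tendsto (fun t : ℝ => |C| * Real.exp (-2 * Real.pi * t)) atTop (𝓝 0) := by
    rw [← mul_zero |C|]
    refine Tendsto.const_mul _ (Real.tendsto_exp_atBot.comp ?_)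
    exact tendsto_id.const_mul_atTop_of_neg (by linarith [Real.pi_pos])
  have := ge_of_tendsto hlim (eventually_atTop.mpr ⟨_, key⟩)
  exact norm_le_zero_iff.mp this

lemma isBigO_prod_of_isBounded {ι : Type*} {s : Finset ι} {φ : ι → ℍ → ℂ}
    (hb : ∀ i, IsBoundedAtImInfty (φ i)) {i : ι} (hi : i ∈ s) {e : ℍ → ℝ}
    (h : φ i =O[atImInfty] e) : (∏ j ∈ s, φ j) =O[atImInfty] e := by
  classical
  rw [← Finset.mul_prod_erase s φ hi]
  have h2 : IsBoundedAtImInfty (∏ j ∈ s.erase i, φ j) := by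
    apply Finset.prod_induction _ IsBoundedAtImInfty
    · exact fun a b ha hb => isBoundedAtImInfty_mul ha hb
    · exact Filter.const_boundedAtFilter _ _
    · exact fun q _ => hb q
  have := Asymptotics.IsBigO.mul h h2
  simp only [Pi.one_apply, mul_one] at this
  exact this

/-- A weight four form on a subgroup of index at most fourteen vanishes if its expansion
starts with the fifth power of `q`. -/
lemma IsModular.eq_zero_of_isBigO {N : ℕ} [NeZero N] (hN : (Gamma0 N).index ≤ 14) {f : ℍ → ℂ}
    (hf : IsModular N 4 f)
    (h : f =O[atImInfty] fun τ => Real.exp (-2 * Real.pi * (5 : ℕ) * τ.im)) : f = 0 := by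
  set F := hf.toModularForm with hF
  suffices ModularForm.norm 𝒮ℒ F = 0 by
    rw [ModularForm.norm_eq_zero_iff] at this
    exact this
  set 𝒬 := 𝒮ℒ ⧸ ((Gamma0 N : Subgroup (GL (Fin 2) ℝ)).subgroupOf 𝒮ℒ)
  have hcard : Nat.card 𝒬 = (Gamma0 N).index := by
    change (Subgroup.relIndex _ _) = _
    rw [MonoidHom.range_eq_map, ← Subgroup.relIndex_comap,
      Subgroup.comap_map_eq_self_of_injective Matrix.SpecialLinearGroup.mapGL_injective,
      Subgroup.relIndex_top_right]
  -- The factor of the trivial coset carries the decay; all other factors of the norm are merely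
  -- bounded.
  have hbig : (ModularForm.norm 𝒮ℒ F : ℍ → ℂ) =O[atImInfty]
      fun τ => Real.exp (-2 * Real.pi * (5 : ℕ) * τ.im) := by
    classical
    rw [ModularForm.coe_norm]
    generalize Fintype.ofFinite (𝒮ℒ ⧸ ((Gamma0 N : Subgroup (GL (Fin 2) ℝ)).subgroupOf 𝒮ℒ)) = I
    have hb : ∀ q : 𝒬, IsBoundedAtImInfty (SlashInvariantForm.quotientFunc F q) := by
      refine Quotient.forall.mpr ?_
      rintro ⟨r, γ, rfl⟩
      have : ((Matrix.SpecialLinearGroup.mapGL ℝ γ : GL (Fin 2) ℝ))⁻¹ =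
        Matrix.SpecialLinearGroup.mapGL ℝ γ⁻¹ := by simp
      rw [SlashInvariantForm.quotientFunc_mk]
      simp only [this]
      exact hf.2.2 γ⁻¹
    refine isBigO_prod_of_isBounded hb (Finset.mem_univ ⟦1⟧) ?_
    rw [SlashInvariantForm.quotientFunc_mk]
    simpa [hF] using! h
  have hsp : (1 : ℝ) ∈ (𝒮ℒ).strictPeriods := one_mem_strictPeriods_SL
  refine sturm_bound_levelOne ?_
  have hcusp : IsCusp OnePoint.infty 𝒮ℒ := Subgroup.isCusp_of_mem_strictPeriods one_pos hsp
  -- The norm has level one and weight 4 · index ≤ 56, so the Sturm bound is at most 4; this is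
  -- where the pair of constants 14 and 5 comes from.
  have hlt : (4 * (Nat.card 𝒬 : ℤ)).toNat / 12 < 5 := by omega
  refine lt_of_lt_of_le (b := ((5 : ℕ) : ℕ∞)) (by exact_mod_cast hlt) ?_
  refine PowerSeries.nat_le_order _ _ fun n hn => ?_
  refine qExpansion_coeff_eq_zero_of_isBigO ?_ (ModularForm.norm 𝒮ℒ F).holo' ?_ 5 hbig n hn
  · simpa using SlashInvariantFormClass.periodic_comp_ofComplex (ModularForm.norm 𝒮ℒ F) hsp
  · exact OnePoint.isBoundedAt_infty_iff.mp ((ModularForm.norm 𝒮ℒ F).bdd_at_cusps' hcusp)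

/-! ### The index of `Γ₀(N)` -/

/-- The cosets embed in the projective line over ℤ/N through bottom rows. The list `l` supplies
unimodular representatives, and two matrices with proportional bottom rows differ by an element of
Γ₀(N). -/
lemma index_Gamma0_le (N : ℕ) (l : List (ZMod N × ZMod N))
    (hu : ∀ x ∈ l, ∃ s t : ZMod N, s * x.1 + t * x.2 = 1)
    (hl : ∀ c d : ZMod N, (∃ a b : ZMod N, a * d - b * c = 1) →
      ∃ x ∈ l, c * x.2 - d * x.1 = 0) :
    (Gamma0 N).index ≤ l.length := by
  classical
  have hex : ∀ γ : SL(2, ℤ), ∃ i : Fin l.length,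
      ((γ 1 0 : ℤ) : ZMod N) * (l.get i).2 - ((γ 1 1 : ℤ) : ZMod N) * (l.get i).1 = 0 := by
    intro γ
    obtain ⟨x, hx, h⟩ := hl ((γ 1 0 : ℤ) : ZMod N) ((γ 1 1 : ℤ) : ZMod N)
      ⟨((γ 0 0 : ℤ) : ZMod N), ((γ 0 1 : ℤ) : ZMod N), by
        have := γ.2
        rw [Matrix.det_fin_two] at this
        have h2 := congrArg (Int.cast : ℤ → ZMod N) this
        push_cast at h2
        exact h2⟩
    obtain ⟨i, rfl⟩ := List.get_of_mem hx
    exact ⟨i, h⟩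
  choose r hr using hex
  have key : ∀ γ γ' : SL(2, ℤ), r γ = r γ' → γ * γ'⁻¹ ∈ Gamma0 N := by
    intro γ γ' h
    have h1 := hr γ
    have h2 := hr γ'
    rw [← h] at h2
    obtain ⟨s, t, hst⟩ := hu _ (l.get_mem (r γ))
    rw [Gamma0_mem]
    have : ((γ * γ'⁻¹) 1 0 : ℤ) = γ 1 0 * γ' 1 1 - γ 1 1 * γ' 1 0 := by
      rw [Matrix.SpecialLinearGroup.coe_mul, Matrix.SpecialLinearGroup.coe_inv,
        Matrix.adjugate_fin_two, Matrix.mul_apply]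
      simp [Fin.sum_univ_two]
      ring
    rw [this]
    push_cast
    linear_combination (-(γ 1 0 : ZMod N) * γ' 1 1 + γ 1 1 * γ' 1 0) * hst +
      (s * γ' 1 0 + t * γ' 1 1) * h1 - (s * γ 1 0 + t * γ 1 1) * h2
  rw [Subgroup.index]
  -- The quotient consists of left cosets whereas the bottom row is an invariant of right cosets,
  -- hence the inverse.
  let f : SL(2, ℤ) ⧸ Gamma0 N → Fin l.length := fun q => r q.out⁻¹
  have hf : Function.Injective f := by
    intro p q hpq
    have h := key _ _ hpq
    rw [← QuotientGroup.out_eq' p, ← QuotientGroup.out_eq' q, QuotientGroup.eq]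
    simpa using h
  simpa using Nat.card_le_card_of_injective f hf

lemma index_Gamma0_six : (Gamma0 6).index ≤ 14 :=
  (index_Gamma0_le 6 [(0, 1), (1, 0), (1, 1), (1, 2), (1, 3), (1, 4), (1, 5), (2, 1), (2, 3),
    (3, 1), (3, 2), (2, 5)] (by decide) (by decide)).trans (by norm_num)

lemma index_Gamma0_eight : (Gamma0 8).index ≤ 14 :=
  (index_Gamma0_le 8 [(0, 1), (1, 0), (1, 1), (1, 2), (1, 3), (1, 4), (1, 5), (1, 6), (1, 7),
    (2, 1), (4, 1), (6, 1)] (by decide) (by decide)).trans (by norm_num)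

lemma index_Gamma0_nine : (Gamma0 9).index ≤ 14 :=
  (index_Gamma0_le 9 [(0, 1), (1, 0), (1, 1), (1, 2), (1, 3), (1, 4), (1, 5), (1, 6), (1, 7),
    (1, 8), (3, 1), (6, 1)] (by decide) (by decide)).trans (by norm_num)

/-! ### Normalising matrices -/

/-- Conjugation by diag(δ, 1) multiplies the upper right entry by δ and divides the lower left one
by δ. -/
lemma triGood_of_dvd {N : ℕ} {δ : ℤ} (h : δ ∣ N) : TriGood N δ 0 1 := by
  intro γ hγ
  rw [Gamma0_mem, ZMod.intCast_zmod_eq_zero_iff_dvd] at hγ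
  obtain ⟨c, hc⟩ := h.trans hγ
  refine ⟨⟨!![γ 0 0, δ * γ 0 1; c, γ 1 1], ?_⟩, ?_⟩
  · have := γ.2
    rw [Matrix.det_fin_two] at this
    rw [Matrix.det_fin_two_of]
    linear_combination this + γ 0 1 * hc
  · ext i j
    fin_cases i <;> fin_cases j <;> simp [Matrix.mul_apply, Fin.sum_univ_two, hc, mul_comm]

/-- The matrix is translation by ε/3. Since 9 divides c, ad ≡ 1 mod 3 and hence a ≡ d mod 3; this
makes the entry b + ε(d − a)/3 − c/9 of the conjugate integral. -/
lemma triGood_nine {ε : ℤ} (hε : ε = 1 ∨ ε = -1) : TriGood 9 3 ε 3 := by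
  intro γ hγ
  rw [Gamma0_mem, ZMod.intCast_zmod_eq_zero_iff_dvd] at hγ
  obtain ⟨c, hc⟩ := hγ
  have hdet := γ.2
  rw [Matrix.det_fin_two] at hdet
  have hε2 : ε * ε = 1 := by rcases hε with rfl | rfl <;> norm_num
  have h3 : (3 : ℤ) ∣ γ 1 1 - γ 0 0 := by
    have h1 : (γ 0 0 * γ 1 1) % 3 = 1 := by
      have : γ 0 0 * γ 1 1 = 1 + 3 * (γ 0 1 * (3 * c)) := by
        rw [hc] at hdet; push_cast at hdet; linarith
      omega
    have ha : γ 0 0 % 3 = 0 ∨ γ 0 0 % 3 = 1 ∨ γ 0 0 % 3 = 2 := by omega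
    have hd : γ 1 1 % 3 = 0 ∨ γ 1 1 % 3 = 1 ∨ γ 1 1 % 3 = 2 := by omega
    rcases ha with ha | ha | ha <;> rcases hd with hd | hd | hd <;>
      simp [Int.mul_emod, ha, hd] at h1 <;> omega
  obtain ⟨m, hm⟩ := h3
  push_cast at hc
  refine ⟨⟨!![γ 0 0 + 3 * ε * c, γ 0 1 + ε * m - c; 9 * c, γ 1 1 - 3 * ε * c], ?_⟩, ?_⟩
  · rw [Matrix.det_fin_two_of]
    rw [hc] at hdet
    linear_combination hdet + 3 * ε * c * hm - 9 * c ^ 2 * hε2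
  · ext i j
    fin_cases i <;> fin_cases j <;> simp [Matrix.mul_apply, Fin.sum_univ_two, hc]
    · ring
    · linear_combination ε * hm - 3 * c * hε2
    · ring
    · ring

/-! ### Power series and the functions they define -/

/-- `z d/dz` on functions. -/
def thetaFun (f : ℂ → ℂ) (z : ℂ) : ℂ := z * deriv f z

/-- The power series `p` converges to `f` on the disc of radius `r`. -/
def EvalOn (p : ℂ⟦X⟧) (f : ℂ → ℂ) (r : ℝ) : Prop :=
  ∀ z : ℂ, ‖z‖ < r → HasSum (fun n => PowerSeries.coeff n p * z ^ n) (f z)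

namespace EvalOn

variable {p p' : ℂ⟦X⟧} {f f' : ℂ → ℂ} {r : ℝ}

lemma mono {s : ℝ} (h : EvalOn p f r) (hs : s ≤ r) : EvalOn p f s :=
  fun z hz => h z (hz.trans_le hs)

lemma congr (h : EvalOn p f r) (hf : ∀ z, ‖z‖ < r → f z = f' z) : EvalOn p f' r :=
  fun z hz => hf z hz ▸ h z hz

lemma add (h : EvalOn p f r) (h' : EvalOn p' f' r) : EvalOn (p + p') (f + f') r :=
  fun z hz => by simpa [add_mul] using (h z hz).add (h' z hz)

lemma smul (c : ℂ) (h : EvalOn p f r) : EvalOn (c • p) (c • f) r :=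
  fun z hz => by simpa [mul_assoc] using (h z hz).mul_left c

lemma neg (h : EvalOn p f r) : EvalOn (-p) (-f) r :=
  fun z hz => by simpa using (h z hz).neg

lemma sub (h : EvalOn p f r) (h' : EvalOn p' f' r) : EvalOn (p - p') (f - f') r :=
  fun z hz => by simpa [sub_mul] using (h z hz).sub (h' z hz)

lemma mul (h : EvalOn p f r) (h' : EvalOn p' f' r) : EvalOn (p * p') (f * f') r := by
  intro z hz
  have h1 := (h z hz).summable.norm
  have h2 := (h' z hz).summable.norm
  have h3 := (summable_norm_sum_mul_antidiagonal_of_summable_norm h1 h2).of_norm.hasSum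
  rw [← tsum_mul_tsum_eq_tsum_sum_antidiagonal_of_summable_norm h1 h2, (h z hz).tsum_eq,
    (h' z hz).tsum_eq] at h3
  suffices heq : (fun n => PowerSeries.coeff n (p * p') * z ^ n) = fun n =>
      ∑ kl ∈ Finset.HasAntidiagonal.antidiagonal n, PowerSeries.coeff kl.1 p * z ^ kl.1 *
        (PowerSeries.coeff kl.2 p' * z ^ kl.2) by
    rw [heq]; exact h3
  ext n
  rw [PowerSeries.coeff_mul, Finset.sum_mul]
  refine Finset.sum_congr rfl fun x hx => ?_
  rw [← Finset.HasAntidiagonal.mem_antidiagonal.mp hx, pow_add]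
  ring

lemma of_differentiableOn (hf : DifferentiableOn ℂ f (Metric.ball 0 r)) :
    EvalOn (PowerSeries.mk fun n => (n.factorial : ℂ)⁻¹ * iteratedDeriv n f 0) f r := by
  intro z hz
  have := Complex.hasSum_taylorSeries_on_ball hf (z := z) (by simpa using hz)
  simpa [mul_comm, mul_left_comm, mul_assoc] using this

lemma hasFPowerSeriesOnBall (h : EvalOn p f r) (hr : 0 < r) :
    HasFPowerSeriesOnBall f (FormalMultilinearSeries.ofScalars ℂ fun n => PowerSeries.coeff n p) 0
      (ENNReal.ofReal r) := by
  refine ⟨?_, by simpa using hr, ?_⟩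
  · refine ENNReal.le_of_forall_nnreal_lt fun s hs => ?_
    have hs' : (s : ℝ) < r := by
      rw [← ENNReal.ofReal_coe_nnreal, ENNReal.ofReal_lt_ofReal_iff hr] at hs
      exact hs
    apply FormalMultilinearSeries.le_radius_of_summable
    have := (h (s : ℝ) (by simpa using hs')).summable.norm
    refine this.congr fun n => ?_
    simp
  · intro y hy
    have hy' : ‖y‖ < r := by
      simpa [Metric.mem_eball, edist_eq_enorm_sub, enorm_eq_nnnorm,
        ENNReal.ofReal, ENNReal.coe_lt_coe, ← NNReal.coe_lt_coe, hr.le] using hy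
    have := h y hy'
    simpa [FormalMultilinearSeries.ofScalars, mul_comm] using this

lemma differentiableOn (h : EvalOn p f r) : DifferentiableOn ℂ f (Metric.ball 0 r) := by
  rcases le_or_gt r 0 with hr | hr
  · rw [Metric.ball_eq_empty.mpr hr]; exact differentiableOn_empty
  · have := (h.hasFPowerSeriesOnBall hr).differentiableOn
    rwa [← Metric.eball_ofReal]

lemma coeff_eq (h : EvalOn p f r) (hr : 0 < r) (n : ℕ) :
    PowerSeries.coeff n p = (n.factorial : ℂ)⁻¹ * iteratedDeriv n f 0 := by
  have := (h.hasFPowerSeriesOnBall hr).factorial_smul 1 n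
  rw [iteratedDeriv, ← this]
  have hn : (n.factorial : ℂ) ≠ 0 := by exact_mod_cast n.factorial_ne_zero
  simp [FormalMultilinearSeries.ofScalars, nsmul_eq_mul]
  field_simp

lemma eq_of_eventuallyEq {s : ℝ} (h : EvalOn p f r) (h' : EvalOn p' f' s) (hr : 0 < r) (hs : 0 < s)
    (he : f =ᶠ[𝓝 0] f') : p = p' := by
  ext n
  rw [h.coeff_eq hr, h'.coeff_eq hs, he.iteratedDeriv_eq]

lemma X_mul (h : EvalOn p f r) : EvalOn (PowerSeries.X * p) (fun z => z * f z) r := by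
  have hX : EvalOn PowerSeries.X (fun z => z) r := by
    intro z _
    have := hasSum_single (f := fun n => PowerSeries.coeff n (PowerSeries.X : ℂ⟦X⟧) * z ^ n) 1
      (fun n hn => by simp [PowerSeries.coeff_X, hn])
    simpa using this
  exact hX.mul h

lemma theta (h : EvalOn p f r) : EvalOn (theta p) (thetaFun f) r := by
  rcases le_or_gt r 0 with hr | hr
  · intro z hz; exact absurd (norm_nonneg z) (by linarith)
  have hd : DifferentiableOn ℂ (deriv f) (Metric.ball 0 r) :=
    h.differentiableOn.deriv Metric.isOpen_ball
  have h1 := of_differentiableOn hd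
  have : PowerSeries.mk (fun n => (n.factorial : ℂ)⁻¹ * iteratedDeriv n (deriv f) 0) =
      PowerSeries.derivative ℂ p := by
    ext n
    rw [PowerSeries.coeff_mk, PowerSeries.coeff_derivative, h.coeff_eq hr, iteratedDeriv_succ',
      Nat.factorial_succ]
    have hn : (n.factorial : ℂ) ≠ 0 := by exact_mod_cast n.factorial_ne_zero
    have hn' : (n + 1 : ℂ) ≠ 0 := by exact_mod_cast n.succ_ne_zero
    push_cast
    field_simp
  rw [this] at h1
  exact h1.X_mul

end EvalOn

lemma coeff_theta (p : ℂ⟦X⟧) (n : ℕ) :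
    PowerSeries.coeff n (theta p) = n * PowerSeries.coeff n p := by
  change PowerSeries.coeff n (PowerSeries.X * PowerSeries.derivative ℂ p) = _
  cases n with
  | zero => simp
  | succ n => rw [PowerSeries.coeff_succ_X_mul, PowerSeries.coeff_derivative]; push_cast; ring

/-! ### Divisor sums -/

lemma summable_sigma_mul_pow (k : ℕ) {q : ℂ} (hq : ‖q‖ < 1) :
    Summable fun n : ℕ => (ArithmeticFunction.sigma k n : ℂ) * q ^ n := by
  apply Summable.of_norm_bounded (summable_norm_pow_mul_geometric_of_norm_lt_one (k + 1) hq)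
  intro n
  rw [norm_mul, norm_mul, norm_pow, norm_pow]
  gcongr
  rw [Complex.norm_natCast, Complex.norm_natCast]
  exact_mod_cast ArithmeticFunction.sigma_le_pow_succ k n

/-- The series `∑ χ(n) σ_k(n) q^n`. -/
def sigmaSeries (χ : ℕ → ℂ) (k : ℕ) : ℂ⟦X⟧ :=
  PowerSeries.mk fun n => χ n * (ArithmeticFunction.sigma k n : ℂ)

/-- Substitution of `q^i` for `q`. -/
def dilate (i : ℕ) (p : ℂ⟦X⟧) : ℂ⟦X⟧ :=
  PowerSeries.mk fun n => if i ∣ n then PowerSeries.coeff (n / i) p else 0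

lemma EvalOn.dilate {p : ℂ⟦X⟧} {f : ℂ → ℂ} {i : ℕ} (hi : 0 < i) (h : EvalOn p f 1) :
    EvalOn (dilate i p) (fun q => f (q ^ i)) 1 := by
  intro q hq
  have hq' : ‖q ^ i‖ < 1 := by rw [norm_pow]; exact pow_lt_one₀ (norm_nonneg _) hq hi.ne'
  have h1 := h _ hq'
  have hinj : Function.Injective (fun n : ℕ => i * n) :=
    fun a b hab => Nat.eq_of_mul_eq_mul_left hi hab
  rw [← hinj.hasSum_iff (fun x hx => by
    have : ¬ i ∣ x := fun ⟨m, hm⟩ => hx ⟨m, hm.symm⟩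
    simp [_root_.dilate, this])]
  convert h1 using 1
  ext n
  simp [_root_.dilate, Nat.mul_div_cancel_left _ hi, pow_mul]

lemma evalOn_sigmaSeries {χ : ℕ → ℂ} (hχ : ∀ n, ‖χ n‖ ≤ 1) (k : ℕ) :
    EvalOn (sigmaSeries χ k)
      (fun q => ∑' n : ℕ, χ (n + 1) * (ArithmeticFunction.sigma k (n + 1) : ℂ) * q ^ (n + 1)) 1 := by
  intro q hq
  have hs : Summable fun n : ℕ => χ n * (ArithmeticFunction.sigma k n : ℂ) * q ^ n := by
    apply Summable.of_norm_bounded (summable_sigma_mul_pow k hq).norm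
    intro n
    rw [mul_assoc, norm_mul]
    exact mul_le_of_le_one_left (norm_nonneg _) (hχ n)
  have := (hasSum_nat_add_iff' 1 (f := fun n : ℕ => χ n *
    (ArithmeticFunction.sigma k n : ℂ) * q ^ n)).mpr hs.hasSum
  have h2 := this.tsum_eq
  simp only [sigmaSeries, PowerSeries.coeff_mk]
  rw [h2]
  simpa using hs.hasSum

lemma evalOn_const (c : ℂ) (r : ℝ) : EvalOn (PowerSeries.C c) (fun _ => c) r := by
  intro z _
  have := hasSum_single (f := fun n => PowerSeries.coeff n (PowerSeries.C c : ℂ⟦X⟧) * z ^ n) 0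
    (fun n hn => by simp [PowerSeries.coeff_C, hn])
  simpa using this

/-- The expansion of `eis2 i`. -/
def eis2Series (i : ℕ) : ℂ⟦X⟧ :=
  PowerSeries.C (-(1 / 24) * i : ℂ) + (i : ℂ) • dilate i (sigmaSeries 1 1)

/-- The expansion of `eis4 i`. -/
def eis4Series (i : ℕ) : ℂ⟦X⟧ :=
  PowerSeries.C (1 / 240 * (i : ℂ) ^ 2) + ((i : ℂ) ^ 2) • dilate i (sigmaSeries 1 3)

lemma evalOn_eis2 {i : ℕ} (hi : 0 < i) : EvalOn (eis2Series i) (eis2 i) 1 := by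
  refine ((evalOn_const _ _).add (((evalOn_sigmaSeries (χ := 1) (by simp) 1).dilate hi).smul
    (i : ℂ))).congr fun q _ => ?_
  simp only [Pi.add_apply, Pi.smul_apply, smul_eq_mul, Pi.one_apply, one_mul, eis2, ← pow_mul]
  ring

lemma evalOn_eis4 {i : ℕ} (hi : 0 < i) : EvalOn (eis4Series i) (eis4 i) 1 := by
  refine ((evalOn_const _ _).add (((evalOn_sigmaSeries (χ := 1) (by simp) 3).dilate hi).smul
    ((i : ℂ) ^ 2))).congr fun q _ => ?_
  simp only [Pi.add_apply, Pi.smul_apply, smul_eq_mul, Pi.one_apply, one_mul, eis4, ← pow_mul]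
  ring

/-! ### Functions of `q` as functions on the upper half-plane -/

lemma nome_eq_qParam (τ : ℂ) : nome τ = Function.Periodic.qParam 1 τ := by
  simp [nome, Function.Periodic.qParam]

lemma norm_nome (τ : ℂ) : ‖nome τ‖ = Real.exp (-2 * Real.pi * τ.im) := by
  rw [nome_eq_qParam, Function.Periodic.norm_qParam, div_one]

lemma norm_nome_lt_one {τ : ℂ} (h : 0 < τ.im) : ‖nome τ‖ < 1 := by
  rw [norm_nome, Real.exp_lt_one_iff]
  nlinarith [Real.pi_pos]

lemma nome_ne_zero (τ : ℂ) : nome τ ≠ 0 := Complex.exp_ne_zero _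

lemma hasDerivAt_nome (τ : ℂ) :
    HasDerivAt nome (2 * Real.pi * Complex.I * nome τ) τ := by
  have := ((hasDerivAt_id τ).const_mul (2 * Real.pi * Complex.I : ℂ)).cexp
  refine this.congr_deriv ?_
  simp [nome, mul_comm]

lemma exists_nome_eq {q : ℂ} (h0 : q ≠ 0) (h1 : ‖q‖ < 1) : ∃ τ : ℍ, nome τ = q := by
  have him := Function.Periodic.im_invQParam_pos_of_norm_lt_one one_pos h1 h0
  refine ⟨⟨Function.Periodic.invQParam 1 q, him⟩, ?_⟩
  rw [nome_eq_qParam]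
  exact Function.Periodic.qParam_right_inv one_ne_zero h0

/-- A function of `q` as a function on the upper half-plane. -/
def onH (f : ℂ → ℂ) (τ : ℍ) : ℂ := f (nome τ)

lemma normalizedDeriv_onH {f : ℂ → ℂ} (hf : DifferentiableOn ℂ f (Metric.ball 0 1)) :
    normalizedDerivOfComplex (onH f) = onH (thetaFun f) := by
  ext z
  have hz := norm_nome_lt_one z.im_pos
  have hd : DifferentiableAt ℂ f (nome z) :=
    hf.differentiableAt (Metric.isOpen_ball.mem_nhds (by simpa using hz))
  have h1 := hd.hasDerivAt.comp (z : ℂ) (hasDerivAt_nome z)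
  have heq : (onH f) ∘ ofComplex =ᶠ[𝓝 (z : ℂ)] f ∘ nome := by
    filter_upwards [isOpen_upperHalfPlaneSet.mem_nhds z.im_pos] with w hw
    simp [onH, ofComplex_apply_of_im_pos (show 0 < w.im from hw)]
  rw [normalizedDerivOfComplex, (h1.congr_of_eventuallyEq heq).deriv, onH, thetaFun]
  have : (Real.pi : ℂ) ≠ 0 := by exact_mod_cast Real.pi_ne_zero
  have hI := Complex.I_ne_zero
  field_simp

/-- Vanishing criterion for weight four forms in terms of the first five coefficients. -/
lemma EvalOn.eq_zero_of_isModular {N : ℕ} [NeZero N] (hN : (Gamma0 N).index ≤ 14) {p : ℂ⟦X⟧}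
    {G : ℂ → ℂ} (hp : EvalOn p G 1) (hG : IsModular N 4 (onH G))
    (h0 : ∀ n < 5, PowerSeries.coeff n p = 0) {q : ℂ} (hq : ‖q‖ < 1) : G q = 0 := by
  have hO : G =O[𝓝 0] fun q => ‖q‖ ^ 5 := by
    have := (hp.hasFPowerSeriesOnBall one_pos).hasFPowerSeriesAt.isBigO_sub_partialSum_pow 5
    simp only [zero_add, FormalMultilinearSeries.partialSum] at this
    refine this.congr_left fun y => ?_
    rw [Finset.sum_eq_zero, sub_zero]
    intro i hi
    simp [FormalMultilinearSeries.ofScalars, h0 i (Finset.mem_range.mp hi)]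
  have hz : onH G = 0 := by
    refine hG.eq_zero_of_isBigO hN ?_
    have ht : Tendsto (fun τ : ℍ => nome τ) atImInfty (𝓝 0) := by
      simpa only [nome_eq_qParam] using qParam_tendsto_atImInfty one_pos
    refine (hO.comp_tendsto ht).congr (fun _ => rfl) fun τ => ?_
    simp only [Function.comp_apply, norm_nome, ← Real.exp_nat_mul, UpperHalfPlane.coe_im]
    ring_nf
  rcases eq_or_ne q 0 with rfl | hq0
  · have h1 := hp 0 (by simp)
    have h2 := hasSum_single (f := fun n => PowerSeries.coeff n p * (0 : ℂ) ^ n) 0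
      (fun n hn => by simp [hn])
    rw [h1.unique h2, h0 0 (by norm_num), zero_mul]
  · obtain ⟨τ, rfl⟩ := exists_nome_eq hq0 hq
    exact congrFun hz τ

/-! ### Eisenstein series -/

lemma hasSum_unique_of_eq {f g : ℕ → ℂ} {a b : ℂ} (hf : HasSum f a) (hg : HasSum g b)
    (h : ∀ n, f n = g n) : a = b := by
  obtain rfl : f = g := funext h
  exact hf.unique hg

lemma onH_eis2_one : onH (eis2 1) = (-(1 / 24) : ℂ) • E2 := by
  ext τ
  have h1 := evalOn_eis2 one_pos (nome τ) (norm_nome_lt_one τ.im_pos)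
  have h2 := (hasSum_qExpansion_E2 τ).mul_left (-(1 / 24) : ℂ)
  refine hasSum_unique_of_eq h1 h2 fun n => ?_
  rcases eq_or_ne n 0 with rfl | hn
  · simp [eis2Series, dilate, sigmaSeries]
  · simp [eis2Series, dilate, sigmaSeries, hn, nome, PowerSeries.coeff_C]
    ring

lemma onH_eis4_one : onH (eis4 1) = (1 / 240 : ℂ) • ⇑(E (k := 4) (by norm_num)) := by
  ext τ
  have h1 := evalOn_eis4 one_pos (nome τ) (norm_nome_lt_one τ.im_pos)
  have h2 := (hasSum_qExpansion (h := 1) one_pos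
    (SlashInvariantFormClass.periodic_comp_ofComplex (E (k := 4) (by norm_num))
      one_mem_strictPeriods_SL) (E (k := 4) (by norm_num)).holo'
    (OnePoint.isBoundedAt_infty_iff.mp ((E (k := 4) (by norm_num)).bdd_at_cusps'
      (Subgroup.isCusp_of_mem_strictPeriods one_pos one_mem_strictPeriods_SL))) τ).mul_left
      (1 / 240 : ℂ)
  refine hasSum_unique_of_eq h1 h2 fun n => ?_
  have hE : (qExpansion 1 (E (k := 4) (by norm_num))).coeff n = _ :=
    E_qExpansion_coeff (k := 4) (by norm_num) (by decide) n
  change _ = _ * ((qExpansion 1 (E (k := 4) (by norm_num))).coeff n • _)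
  rw [hE, nome_eq_qParam]
  have hb : bernoulli 4 = -1 / 30 := by rw [bernoulli_eq_bernoulli'_of_ne_one (by norm_num)]; norm_num
  rcases eq_or_ne n 0 with rfl | hn
  · simp [eis4Series, dilate, sigmaSeries]
  · simp [eis4Series, dilate, sigmaSeries, hn, PowerSeries.coeff_C, hb]
    ring

lemma eis2_eq {i : ℕ} (q : ℂ) : eis2 i q = i * eis2 1 (q ^ i) := by
  simp only [eis2, ← pow_mul]; push_cast; simp; ring

lemma eis4_eq {i : ℕ} (q : ℂ) : eis4 i q = i ^ 2 * eis4 1 (q ^ i) := by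
  simp only [eis4, ← pow_mul]; push_cast; simp; ring

lemma nome_pow (τ : ℂ) (i : ℕ) : nome τ ^ i = nome (i * τ) := by
  rw [nome, nome, ← Complex.exp_nat_mul]; ring_nf

/-- The factor i in the normalisation makes E_{2,i} exactly −1/24 times the slash of E₂ by diag(i,
1), so the anomaly does not depend on i. -/
lemma isQuasimodular_eis2 {N i : ℕ} (hi : 0 < i) (h : i ∣ N) :
    IsQuasimodular N (-(1 / 24)) (onH (eis2 i)) := by
  have hg : TriGood N i 0 1 := triGood_of_dvd (by exact_mod_cast h)
  have hne : (i : ℤ) * 1 ≠ 0 := by simp [hi.ne']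
  have := (isQuasimodular_E2_slash (by exact_mod_cast hi) one_pos hne hg).smul (-(1 / 24))
  rw [mul_one] at this
  convert this using 1
  ext τ
  have him : 0 < ((i : ℂ) * τ).im := by
    have : (0 : ℝ) < i := by exact_mod_cast hi
    simpa using mul_pos this τ.im_pos
  rw [Pi.smul_apply, slash_triMatrix_apply (by exact_mod_cast hi) one_pos, onH, eis2_eq, nome_pow]
  have h1 := congrFun onH_eis2_one ⟨(i : ℂ) * τ, him⟩
  simp only [onH, Pi.smul_apply, smul_eq_mul] at h1
  rw [h1]
  have h2 : ofComplex (((i : ℤ) * τ + (0 : ℤ)) / (1 : ℤ) : ℂ) = ⟨(i : ℂ) * τ, him⟩ := by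
    rw [← ofComplex_apply_of_im_pos him]; simp
  rw [h2]
  simp
  ring

lemma isModular_eis4 {N i : ℕ} (hi : 0 < i) (h : i ∣ N) : IsModular N 4 (onH (eis4 i)) := by
  have hg : TriGood N i 0 1 := triGood_of_dvd (by exact_mod_cast h)
  have hne : (i : ℤ) * 1 ≠ 0 := by simp [hi.ne']
  have hE : ∀ γ : SL(2, ℤ), (⇑(E (k := 4) (by norm_num)) : ℍ → ℂ) ∣[(4 : ℤ)] γ =
      ⇑(E (k := 4) (by norm_num)) := fun γ =>
    SlashInvariantForm.slash_action_eqn (E (k := 4) (by norm_num)) _ ⟨γ, rfl⟩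
  have hb := OnePoint.isBoundedAt_infty_iff.mp ((E (k := 4) (by norm_num)).bdd_at_cusps'
      (Subgroup.isCusp_of_mem_strictPeriods one_pos one_mem_strictPeriods_SL))
  have := (isModular_slash_triMatrix hne hg (E (k := 4) (by norm_num)).holo' hE hb).smul
    (1 / (240 * i))
  convert this using 1
  ext τ
  have him : 0 < ((i : ℂ) * τ).im := by
    have : (0 : ℝ) < i := by exact_mod_cast hi
    simpa using mul_pos this τ.im_pos
  rw [Pi.smul_apply, slash_triMatrix_apply (by exact_mod_cast hi) one_pos, onH, eis4_eq, nome_pow]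
  have h1 := congrFun onH_eis4_one ⟨(i : ℂ) * τ, him⟩
  simp only [onH, Pi.smul_apply, smul_eq_mul] at h1
  rw [h1]
  have h2 : ofComplex (((i : ℤ) * τ + (0 : ℤ)) / (1 : ℤ) : ℂ) = ⟨(i : ℂ) * τ, him⟩ := by
    rw [← ofComplex_apply_of_im_pos him]; simp
  rw [h2]
  have : (i : ℂ) ≠ 0 := by exact_mod_cast hi.ne'
  simp
  field_simp

/-! ### Twisted Eisenstein series of level nine -/

/-- The quadratic character modulo three. -/
def chi3 (n : ℕ) : ℂ := (legendreSym 3 (n : ℤ) : ℂ)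

lemma chi3_eq (n : ℕ) : chi3 n = if n % 3 = 0 then 0 else if n % 3 = 1 then 1 else -1 := by
  have h : legendreSym 3 (n : ℤ) = legendreSym 3 ((n % 3 : ℕ) : ℤ) := by
    rw [legendreSym.mod]; norm_cast
  rw [chi3, h]
  have h3 : n % 3 < 3 := Nat.mod_lt _ (by norm_num)
  have e0 : legendreSym 3 ((0 : ℕ) : ℤ) = 0 := by decide
  have e1 : legendreSym 3 ((1 : ℕ) : ℤ) = 1 := by decide
  have e2 : legendreSym 3 ((2 : ℕ) : ℤ) = -1 := by decide
  interval_cases n % 3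
  · rw [e0]; simp
  · rw [e1]; simp
  · rw [e2]; simp

lemma norm_chi3_le (n : ℕ) : ‖chi3 n‖ ≤ 1 := by
  rw [chi3_eq]; split_ifs <;> simp

/-- A primitive cube root of unity. -/
def omega3 : ℂ := nome (1 / 3)

lemma omega3_eq : omega3 = -(1 / 2) + Real.sqrt 3 / 2 * Complex.I := by
  have h : (2 * Real.pi * Complex.I * (1 / 3) : ℂ) = ((Real.pi - Real.pi / 3 : ℝ) : ℂ) *
      Complex.I := by
    push_cast; ring
  rw [omega3, nome, h, Complex.exp_mul_I, ← Complex.ofReal_cos, ← Complex.ofReal_sin,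
    Real.cos_pi_sub, Real.sin_pi_sub, Real.cos_pi_div_three, Real.sin_pi_div_three]
  push_cast
  ring

lemma sqrt_three_sq : ((Real.sqrt 3 : ℝ) : ℂ) ^ 2 = 3 := by
  rw [← Complex.ofReal_pow, Real.sq_sqrt (by norm_num)]; norm_num

lemma omega3_sq : omega3 ^ 2 = -1 - omega3 := by
  rw [omega3_eq]
  linear_combination (1 / 4 * Complex.I ^ 2) * sqrt_three_sq + 3 / 4 * Complex.I_sq

lemma omega3_pow_three : omega3 ^ 3 = 1 := by
  linear_combination (omega3 - 1) * omega3_sq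

/-- The Gauss sum of the quadratic character modulo 3, which expresses twisting as a difference of
the two translates by ±1/3. -/
lemma omega3_pow_sub (n : ℕ) :
    omega3 ^ n - (omega3 ^ 2) ^ n = Real.sqrt 3 * Complex.I * chi3 n := by
  have h1 : ∀ m r : ℕ, omega3 ^ (3 * m + r) = omega3 ^ r := fun m r => by
    rw [pow_add, pow_mul, omega3_pow_three, one_pow, one_mul]
  have h2 : ∀ m r : ℕ, (omega3 ^ 2) ^ (3 * m + r) = (omega3 ^ 2) ^ r := fun m r => by
    have : (omega3 ^ 2) ^ 3 = 1 := by rw [← pow_mul, mul_comm, pow_mul, omega3_pow_three, one_pow]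
    rw [pow_add, pow_mul, this, one_pow, one_mul]
  have h3 : n % 3 < 3 := Nat.mod_lt _ (by norm_num)
  rw [chi3_eq, ← Nat.div_add_mod n 3, h1, h2, Nat.div_add_mod]
  interval_cases n % 3
  · simp
  · rw [pow_one, pow_one, omega3_sq, omega3_eq]
    norm_num
    ring
  · rw [omega3_sq]
    norm_num
    rw [show (-1 - omega3) ^ 2 = 1 + 2 * omega3 + omega3 ^ 2 by ring, omega3_sq, omega3_eq]
    ring

/-- The weight two twisted Eisenstein series of level nine. -/
def twist2 (q : ℂ) : ℂ :=
  ∑' n : ℕ, chi3 (n + 1) * (ArithmeticFunction.sigma 1 (n + 1) : ℂ) * q ^ (n + 1)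

lemma evalOn_twist2 : EvalOn (sigmaSeries chi3 1) twist2 1 := evalOn_sigmaSeries norm_chi3_le 1

lemma evalOn_formF_V18 : EvalOn (sigmaSeries chi3 3) (MukaiCase.formF .V18) 1 :=
  evalOn_sigmaSeries norm_chi3_le 3

lemma nome_add (a b : ℂ) : nome (a + b) = nome a * nome b := by
  rw [nome, nome, nome, ← Complex.exp_add]; ring_nf

lemma nome_neg_third : nome (-1 / 3) = omega3 ^ 2 := by
  have h : nome (-1 / 3) * omega3 = 1 := by
    rw [omega3, ← nome_add]; norm_num [nome]
  have h0 : omega3 ≠ 0 := nome_ne_zero _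
  apply mul_right_cancel₀ h0
  rw [h]
  linear_combination -omega3_pow_three

lemma twist_of_evalOn {k : ℕ} {p : ℂ⟦X⟧} {f : ℂ → ℂ} {s : ℂ} (hp : EvalOn p f 1)
    (hs : ∀ n ≠ 0, PowerSeries.coeff n p = s * (ArithmeticFunction.sigma k n : ℂ)) {T : ℂ → ℂ}
    (hT : EvalOn (sigmaSeries chi3 k) T 1) {q : ℂ} (hq : ‖q‖ < 1) :
    f (omega3 * q) - f (omega3 ^ 2 * q) = s * (Real.sqrt 3 * Complex.I) * T q := by
  have hn : ‖omega3‖ = 1 := by rw [omega3, norm_nome]; simp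
  have h1 := hp (omega3 * q) (by rwa [norm_mul, hn, one_mul])
  have h2 := hp (omega3 ^ 2 * q) (by rwa [norm_mul, norm_pow, hn, one_pow, one_mul])
  refine hasSum_unique_of_eq (h1.sub h2) ((hT q hq).mul_left _) fun n => ?_
  rcases eq_or_ne n 0 with rfl | h0
  · simp [sigmaSeries]
  · rw [hs n h0, sigmaSeries, PowerSeries.coeff_mk, mul_pow, mul_pow]
    linear_combination (s * (ArithmeticFunction.sigma k n : ℂ) * q ^ n) * omega3_pow_sub n

lemma twist2_eq {q : ℂ} (hq : ‖q‖ < 1) :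
    eis2 1 (omega3 * q) - eis2 1 (omega3 ^ 2 * q) = Real.sqrt 3 * Complex.I * twist2 q := by
  rw [twist_of_evalOn (evalOn_eis2 one_pos) (s := 1) (k := 1) _ evalOn_twist2 hq, one_mul]
  intro n hn
  simp [eis2Series, dilate, sigmaSeries, PowerSeries.coeff_C, hn]

lemma formF_V18_eq {q : ℂ} (hq : ‖q‖ < 1) :
    eis4 1 (omega3 * q) - eis4 1 (omega3 ^ 2 * q) =
      Real.sqrt 3 * Complex.I * MukaiCase.formF .V18 q := by
  rw [twist_of_evalOn (evalOn_eis4 one_pos) (s := 1) (k := 3) _ evalOn_formF_V18 hq, one_mul]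
  intro n hn
  simp [eis4Series, dilate, sigmaSeries, PowerSeries.coeff_C, hn]

lemma sqrt_three_mul_I_ne_zero : (Real.sqrt 3 * Complex.I : ℂ) ≠ 0 := by
  refine mul_ne_zero ?_ Complex.I_ne_zero
  exact_mod_cast (Real.sqrt_pos.mpr (by norm_num : (0 : ℝ) < 3)).ne'

lemma slash_third_apply {ε : ℤ} (h : (3 : ℤ) * 3 ≠ 0) (k : ℤ) (f : ℍ → ℂ) {g : ℂ → ℂ} {s : ℂ}
    (hfg : onH g = s • f) (τ : ℍ) :
    s * (f ∣[k] ((triMatrix 3 ε 3 h).map (Rat.castHom ℝ))) τ =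
      g (nome (ε / 3) * nome τ) * 9 ^ (k - 1) * 3 ^ (-k) := by
  have him : 0 < ((ε / 3 : ℂ) + τ).im := by
    have : (ε / 3 : ℂ) = ((ε / 3 : ℝ) : ℂ) := by push_cast; rfl
    rw [this]
    simpa using τ.im_pos
  rw [slash_triMatrix_apply (by norm_num) (by norm_num), ← nome_add]
  have h1 := congrFun hfg ⟨(ε / 3 : ℂ) + τ, him⟩
  simp only [onH, Pi.smul_apply, smul_eq_mul] at h1
  have h2 : ofComplex (((3 : ℤ) * τ + (ε : ℤ)) / (3 : ℤ) : ℂ) = ⟨(ε / 3 : ℂ) + τ, him⟩ := by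
    rw [← ofComplex_apply_of_im_pos him]
    congr 1
    push_cast
    field_simp
    ring
  rw [h2, h1]
  push_cast
  norm_num
  ring

/-- The translates of E₂ by 1/3 and −1/3 have the same anomaly under Γ₀(9), so it drops out of their
difference. -/
lemma isQuasimodular_twist2 : IsQuasimodular 9 0 (onH twist2) := by
  have h9 : (3 : ℤ) * 3 ≠ 0 := by norm_num
  have h1 := isQuasimodular_E2_slash (by norm_num) (by norm_num) h9 (triGood_nine (Or.inl rfl))
  have h2 := isQuasimodular_E2_slash (by norm_num) (by norm_num) h9 (triGood_nine (Or.inr rfl))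
  have := ((h1.smul (-(1 / 24))).add (h2.smul (1 / 24))).smul ((Real.sqrt 3 * Complex.I : ℂ)⁻¹)
  convert this using 1
  · ring
  · ext τ
    have e1 := slash_third_apply (ε := 1) h9 2 E2 onH_eis2_one τ
    have e2 := slash_third_apply (ε := -1) h9 2 E2 onH_eis2_one τ
    simp only [Pi.smul_apply, Pi.add_apply, smul_eq_mul]
    rw [eq_inv_mul_iff_mul_eq₀ sqrt_three_mul_I_ne_zero, onH,
      ← twist2_eq (norm_nome_lt_one τ.im_pos), e1]
    rw [neg_mul, neg_eq_iff_eq_neg] at e2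
    rw [e2]
    have h3 : nome (((-1 : ℤ) : ℂ) / 3) = omega3 ^ 2 := by push_cast; exact nome_neg_third
    have h4 : nome (((1 : ℤ) : ℂ) / 3) = omega3 := by push_cast; rfl
    rw [h3, h4]
    norm_num
    ring

lemma isModular_formF_V18 : IsModular 9 4 (onH (MukaiCase.formF .V18)) := by
  have h9 : (3 : ℤ) * 3 ≠ 0 := by norm_num
  have hE : ∀ γ : SL(2, ℤ), (⇑(E (k := 4) (by norm_num)) : ℍ → ℂ) ∣[(4 : ℤ)] γ =
      ⇑(E (k := 4) (by norm_num)) := fun γ =>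
    SlashInvariantForm.slash_action_eqn (E (k := 4) (by norm_num)) _ ⟨γ, rfl⟩
  have hb := OnePoint.isBoundedAt_infty_iff.mp ((E (k := 4) (by norm_num)).bdd_at_cusps'
      (Subgroup.isCusp_of_mem_strictPeriods one_pos one_mem_strictPeriods_SL))
  have hm := (E (k := 4) (by norm_num)).holo'
  have h1 := isModular_slash_triMatrix h9 (triGood_nine (Or.inl rfl)) hm hE hb
  have h2 := isModular_slash_triMatrix h9 (triGood_nine (Or.inr rfl)) hm hE hb
  have := ((h1.smul (1 / 240)).sub (h2.smul (1 / 240))).smul (9 * (Real.sqrt 3 * Complex.I : ℂ))⁻¹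
  convert this using 1
  ext τ
  have e1 := slash_third_apply (ε := 1) h9 4 _ onH_eis4_one τ
  have e2 := slash_third_apply (ε := -1) h9 4 _ onH_eis4_one τ
  simp only [Pi.smul_apply, Pi.sub_apply, smul_eq_mul]
  rw [eq_inv_mul_iff_mul_eq₀ (mul_ne_zero (by norm_num) sqrt_three_mul_I_ne_zero), onH, mul_assoc,
      ← formF_V18_eq (norm_nome_lt_one τ.im_pos)]
  have h3 : nome (((-1 : ℤ) : ℂ) / 3) = omega3 ^ 2 := by push_cast; exact nome_neg_third
  have h4 : nome (((1 : ℤ) : ℂ) / 3) = omega3 := by push_cast; rfl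
  rw [h4] at e1
  rw [h3] at e2
  refine Eq.trans ?_ (congrArg₂ (· - ·) e1.symm e2.symm)
  norm_num
  ring

/-! ### First coefficients of power series -/

/-- The first five coefficients of `p` are those of `a`. -/
def FirstCoeffs (p : ℂ⟦X⟧) (a : ℕ → ℂ) : Prop := ∀ n < 5, PowerSeries.coeff n p = a n

/-- The Cauchy product of two sequences. -/
def conv (a b : ℕ → ℂ) (n : ℕ) : ℂ := ∑ k ∈ Finset.range (n + 1), a k * b (n - k)

lemma FirstCoeffs.mul {p p' : ℂ⟦X⟧} {a a' : ℕ → ℂ} (h : FirstCoeffs p a)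
    (h' : FirstCoeffs p' a') : FirstCoeffs (p * p') (conv a a') := by
  intro n hn
  rw [PowerSeries.coeff_mul, Finset.Nat.sum_antidiagonal_eq_sum_range_succ_mk]
  refine Finset.sum_congr rfl fun k hk => ?_
  have := Finset.mem_range.mp hk
  rw [h k (by omega), h' (n - k) (by omega)]

lemma coeff_eis2Series {i : ℕ} (n : ℕ) : PowerSeries.coeff n (eis2Series i) =
    (if n = 0 then (-(1 / 24) * i : ℂ) else 0) +
      i * if i ∣ n then (ArithmeticFunction.sigma 1 (n / i) : ℂ) else 0 := by
  simp only [eis2Series, map_add, PowerSeries.coeff_smul, PowerSeries.coeff_C, dilate,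
    PowerSeries.coeff_mk, sigmaSeries, smul_eq_mul, Pi.one_apply, one_mul]

lemma coeff_eis4Series {i : ℕ} (n : ℕ) : PowerSeries.coeff n (eis4Series i) =
    (if n = 0 then (1 / 240 * (i : ℂ) ^ 2 : ℂ) else 0) +
      i ^ 2 * if i ∣ n then (ArithmeticFunction.sigma 3 (n / i) : ℂ) else 0 := by
  simp only [eis4Series, map_add, PowerSeries.coeff_smul, PowerSeries.coeff_C, dilate,
    PowerSeries.coeff_mk, sigmaSeries, smul_eq_mul, Pi.one_apply, one_mul]

/-! ### Quadratic relations -/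

/-- The differential and algebraic relations between `Φ`, `tΦ`, the logarithmic derivatives
`w` of `t` and `u` of `Φ`, and `F`. -/
structure Relations (al be ka : ℤ) (phi psi w u F : ℂ → ℂ) : Prop where
  theta_phi : ∀ q, ‖q‖ < 1 → thetaFun phi q = u q * phi q
  theta_psi : ∀ q, ‖q‖ < 1 → thetaFun psi q = (u q + w q) * psi q
  w_sq : ∀ q, ‖q‖ < 1 → w q ^ 2 = phi q ^ 2 - 2 * al * phi q * psi q + ka * psi q ^ 2
  F_eq : ∀ q, ‖q‖ < 1 → F q = w q * psi q
  theta_u : ∀ q, ‖q‖ < 1 →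
    2 * thetaFun u q - u q ^ 2 = 2 * be * phi q * psi q - ka * psi q ^ 2

lemma serreDerivative_onH {f : ℂ → ℂ} (hf : DifferentiableOn ℂ f (Metric.ball 0 1)) (k : ℂ)
    (τ : ℍ) : Derivative.serreDerivative k (onH f) τ =
      thetaFun f (nome τ) + 2 * k * eis2 1 (nome τ) * f (nome τ) := by
  have h := congrFun onH_eis2_one τ
  simp only [onH, Pi.smul_apply, smul_eq_mul] at h
  rw [serreDerivative_apply, normalizedDeriv_onH hf, onH, onH, h]
  ring

lemma IsModular.congr {N : ℕ} {k l : ℤ} {f g : ℍ → ℂ} (hf : IsModular N k f) (hk : k = l)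
    (h : ∀ τ, f τ = g τ) : IsModular N l g := by
  obtain rfl : f = g := funext h
  exact hk ▸ hf

lemma IsModular.mul_self_weight {N : ℕ} {f g : ℍ → ℂ} (hf : IsModular N 2 f)
    (hg : IsModular N 2 g) : IsModular N 4 (f * g) :=
  IsModular.congr (k := 2 + 2) (hf.mul hg) (by norm_num) fun _ => rfl

lemma IsModular.serreDerivative_two {N : ℕ} {f : ℍ → ℂ} (hf : IsModular N 2 f) :
    IsModular N 4 (Derivative.serreDerivative 2 f) :=
  IsModular.congr (k := 2 + 2) hf.serreDerivative (by norm_num) fun _ => rfl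

/-- The two sides of a relation need not be modular separately. It suffices that f − g is the
difference of two modular forms f' and g', which leaves room for E₂ corrections common to both
sides. -/
lemma EvalOn.eq_of_isModular {N : ℕ} [NeZero N] (hN : (Gamma0 N).index ≤ 14) {p p' : ℂ⟦X⟧}
    {f g : ℂ → ℂ} (hp : EvalOn p f 1) (hp' : EvalOn p' g 1)
    {f' g' : ℍ → ℂ} (hf : IsModular N 4 f') (hg : IsModular N 4 g')
    (h : ∀ τ : ℍ, f' τ - g' τ = f (nome τ) - g (nome τ))
    (h0 : ∀ n < 5, PowerSeries.coeff n p = PowerSeries.coeff n p') {q : ℂ} (hq : ‖q‖ < 1) :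
    f q = g q := by
  refine sub_eq_zero.mp ((hp.sub hp').eq_zero_of_isModular hN
    ((hf.sub hg).congr rfl fun τ => ?_) (fun n hn => ?_) hq)
  · simp only [Pi.sub_apply, h, onH]
  · rw [map_sub, h0 n hn, sub_self]

/-- Adding 4·E_{2,1}·f to both sides turns θf into a Serre derivative and u into u + 4·E_{2,1},
whose anomaly 1/6 − 4/24 vanishes. -/
lemma theta_eq_mul_of_coeffs {N : ℕ} [NeZero N] (hN : (Gamma0 N).index ≤ 14)
    {f u : ℂ → ℂ} {pf pu : ℂ⟦X⟧} {a d : ℕ → ℂ}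
    (hf : EvalOn pf f 1) (hu : EvalOn pu u 1)
    (mf : IsQuasimodular N 0 (onH f)) (mu : IsQuasimodular N (1 / 6) (onH u))
    (ca : FirstCoeffs pf a) (cd : FirstCoeffs pu d)
    (h : ∀ n < 5, n * a n = conv d a n) {q : ℂ} (hq : ‖q‖ < 1) :
    thetaFun f q = u q * f q := by
  have m1 := (mu.add ((isQuasimodular_eis2 one_pos (one_dvd N)).smul 4)).isModular (by norm_num)
  refine hf.theta.eq_of_isModular hN (hu.mul hf) (mf.isModular rfl).serreDerivative_two
    (m1.mul_self_weight (mf.isModular rfl)) (fun τ => ?_) (fun n hn => ?_) hq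
  · rw [serreDerivative_onH hf.differentiableOn]
    simp only [onH, Pi.mul_apply, Pi.add_apply, Pi.smul_apply, smul_eq_mul]
    ring
  · rw [coeff_theta, (cd.mul ca) n hn, ca n hn, h n hn]

lemma w_sq_of_coeffs {N : ℕ} [NeZero N] (hN : (Gamma0 N).index ≤ 14) (al ka : ℂ)
    {phi psi w : ℂ → ℂ} {pphi ppsi pw : ℂ⟦X⟧} {a b c : ℕ → ℂ}
    (hphi : EvalOn pphi phi 1) (hpsi : EvalOn ppsi psi 1) (hw : EvalOn pw w 1)
    (mphi : IsModular N 2 (onH phi)) (mpsi : IsModular N 2 (onH psi))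
    (mw : IsModular N 2 (onH w))
    (ca : FirstCoeffs pphi a) (cb : FirstCoeffs ppsi b) (cc : FirstCoeffs pw c)
    (h : ∀ n < 5, conv c c n = conv a a n - 2 * al * conv a b n + ka * conv b b n)
    {q : ℂ} (hq : ‖q‖ < 1) :
    w q ^ 2 = phi q ^ 2 - 2 * al * phi q * psi q + ka * psi q ^ 2 := by
  have := (hw.mul hw).eq_of_isModular hN (((hphi.mul hphi).sub ((hphi.mul hpsi).smul (2 * al))).add
      ((hpsi.mul hpsi).smul ka)) (mw.mul_self_weight mw)
      (((mphi.mul_self_weight mphi).sub ((mphi.mul_self_weight mpsi).smul (2 * al))).add ((mpsi.mul_self_weight mpsi).smul ka))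
      (fun τ => rfl) (fun n hn => ?_) hq
  · simp only [Pi.sub_apply, Pi.add_apply, Pi.mul_apply, Pi.smul_apply, smul_eq_mul] at this
    linear_combination this
  · simp only [map_sub, map_add, PowerSeries.coeff_smul, smul_eq_mul, (cc.mul cc) n hn,
      (ca.mul ca) n hn, (ca.mul cb) n hn, (cb.mul cb) n hn, h n hn]

lemma thetaFun_add_smul {f g : ℂ → ℂ} {q : ℂ} (c : ℂ) (hf : DifferentiableAt ℂ f q)
    (hg : DifferentiableAt ℂ g q) : thetaFun (f + c • g) q = thetaFun f q + c * thetaFun g q := by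
  simp only [thetaFun]
  rw [deriv_add hf (hg.const_smul _), deriv_const_smul _ hg, smul_eq_mul]
  ring

lemma theta_u_of_coeffs {N : ℕ} [NeZero N] (hN : (Gamma0 N).index ≤ 14) (be ka : ℂ)
    {phi psi u : ℂ → ℂ} {pphi ppsi pu : ℂ⟦X⟧} {a b d : ℕ → ℂ}
    (hphi : EvalOn pphi phi 1) (hpsi : EvalOn ppsi psi 1) (hu : EvalOn pu u 1)
    (mphi : IsModular N 2 (onH phi)) (mpsi : IsModular N 2 (onH psi))
    (mu : IsQuasimodular N (1 / 6) (onH u))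
    (ca : FirstCoeffs pphi a) (cb : FirstCoeffs ppsi b) (cd : FirstCoeffs pu d)
    (h : ∀ n < 5, 2 * (n * d n) - conv d d n = 2 * be * conv a b n - ka * conv b b n)
    {q : ℂ} (hq : ‖q‖ < 1) :
    2 * thetaFun u q - u q ^ 2 = 2 * be * phi q * psi q - ka * psi q ^ 2 := by
  have e1 : EvalOn _ (eis2 1) 1 := evalOn_eis2 one_pos
  have hE2 : E2 = onH ((fun _ => 0) + (-24 : ℂ) • eis2 1) := by
    have : onH ((fun _ => 0) + (-24 : ℂ) • eis2 1) = (-24 : ℂ) • onH (eis2 1) := by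
      ext τ; simp [onH]
    rw [this, onH_eis2_one, smul_smul]; norm_num
  have m0 := isModular_serreDerivative_E2 N
  have m1 : IsModular N 2 (onH (u + (4 : ℂ) • eis2 1)) :=
    (mu.add ((isQuasimodular_eis2 one_pos (one_dvd N)).smul 4)).isModular (by norm_num)
  have e2 := ((evalOn_const 0 1).add (e1.smul (-24))).differentiableOn
  -- With U = u + 4·E_{2,1} modular of weight two, the modular expression for the left side is twice
  -- the Serre derivative of U, minus U², plus (θE₂ − E₂²/12)/3. As E₂ = −24·E_{2,1}, all terms
  -- containing E_{2,1} cancel and 2θu − u² remains.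
  have := ((hu.theta.smul 2).sub (hu.mul hu)).eq_of_isModular hN
      (((hphi.mul hpsi).smul (2 * be)).sub ((hpsi.mul hpsi).smul ka))
      (((m1.serreDerivative_two.smul 2).sub (m1.mul_self_weight m1)).add (m0.smul (1 / 3)))
      (((mphi.mul_self_weight mpsi).smul (2 * be)).sub ((mpsi.mul_self_weight mpsi).smul ka))
      (fun τ => ?_) (fun n hn => ?_) hq
  · simp only [Pi.sub_apply, Pi.mul_apply, Pi.smul_apply, smul_eq_mul] at this
    linear_combination this
  · have hq' := norm_nome_lt_one τ.im_pos
    have hat : ∀ {p f}, EvalOn p f 1 → DifferentiableAt ℂ f (nome τ) := fun h =>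
      h.differentiableOn.differentiableAt (Metric.isOpen_ball.mem_nhds (by simpa using hq'))
    rw [hE2]
    simp only [Pi.sub_apply, Pi.mul_apply, Pi.add_apply, Pi.smul_apply, smul_eq_mul]
    rw [serreDerivative_onH (hu.add (e1.smul 4)).differentiableOn, serreDerivative_onH e2,
      thetaFun_add_smul _ (hat hu) (hat e1),
      thetaFun_add_smul _ (differentiableAt_const (0 : ℂ)) (hat e1)]
    have h0 : thetaFun (fun _ => (0 : ℂ)) (nome τ) = 0 := by simp [thetaFun]
    simp only [onH, Pi.add_apply, Pi.smul_apply, smul_eq_mul, h0]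
    ring
  · have hcu : FirstCoeffs (theta pu) fun n => n * d n := fun n hn => by
      rw [coeff_theta, cd n hn]
    simp only [map_sub, PowerSeries.coeff_smul, smul_eq_mul, hcu n hn, (cd.mul cd) n hn,
      (ca.mul cb) n hn, (cb.mul cb) n hn]
    exact h n hn

lemma relations_of_coeffs {N : ℕ} [NeZero N] (hN : (Gamma0 N).index ≤ 14) (al be ka : ℤ)
    {phi psi w u F : ℂ → ℂ} {pphi ppsi pw pu pF : ℂ⟦X⟧} {a b c d e : ℕ → ℂ}
    (hphi : EvalOn pphi phi 1) (hpsi : EvalOn ppsi psi 1) (hw : EvalOn pw w 1)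
    (hu : EvalOn pu u 1) (hF : EvalOn pF F 1)
    (mphi : IsQuasimodular N 0 (onH phi)) (mpsi : IsQuasimodular N 0 (onH psi))
    (mw : IsQuasimodular N 0 (onH w)) (mu : IsQuasimodular N (1 / 6) (onH u))
    (mF : IsModular N 4 (onH F))
    (ca : FirstCoeffs pphi a) (cb : FirstCoeffs ppsi b) (cc : FirstCoeffs pw c)
    (cd : FirstCoeffs pu d) (ce : FirstCoeffs pF e)
    (h1 : ∀ n < 5, n * a n = conv d a n)
    (h2 : ∀ n < 5, n * b n = conv (d + c) b n)
    (h3 : ∀ n < 5, conv c c n = conv a a n - 2 * al * conv a b n + ka * conv b b n)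
    (h4 : ∀ n < 5, e n = conv c b n)
    (h5 : ∀ n < 5, 2 * (n * d n) - conv d d n = 2 * be * conv a b n - ka * conv b b n) :
    Relations al be ka phi psi w u F := by
  have nphi := mphi.isModular rfl
  have npsi := mpsi.isModular rfl
  have nw := mw.isModular rfl
  refine ⟨fun q hq => theta_eq_mul_of_coeffs hN hphi hu mphi mu ca cd h1 hq, fun q hq => ?_,
    fun q hq => w_sq_of_coeffs hN al ka hphi hpsi hw nphi npsi nw ca cb cc h3 hq,
    fun q hq => ?_, fun q hq => theta_u_of_coeffs hN be ka hphi hpsi hu nphi npsi mu ca cb cd h5 hq⟩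
  · have muw : IsQuasimodular N (1 / 6) (onH (u + w)) := by
      have := mu.add mw
      rwa [add_zero] at this
    refine theta_eq_mul_of_coeffs hN hpsi (hu.add hw) mpsi muw cb (d := d + c) ?_ h2 hq
    intro n hn
    rw [map_add, cd n hn, cc n hn, Pi.add_apply]
  · exact hF.eq_of_isModular hN (hw.mul hpsi) mF (nw.mul_self_weight npsi) (fun τ => rfl)
      (fun n hn => by rw [(cc.mul cb) n hn, ce n hn, h4 n hn]) hq

/-! ### The forms attached to the three cases -/

lemma IsQuasimodular.congr {N : ℕ} {s s' : ℂ} {f g : ℍ → ℂ} (hf : IsQuasimodular N s f)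
    (hs : s = s') (h : ∀ τ, f τ = g τ) : IsQuasimodular N s' g := by
  obtain rfl : f = g := funext h
  exact hs ▸ hf

/-- Linear combination of weight two Eisenstein series of level `N`. -/
def eisComb (N : ℕ) (c : ℕ → ℂ) (q : ℂ) : ℂ := ∑ i ∈ N.divisors, c i * eis2 i q

/-- The expansion of `eisComb`. -/
def eisCombSeries (N : ℕ) (c : ℕ → ℂ) : ℂ⟦X⟧ := ∑ i ∈ N.divisors, c i • eis2Series i

lemma evalOn_eisComb (N : ℕ) (c : ℕ → ℂ) : EvalOn (eisCombSeries N c) (eisComb N c) 1 := by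
  intro z hz
  have := hasSum_sum (s := N.divisors)
    fun i hi => (((evalOn_eis2 (Nat.pos_of_mem_divisors hi)).smul (c i)) z hz)
  simpa [eisCombSeries, eisComb, Finset.sum_mul] using this

lemma isQuasimodular_eisComb (N : ℕ) (c : ℕ → ℂ) :
    IsQuasimodular N (-(1 / 24) * ∑ i ∈ N.divisors, c i) (onH (eisComb N c)) := by
  suffices h : ∀ s : Finset ℕ, s ⊆ N.divisors → IsQuasimodular N (-(1 / 24) * ∑ i ∈ s, c i)
      (onH fun q => ∑ i ∈ s, c i * eis2 i q) from h _ subset_rfl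
  intro s
  induction s using Finset.induction_on with
  | empty =>
    intro _
    have := (isQuasimodular_eis2 one_pos (one_dvd N)).smul 0
    exact this.congr (by simp) fun τ => by simp [onH]
  | insert i s hi ih =>
    intro hs
    have hi' := hs (Finset.mem_insert_self i s)
    have := ((isQuasimodular_eis2 (Nat.pos_of_mem_divisors hi') (Nat.dvd_of_mem_divisors hi')).smul
      (c i)).add (ih ((Finset.subset_insert i s).trans hs))
    refine this.congr ?_ fun τ => ?_
    · rw [Finset.sum_insert hi]; ring
    · simp [onH, Finset.sum_insert hi]

lemma coeff_eisCombSeries (N : ℕ) (c : ℕ → ℂ) (n : ℕ) : PowerSeries.coeff n (eisCombSeries N c) =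
    ∑ i ∈ N.divisors, c i * ((if n = 0 then (-(1 / 24) * i : ℂ) else 0) +
      i * if i ∣ n then (ArithmeticFunction.sigma 1 (n / i) : ℂ) else 0) := by
  simp only [eisCombSeries, map_sum, PowerSeries.coeff_smul, coeff_eis2Series, smul_eq_mul]

lemma coeff_sigmaSeries (χ : ℕ → ℂ) (k n : ℕ) : PowerSeries.coeff n (sigmaSeries χ k) =
    χ n * (ArithmeticFunction.sigma k n : ℂ) := PowerSeries.coeff_mk _ _

lemma divisors_six : Nat.divisors 6 = {1, 2, 3, 6} := by decide
lemma divisors_eight : Nat.divisors 8 = {1, 2, 4, 8} := by decide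
lemma divisors_nine : Nat.divisors 9 = {1, 3, 9} := by decide

lemma sigma_one_two : ArithmeticFunction.sigma 1 2 = 3 := by decide
lemma sigma_one_three : ArithmeticFunction.sigma 1 3 = 4 := by decide
lemma sigma_one_four : ArithmeticFunction.sigma 1 4 = 7 := by decide
lemma sigma_three_two : ArithmeticFunction.sigma 3 2 = 9 := by decide
lemma sigma_three_three : ArithmeticFunction.sigma 3 3 = 28 := by decide
lemma sigma_three_four : ArithmeticFunction.sigma 3 4 = 73 := by decide

/-- The sequence with finitely many nonzero terms listed in `l`. -/
def listSeq (l : List ℂ) (n : ℕ) : ℂ := l.getD n 0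

namespace MukaiCase

/-- The operator is `D³ - t (1 + 2 D) (al D² + al D + be) + ka t² (D + 1)³`. -/
def al : MukaiCase → ℤ
  | V12 => 17
  | V16 => 12
  | V18 => 9

/-- See `MukaiCase.al`. -/
def be : MukaiCase → ℤ
  | V12 => 5
  | V16 => 4
  | V18 => 3

/-- See `MukaiCase.al`. -/
def ka : MukaiCase → ℤ
  | V12 => 1
  | V16 => 16
  | V18 => -27

/-- The coefficients of `Φ` in terms of Eisenstein series. -/
def phiCoeff : MukaiCase → ℕ → ℂ
  | V12, i => if i = 1 then 5 else if i = 2 then -1 else if i = 3 then 1 else -5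
  | V16, i => if i = 1 then 4 else if i = 2 then -2 else if i = 4 then 2 else -4
  | V18, i => if i = 1 then 3 else if i = 3 then 0 else -3

/-- The coefficients of `w = θt / t` in terms of Eisenstein series. -/
def wCoeff : MukaiCase → ℕ → ℂ
  | V12, i => if i = 1 then -12 else if i = 2 then 12 else if i = 3 then 12 else -12
  | V16, i => if i = 1 then -8 else if i = 2 then 8 else if i = 4 then 8 else -8
  | V18, i => if i = 1 then -6 else if i = 3 then 12 else -6

/-- The coefficients of `u = θΦ / Φ` in terms of Eisenstein series. -/
def uCoeff : MukaiCase → ℕ → ℂ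
  | V12, i => if i = 1 then 5 else if i = 2 then -7 else if i = 3 then -7 else 5
  | V16, i => if i = 1 then 4 else if i = 2 then -6 else if i = 4 then -6 else 4
  | V18, i => if i = 1 then 3 else if i = 3 then -10 else 3

/-- The coefficients of `tΦ` in terms of Eisenstein series, for `V12` and `V16`. -/
def psiCoeff : MukaiCase → ℕ → ℂ
  | V12, i => if i = 1 then 1 else if i = 2 then -5 else if i = 3 then 5 else -1
  | V16, i => if i = 1 then 1 else if i = 2 then -7 / 2 else if i = 4 then 7 / 2 else -1
  | V18, _ => 0

/-- The weight two form `t Φ`. -/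
def psi : MukaiCase → ℂ → ℂ
  | V12 => eisComb 6 (psiCoeff V12)
  | V16 => eisComb 8 (psiCoeff V16)
  | V18 => twist2

/-- The logarithmic derivative of `t`. -/
def w (v : MukaiCase) : ℂ → ℂ := eisComb v.level v.wCoeff

/-- The logarithmic derivative of `Φ`. -/
def u (v : MukaiCase) : ℂ → ℂ := eisComb v.level v.uCoeff

instance (v : MukaiCase) : NeZero v.level := ⟨by cases v <;> simp [level]⟩

lemma index_Gamma0_level (v : MukaiCase) : (Gamma0 v.level).index ≤ 14 := by
  cases v
  exacts [index_Gamma0_six, index_Gamma0_eight, index_Gamma0_nine]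

lemma phi_eq (v : MukaiCase) : v.phi = eisComb v.level v.phiCoeff := by
  ext q
  cases v <;> simp [phi, level, eisComb, phiCoeff, divisors_six, divisors_eight, divisors_nine] <;>
    ring

lemma evalOn_phi (v : MukaiCase) : EvalOn (eisCombSeries v.level v.phiCoeff) v.phi 1 := by
  rw [phi_eq]; exact evalOn_eisComb _ _

lemma isQuasimodular_phi (v : MukaiCase) : IsQuasimodular v.level 0 (onH v.phi) := by
  rw [phi_eq]
  refine (isQuasimodular_eisComb _ _).congr ?_ fun _ => rfl
  cases v <;> norm_num [level, phiCoeff, divisors_six, divisors_eight, divisors_nine]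

lemma isQuasimodular_w (v : MukaiCase) : IsQuasimodular v.level 0 (onH v.w) := by
  refine (isQuasimodular_eisComb _ _).congr ?_ fun _ => rfl
  cases v <;> norm_num [level, wCoeff, divisors_six, divisors_eight, divisors_nine]

lemma isQuasimodular_u (v : MukaiCase) : IsQuasimodular v.level (1 / 6) (onH v.u) := by
  refine (isQuasimodular_eisComb _ _).congr ?_ fun _ => rfl
  cases v <;> norm_num [level, uCoeff, divisors_six, divisors_eight, divisors_nine]

/-- The expansion of `psi`. -/
def psiSeries : MukaiCase → ℂ⟦X⟧
  | V12 => eisCombSeries 6 (psiCoeff V12)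
  | V16 => eisCombSeries 8 (psiCoeff V16)
  | V18 => sigmaSeries chi3 1

lemma evalOn_psi (v : MukaiCase) : EvalOn v.psiSeries v.psi 1 := by
  cases v
  exacts [evalOn_eisComb _ _, evalOn_eisComb _ _, evalOn_twist2]

lemma isQuasimodular_psi (v : MukaiCase) : IsQuasimodular v.level 0 (onH v.psi) := by
  cases v
  · refine (isQuasimodular_eisComb _ _).congr ?_ fun _ => rfl
    norm_num [level, psiCoeff, divisors_six]
  · refine (isQuasimodular_eisComb _ _).congr ?_ fun _ => rfl
    norm_num [level, psiCoeff, divisors_eight]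
  · exact isQuasimodular_twist2

/-- The expansion of `formF`. -/
def formFSeries : MukaiCase → ℂ⟦X⟧
  | V12 => eis4Series 1 - (7 : ℂ) • eis4Series 2 + (7 : ℂ) • eis4Series 3 - eis4Series 6
  | V16 => eis4Series 1 - (21 / 4 : ℂ) • eis4Series 2 + (21 / 4 : ℂ) • eis4Series 4 - eis4Series 8
  | V18 => sigmaSeries chi3 3

lemma evalOn_formF (v : MukaiCase) : EvalOn v.formFSeries v.formF 1 := by
  cases v
  · exact ((((evalOn_eis4 (by norm_num)).sub ((evalOn_eis4 (by norm_num)).smul 7)).add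
      ((evalOn_eis4 (by norm_num)).smul 7)).sub (evalOn_eis4 (by norm_num))).congr fun q _ => rfl
  · exact ((((evalOn_eis4 (by norm_num)).sub ((evalOn_eis4 (by norm_num)).smul (21 / 4))).add
      ((evalOn_eis4 (by norm_num)).smul (21 / 4))).sub
        (evalOn_eis4 (by norm_num))).congr fun q _ => rfl
  · exact evalOn_formF_V18

lemma isModular_formF (v : MukaiCase) : IsModular v.level 4 (onH v.formF) := by
  cases v
  · exact ((((isModular_eis4 (i := 1) (by norm_num) (by norm_num)).sub
      ((isModular_eis4 (i := 2) (by norm_num) (by norm_num)).smul 7)).add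
      ((isModular_eis4 (i := 3) (by norm_num) (by norm_num)).smul 7)).sub
      (isModular_eis4 (N := 6) (i := 6) (by norm_num) (by norm_num))).congr rfl fun _ => rfl
  · exact ((((isModular_eis4 (i := 1) (by norm_num) (by norm_num)).sub
      ((isModular_eis4 (i := 2) (by norm_num) (by norm_num)).smul (21 / 4))).add
      ((isModular_eis4 (i := 4) (by norm_num) (by norm_num)).smul (21 / 4))).sub
      (isModular_eis4 (N := 8) (i := 8) (by norm_num) (by norm_num))).congr rfl fun _ => rfl
  · exact isModular_formF_V18

/-- First coefficients of `Φ`. -/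
def phiList : MukaiCase → List ℂ
  | V12 => [1, 5, 13, 23, 29]
  | V16 => [1, 4, 8, 16, 24]
  | V18 => [1, 3, 9, 12, 21]

/-- First coefficients of `psi`. -/
def psiList : MukaiCase → List ℂ
  | V12 => [0, 1, -7, 19, -23]
  | V16 => [0, 1, -4, 4, 0]
  | V18 => [0, 1, -3, 0, 7]

/-- First coefficients of `w`. -/
def wList : MukaiCase → List ℂ
  | V12 => [1, -12, -12, -12, -12]
  | V16 => [1, -8, -8, -32, 24]
  | V18 => [1, -6, -18, 12, -42]

/-- First coefficients of `u`. -/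
def uList : MukaiCase → List ℂ
  | V12 => [0, 5, 1, -1, -7]
  | V16 => [0, 4, 0, 16, -32]
  | V18 => [0, 3, 9, -18, 21]

/-- First coefficients of `F`. -/
def formFList : MukaiCase → List ℂ
  | V12 => [0, 1, -19, 91, -179]
  | V16 => [0, 1, -12, 28, -32]
  | V18 => [0, 1, -9, 0, 73]

lemma firstCoeffs_phi (v : MukaiCase) :
    FirstCoeffs (eisCombSeries v.level v.phiCoeff) (listSeq v.phiList) := by
  intro n hn
  cases v <;> interval_cases n <;>
    norm_num [level, coeff_eisCombSeries, phiCoeff, listSeq, phiList, divisors_six, divisors_eight,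
      divisors_nine, sigma_one_two, sigma_one_three, sigma_one_four]

lemma firstCoeffs_w (v : MukaiCase) :
    FirstCoeffs (eisCombSeries v.level v.wCoeff) (listSeq v.wList) := by
  intro n hn
  cases v <;> interval_cases n <;>
    norm_num [level, coeff_eisCombSeries, wCoeff, listSeq, wList, divisors_six, divisors_eight,
      divisors_nine, sigma_one_two, sigma_one_three, sigma_one_four]

lemma firstCoeffs_u (v : MukaiCase) :
    FirstCoeffs (eisCombSeries v.level v.uCoeff) (listSeq v.uList) := by
  intro n hn
  cases v <;> interval_cases n <;>
    norm_num [level, coeff_eisCombSeries, uCoeff, listSeq, uList, divisors_six, divisors_eight,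
      divisors_nine, sigma_one_two, sigma_one_three, sigma_one_four]

lemma firstCoeffs_psi (v : MukaiCase) : FirstCoeffs v.psiSeries (listSeq v.psiList) := by
  intro n hn
  cases v <;> interval_cases n <;>
    norm_num [psiSeries, coeff_eisCombSeries, psiCoeff, listSeq, psiList, divisors_six, divisors_eight,
      sigma_one_two, sigma_one_three, sigma_one_four, coeff_sigmaSeries, chi3_eq]

lemma firstCoeffs_formF (v : MukaiCase) : FirstCoeffs v.formFSeries (listSeq v.formFList) := by
  intro n hn
  cases v <;> interval_cases n <;>
    norm_num [-PowerSeries.coeff_zero_eq_constantCoeff, formFSeries, coeff_eis4Series, listSeq, formFList,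
      sigma_three_two, sigma_three_three, sigma_three_four, coeff_sigmaSeries, chi3_eq]

-- Only finite arithmetic remains: each of the five relations is compared in degrees 0 to 4 for each
-- of the three levels.
set_option maxHeartbeats 1000000 in
lemma relations (v : MukaiCase) : Relations v.al v.be v.ka v.phi v.psi v.w v.u v.formF := by
  refine relations_of_coeffs v.index_Gamma0_level v.al v.be v.ka v.evalOn_phi v.evalOn_psi
    (evalOn_eisComb _ _) (evalOn_eisComb _ _) v.evalOn_formF v.isQuasimodular_phi
    v.isQuasimodular_psi v.isQuasimodular_w v.isQuasimodular_u v.isModular_formF v.firstCoeffs_phi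
    v.firstCoeffs_psi v.firstCoeffs_w v.firstCoeffs_u v.firstCoeffs_formF ?_ ?_ ?_ ?_ ?_ <;>
  · intro n hn
    cases v <;> interval_cases n <;>
      norm_num [conv, Finset.sum_range_succ, listSeq, phiList, psiList, wList, uList, formFList, al,
        be, ka]

end MukaiCase

/-! ### The Fricke involution -/

lemma eis2_one_moebius {a b c d : ℤ} (h : a * d - b * c = 1) {z : ℂ} (hz : 0 < z.im) :
    eis2 1 (nome ((a * z + b) / (c * z + d))) =
      (c * z + d) ^ 2 * eis2 1 (nome z) + Complex.I / (4 * Real.pi) * c * (c * z + d) := by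
  set γ : SL(2, ℤ) := ⟨!![a, b; c, d], by rw [Matrix.det_fin_two_of, h]⟩ with hγ
  have h1 := congrFun (E2_slash_action γ) ⟨z, hz⟩
  have hd : denom (γ : GL (Fin 2) ℝ) (⟨z, hz⟩ : ℍ) = c * z + d := by
    rw [ModularGroup.denom_apply]; simp [hγ]
  have hd0 : (c * z + d : ℂ) ≠ 0 := hd ▸ denom_ne_zero (γ : GL (Fin 2) ℝ) (⟨z, hz⟩ : ℍ)
  have hz2 : ((γ • (⟨z, hz⟩ : ℍ) : ℍ) : ℂ) = (a * z + b) / (c * z + d) := by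
    rw [coe_specialLinearGroup_apply]; simp [hγ]
  have hE : ∀ τ : ℍ, eis2 1 (nome τ) = -(1 / 24) * E2 τ := fun τ => by
    have := congrFun onH_eis2_one τ
    simpa [onH] using this
  have hg := hE (γ • ⟨z, hz⟩)
  rw [hz2] at hg
  have hg2 := hE ⟨z, hz⟩
  simp only [] at hg2
  rw [hg, hg2]
  rw [SL_slash_apply, hd] at h1
  simp only [Pi.sub_apply, Pi.smul_apply, D2, hd, smul_eq_mul, riemannZeta_two] at h1
  have hc : ((γ 1 0 : ℤ) : ℂ) = c := by simp [hγ]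
  rw [hc] at h1
  have hpi : (Real.pi : ℂ) ≠ 0 := by exact_mod_cast Real.pi_ne_zero
  have h2 : E2 (γ • ⟨z, hz⟩) = (c * z + d) ^ 2 * (E2 (γ • ⟨z, hz⟩) * (c * z + d) ^ (-2 : ℤ)) := by
    rw [zpow_neg, mul_comm, mul_assoc]
    norm_cast
    rw [inv_mul_cancel₀ (pow_ne_zero 2 hd0), mul_one]
  rw [h2, h1]
  field_simp
  ring

lemma im_neg_one_div_pos {N : ℝ} (hN : 0 < N) {τ : ℂ} (hτ : 0 < τ.im) :
    0 < (-1 / (N * τ)).im := by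
  have hz : τ ≠ 0 := by rintro rfl; simp at hτ
  rw [Complex.div_im]
  have : 0 < Complex.normSq (N * τ) := Complex.normSq_pos.mpr
    (mul_ne_zero (by exact_mod_cast hN.ne') hz)
  simp only [Complex.neg_im, Complex.one_im, neg_zero, zero_mul, zero_div, Complex.neg_re,
    Complex.one_re, Complex.im_ofReal_mul, zero_sub]
  rw [neg_mul, one_mul, neg_div, neg_neg]
  positivity

/-- Here i·(−1/(Nτ)) = −1/(jτ), so the inversion law for E₂ at jτ applies. The non-modular term is
the same for every divisor i. -/
lemma eis2_fricke {N i j : ℕ} (hN : N = i * j) (hj : 0 < j) {τ : ℂ} (hi : 0 < i) (hτ : 0 < τ.im) :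
    eis2 i (nome (-1 / (N * τ))) =
      N * τ ^ 2 * eis2 j (nome τ) + Complex.I / (4 * Real.pi) * N * τ := by
  have hτ0 : τ ≠ 0 := by rintro rfl; simp at hτ
  have him : 0 < ((j : ℂ) * τ).im := by
    have : ((j : ℂ) * τ).im = j * τ.im := by
      rw [← Complex.ofReal_natCast, Complex.im_ofReal_mul]
    rw [this]; positivity
  have := eis2_one_moebius (a := 0) (b := -1) (c := 1) (d := 0) (by norm_num) him
  rw [eis2_eq (i := i), eis2_eq (i := j), nome_pow, nome_pow]
  have hi' : (i : ℂ) ≠ 0 := by exact_mod_cast hi.ne'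
  have hj' : (j : ℂ) ≠ 0 := by exact_mod_cast hj.ne'
  have e : (i : ℂ) * (-1 / (N * τ)) = (((0 : ℤ) : ℂ) * (j * τ) + ((-1 : ℤ) : ℂ)) /
      (((1 : ℤ) : ℂ) * (j * τ) + ((0 : ℤ) : ℂ)) := by
    rw [hN]; push_cast; field_simp; ring
  rw [e, this, hN]
  push_cast
  ring

lemma eisComb_fricke {N : ℕ} (hN : 0 < N) {c : ℕ → ℂ} {ε : ℂ} (h0 : ∑ i ∈ N.divisors, c i = 0)
    (hc : ∀ i ∈ N.divisors, c (N / i) = ε * c i) {τ : ℂ} (hτ : 0 < τ.im) :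
    eisComb N c (nome (-1 / (N * τ))) = ε * (N * τ ^ 2) * eisComb N c (nome τ) := by
  have h1 : eisComb N c (nome (-1 / (N * τ))) = ∑ i ∈ N.divisors,
      (c i * (N * τ ^ 2 * eis2 (N / i) (nome τ)) + c i * (Complex.I / (4 * Real.pi) * N * τ)) := by
    refine Finset.sum_congr rfl fun i hi => ?_
    have hd := Nat.dvd_of_mem_divisors hi
    rw [eis2_fricke (Nat.mul_div_cancel' hd).symm (Nat.div_pos (Nat.le_of_dvd hN hd)
      (Nat.pos_of_mem_divisors hi)) (Nat.pos_of_mem_divisors hi) hτ, mul_add]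
  rw [h1, Finset.sum_add_distrib, ← Finset.sum_mul, h0, zero_mul, add_zero,
    ← Nat.sum_div_divisors, eisComb, Finset.mul_sum]
  refine Finset.sum_congr rfl fun i hi => ?_
  rw [hc i hi, Nat.div_div_self (Nat.dvd_of_mem_divisors hi) hN.ne']
  ring

/-- The matrices (1 0; ±3 1) send τ ∓ 1/3 to −1/(9τ) ± 1/3. They exchange the two translates, whence
the sign, and their anomalies are equal and cancel. -/
lemma twist2_fricke {τ : ℂ} (hτ : 0 < τ.im) :
    twist2 (nome (-1 / (9 * τ))) = -(9 * τ ^ 2) * twist2 (nome τ) := by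
  have hτ0 : τ ≠ 0 := by rintro rfl; simp at hτ
  have him := im_neg_one_div_pos (N := 9) (by norm_num) hτ
  push_cast at him
  have e1 := twist2_eq (norm_nome_lt_one him)
  have e2 := twist2_eq (norm_nome_lt_one hτ)
  have i1 : 0 < (-1 / 3 + τ).im := by
    have : (-1 / 3 : ℂ) = ((-1 / 3 : ℝ) : ℂ) := by push_cast; rfl
    rw [this]; simpa using hτ
  have i2 : 0 < (1 / 3 + τ).im := by
    have : (1 / 3 : ℂ) = ((1 / 3 : ℝ) : ℂ) := by push_cast; rfl
    rw [this]; simpa using hτ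
  have m1 := eis2_one_moebius (a := 1) (b := 0) (c := 3) (d := 1) (by norm_num) i1
  have m2 := eis2_one_moebius (a := 1) (b := 0) (c := -3) (d := 1) (by norm_num) i2
  have f1 : (((1 : ℤ) : ℂ) * (-1 / 3 + τ) + ((0 : ℤ) : ℂ)) /
      (((3 : ℤ) : ℂ) * (-1 / 3 + τ) + ((1 : ℤ) : ℂ)) = 1 / 3 + -1 / (9 * τ) := by
    have : ((3 : ℤ) : ℂ) * (-1 / 3 + τ) + ((1 : ℤ) : ℂ) = 3 * τ := by push_cast; ring
    rw [this]; push_cast; field_simp; ring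
  have f2 : (((1 : ℤ) : ℂ) * (1 / 3 + τ) + ((0 : ℤ) : ℂ)) /
      (((-3 : ℤ) : ℂ) * (1 / 3 + τ) + ((1 : ℤ) : ℂ)) = -1 / 3 + -1 / (9 * τ) := by
    have : ((-3 : ℤ) : ℂ) * (1 / 3 + τ) + ((1 : ℤ) : ℂ) = -3 * τ := by push_cast; ring
    rw [this]; push_cast; field_simp; ring
  rw [f1] at m1
  rw [f2] at m2
  rw [omega3, ← omega3, ← nome_neg_third, ← nome_add, omega3, ← nome_add] at e1 e2
  rw [m1, m2] at e1
  apply mul_left_cancel₀ sqrt_three_mul_I_ne_zero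
  rw [← e1]
  push_cast
  linear_combination (-(9 * τ ^ 2)) * e2

namespace MukaiCase

lemma level_pos (v : MukaiCase) : 0 < v.level := by cases v <;> simp [level]

lemma phi_fricke (v : MukaiCase) {τ : ℂ} (hτ : 0 < τ.im) :
    v.phi (nome (-1 / (v.level * τ))) = -(v.level * τ ^ 2) * v.phi (nome τ) := by
  rw [phi_eq, eisComb_fricke v.level_pos (ε := -1) _ _ hτ]
  · ring
  · cases v <;> norm_num [level, phiCoeff, divisors_six, divisors_eight, divisors_nine]
  · cases v <;> norm_num [level, phiCoeff, divisors_six, divisors_eight, divisors_nine]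

lemma w_fricke (v : MukaiCase) {τ : ℂ} (hτ : 0 < τ.im) :
    v.w (nome (-1 / (v.level * τ))) = v.level * τ ^ 2 * v.w (nome τ) := by
  rw [w, eisComb_fricke v.level_pos (ε := 1) _ _ hτ]
  · ring
  · cases v <;> norm_num [level, wCoeff, divisors_six, divisors_eight, divisors_nine]
  · cases v <;> norm_num [level, wCoeff, divisors_six, divisors_eight, divisors_nine]

lemma psi_fricke (v : MukaiCase) {τ : ℂ} (hτ : 0 < τ.im) :
    v.psi (nome (-1 / (v.level * τ))) = -(v.level * τ ^ 2) * v.psi (nome τ) := by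
  cases v
  · refine (eisComb_fricke (by norm_num [level]) (ε := -1) ?_ ?_ hτ).trans (by simp [psi, level])
    · norm_num [level, psiCoeff, divisors_six]
    · norm_num [level, psiCoeff, divisors_six]
  · refine (eisComb_fricke (by norm_num [level]) (ε := -1) ?_ ?_ hτ).trans (by simp [psi, level])
    · norm_num [level, psiCoeff, divisors_eight]
    · norm_num [level, psiCoeff, divisors_eight]
  · exact_mod_cast twist2_fricke hτ

lemma im_fricke_pos (v : MukaiCase) {τ : ℂ} (hτ : 0 < τ.im) :
    0 < (-1 / (v.level * τ) : ℂ).im := by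
  have := im_neg_one_div_pos (N := v.level) (by exact_mod_cast v.level_pos) hτ
  simpa using this

lemma formF_fricke (v : MukaiCase) {τ : ℂ} (hτ : 0 < τ.im) :
    v.formF (nome (-1 / (v.level * τ))) =
      -(τ * (√(v.level : ℝ) : ℝ)) ^ 4 * v.formF (nome τ) := by
  have hs : ((√(v.level : ℝ) : ℝ) : ℂ) ^ 2 = v.level := by
    rw [← Complex.ofReal_pow, Real.sq_sqrt (Nat.cast_nonneg _), Complex.ofReal_natCast]
  rw [v.relations.F_eq _ (norm_nome_lt_one (v.im_fricke_pos hτ)),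
    v.relations.F_eq _ (norm_nome_lt_one hτ), v.w_fricke hτ, v.psi_fricke hτ]
  linear_combination ((((√(v.level : ℝ) : ℝ) : ℂ) ^ 2 + v.level) * τ ^ 4 * v.w (nome τ) *
    v.psi (nome τ)) * hs

end MukaiCase

/-! ### Nonvanishing -/

/-- At a zero of finite order away from the origin, f' would have order one less than f, while f' =
(u/q)·f has at least the order of f. So f vanishes to infinite order and the identity theorem
applies. -/
lemma eqOn_zero_of_theta_eq_mul {f u : ℂ → ℂ} (hf : DifferentiableOn ℂ f (Metric.ball 0 1))
    (hu : DifferentiableOn ℂ u (Metric.ball 0 1))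
    (h : ∀ q, ‖q‖ < 1 → thetaFun f q = u q * f q) {q₀ : ℂ} (h0 : q₀ ≠ 0) (h1 : ‖q₀‖ < 1)
    (hz : f q₀ = 0) {q : ℂ} (hq : ‖q‖ < 1) : f q = 0 := by
  have hm : q₀ ∈ Metric.ball (0 : ℂ) 1 := by simpa using h1
  have hfa : AnalyticOnNhd ℂ f (Metric.ball 0 1) := hf.analyticOnNhd Metric.isOpen_ball
  have hua : AnalyticAt ℂ (fun q => u q * q⁻¹) q₀ :=
    (hu.analyticOnNhd Metric.isOpen_ball q₀ hm).mul (analyticAt_inv h0)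
  have he : deriv f =ᶠ[𝓝 q₀] (fun q => u q * q⁻¹) * f := by
    filter_upwards [Metric.isOpen_ball.mem_nhds hm, isOpen_ne.mem_nhds h0] with z hz1 hz2
    have := h z (by simpa using hz1)
    rw [thetaFun] at this
    have hz2 : z ≠ 0 := hz2
    simp only [Pi.mul_apply]
    field_simp
    linear_combination this
  have ho := (hfa q₀ hm).analyticOrderAt_deriv_add_one
  rw [analyticOrderAt_congr he, analyticOrderAt_mul hua (hfa q₀ hm)] at ho
  simp only [hz, sub_zero] at ho
  have htop : analyticOrderAt f q₀ = ⊤ := by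
    by_contra hne
    obtain ⟨n, hn⟩ := ENat.ne_top_iff_exists.mp hne
    rw [← hn] at ho
    have : (n : ℕ∞) + 1 ≤ n := by
      calc (n : ℕ∞) + 1 ≤ analyticOrderAt (fun q => u q * q⁻¹) q₀ + n + 1 := by
            gcongr; exact le_add_self
        _ = n := ho
    have h2 : ((n + 1 : ℕ) : ℕ∞) ≤ n := by exact_mod_cast this
    have := ENat.natCast_le_natCast.mp h2
    omega
  have := hfa.eqOn_zero_of_preconnected_of_eventuallyEq_zero
    (convex_ball (0 : ℂ) 1).isPreconnected hm (analyticOrderAt_eq_top.mp htop)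
  exact this (by simpa using hq)

namespace MukaiCase

lemma differentiableOn_phi (v : MukaiCase) : DifferentiableOn ℂ v.phi (Metric.ball 0 1) :=
  v.evalOn_phi.differentiableOn

lemma differentiableOn_psi (v : MukaiCase) : DifferentiableOn ℂ v.psi (Metric.ball 0 1) :=
  v.evalOn_psi.differentiableOn

lemma differentiableOn_w (v : MukaiCase) : DifferentiableOn ℂ v.w (Metric.ball 0 1) :=
  (evalOn_eisComb _ _).differentiableOn

lemma differentiableOn_u (v : MukaiCase) : DifferentiableOn ℂ v.u (Metric.ball 0 1) :=
  (evalOn_eisComb _ _).differentiableOn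

end MukaiCase

lemma EvalOn.apply_zero {p : ℂ⟦X⟧} {f : ℂ → ℂ} {r : ℝ} (h : EvalOn p f r) (hr : 0 < r) :
    f 0 = PowerSeries.coeff 0 p := by
  have := h.coeff_eq hr 0
  simpa using this.symm

namespace MukaiCase

lemma phi_zero (v : MukaiCase) : v.phi 0 = 1 := by
  rw [v.evalOn_phi.apply_zero one_pos, v.firstCoeffs_phi 0 (by norm_num)]
  cases v <;> simp [listSeq, phiList]

lemma psi_zero (v : MukaiCase) : v.psi 0 = 0 := by
  rw [v.evalOn_psi.apply_zero one_pos, v.firstCoeffs_psi 0 (by norm_num)]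
  cases v <;> simp [listSeq, psiList]

lemma w_zero (v : MukaiCase) : v.w 0 = 1 := by
  rw [w, (evalOn_eisComb _ _).apply_zero one_pos, v.firstCoeffs_w 0 (by norm_num)]
  cases v <;> simp [listSeq, wList]

lemma deriv_psi_zero (v : MukaiCase) : deriv v.psi 0 = 1 := by
  have := v.evalOn_psi.coeff_eq one_pos 1
  rw [v.firstCoeffs_psi 1 (by norm_num)] at this
  rw [iteratedDeriv_one, Nat.factorial_one, Nat.cast_one, inv_one, one_mul] at this
  rw [← this]
  cases v <;> simp [listSeq, psiList]

lemma phi_ne_zero (v : MukaiCase) {q : ℂ} (hq : ‖q‖ < 1) : v.phi q ≠ 0 := by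
  intro h
  rcases eq_or_ne q 0 with rfl | h0
  · rw [phi_zero] at h; exact one_ne_zero h
  · have := eqOn_zero_of_theta_eq_mul v.differentiableOn_phi v.differentiableOn_u
      v.relations.theta_phi h0 hq h (q := 0) (by simp)
    rw [phi_zero] at this; exact one_ne_zero this

lemma psi_ne_zero (v : MukaiCase) {q : ℂ} (hq : ‖q‖ < 1) (h0 : q ≠ 0) : v.psi q ≠ 0 := by
  intro h
  have h1 : v.psi =ᶠ[𝓝 0] fun _ => 0 := by
    filter_upwards [Metric.ball_mem_nhds (0 : ℂ) one_pos] with z hz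
    exact eqOn_zero_of_theta_eq_mul v.differentiableOn_psi
      (v.differentiableOn_u.add v.differentiableOn_w)
      (fun q hq => v.relations.theta_psi q hq) h0 hq h (q := z) (by simpa using hz)
  have := h1.deriv_eq
  rw [deriv_psi_zero] at this
  simp at this

/-- The modular function `t`. -/
def t (v : MukaiCase) (q : ℂ) : ℂ := v.psi q / v.phi q

lemma t_mul_phi (v : MukaiCase) {q : ℂ} (hq : ‖q‖ < 1) : v.t q * v.phi q = v.psi q :=
  div_mul_cancel₀ _ (v.phi_ne_zero hq)

lemma differentiableOn_t (v : MukaiCase) : DifferentiableOn ℂ v.t (Metric.ball 0 1) :=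
  v.differentiableOn_psi.div v.differentiableOn_phi fun q hq => v.phi_ne_zero (by simpa using hq)

lemma t_zero (v : MukaiCase) : v.t 0 = 0 := by rw [t, psi_zero, zero_div]

lemma t_ne_zero (v : MukaiCase) {q : ℂ} (hq : ‖q‖ < 1) (h0 : q ≠ 0) : v.t q ≠ 0 :=
  div_ne_zero (v.psi_ne_zero hq h0) (v.phi_ne_zero hq)

lemma hasDerivAt_of_norm_lt {f : ℂ → ℂ} (hf : DifferentiableOn ℂ f (Metric.ball 0 1)) {q : ℂ}
    (hq : ‖q‖ < 1) : HasDerivAt f (deriv f q) q :=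
  (hf.differentiableAt (Metric.isOpen_ball.mem_nhds (by simpa using hq))).hasDerivAt

lemma theta_t (v : MukaiCase) {q : ℂ} (hq : ‖q‖ < 1) : thetaFun v.t q = v.w q * v.t q := by
  have h0 := v.phi_ne_zero hq
  have h := (hasDerivAt_of_norm_lt v.differentiableOn_psi hq).fun_div
    (hasDerivAt_of_norm_lt v.differentiableOn_phi hq) h0
  have h1 := v.relations.theta_phi q hq
  have h2 := v.relations.theta_psi q hq
  have h3 : deriv v.t q = _ := h.deriv
  rw [thetaFun] at h1 h2 ⊢
  rw [h3, t]
  field_simp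
  linear_combination v.phi q * h2 - v.psi q * h1

lemma deriv_t_zero (v : MukaiCase) : deriv v.t 0 = 1 := by
  have h := (hasDerivAt_of_norm_lt v.differentiableOn_psi (q := 0) (by simp)).fun_div
    (hasDerivAt_of_norm_lt v.differentiableOn_phi (q := 0) (by simp)) (v.phi_ne_zero (by simp))
  have h3 : deriv v.t 0 = _ := h.deriv
  rw [h3, psi_zero, phi_zero, deriv_psi_zero]
  simp

lemma w_sq (v : MukaiCase) {q : ℂ} (hq : ‖q‖ < 1) :
    v.w q ^ 2 = v.phi q ^ 2 * (1 - 2 * v.al * v.t q + v.ka * v.t q ^ 2) := by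
  rw [v.relations.w_sq q hq, ← v.t_mul_phi hq]; ring

lemma t_smul (v : MukaiCase) {γ : SL(2, ℤ)} (hγ : γ ∈ Gamma0 v.level) (τ : ℍ) :
    v.t (nome ↑(γ • τ)) = v.t (nome τ) := by
  have key : ∀ f : ℂ → ℂ, IsQuasimodular v.level 0 (onH f) →
      f (nome ↑(γ • τ)) = f (nome τ) * denom (γ : GL (Fin 2) ℝ) τ ^ (2 : ℤ) := by
    intro f hf
    have := congrFun ((hf.isModular rfl).2.1 γ hγ) τ
    rw [SL_slash_apply] at this
    simp only [onH] at this
    rw [← this, mul_assoc, ← zpow_add₀ (denom_ne_zero _ _)]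
    simp
  rw [t, t, key _ v.isQuasimodular_psi, key _ v.isQuasimodular_phi,
    mul_div_mul_right _ _ (zpow_ne_zero _ (denom_ne_zero _ _))]

lemma t_fricke (v : MukaiCase) {τ : ℂ} (hτ : 0 < τ.im) :
    v.t (nome (-1 / (v.level * τ))) = v.t (nome τ) := by
  have hτ0 : τ ≠ 0 := by rintro rfl; simp at hτ
  have : (v.level : ℂ) ≠ 0 := by exact_mod_cast v.level_pos.ne'
  rw [t, t, v.psi_fricke hτ, v.phi_fricke hτ, mul_div_mul_left]
  exact neg_ne_zero.mpr (mul_ne_zero this (pow_ne_zero 2 hτ0))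

end MukaiCase

/-! ### The differential equation under the change of variable `t = t(q)` -/

/-- `f` is differentiable on `V` and `q df/dq = g` there. -/
def HasTheta (f g : ℂ → ℂ) (V : Set ℂ) : Prop := ∀ q ∈ V, DifferentiableAt ℂ f q ∧ thetaFun f q = g q

namespace HasTheta

variable {f f' g g' : ℂ → ℂ} {V : Set ℂ}

lemma congr_right (h : HasTheta f g V) (hg : ∀ q ∈ V, g q = g' q) : HasTheta f g' V :=
  fun q hq => ⟨(h q hq).1, (h q hq).2.trans (hg q hq)⟩

lemma add (h : HasTheta f g V) (h' : HasTheta f' g' V) :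
    HasTheta (fun q => f q + f' q) (fun q => g q + g' q) V := fun q hq => by
  refine ⟨(h q hq).1.add (h' q hq).1, ?_⟩
  beta_reduce
  rw [← (h q hq).2, ← (h' q hq).2, thetaFun, deriv_fun_add (h q hq).1 (h' q hq).1, mul_add]; rfl

lemma sub (h : HasTheta f g V) (h' : HasTheta f' g' V) :
    HasTheta (fun q => f q - f' q) (fun q => g q - g' q) V := fun q hq => by
  refine ⟨(h q hq).1.sub (h' q hq).1, ?_⟩
  beta_reduce
  rw [← (h q hq).2, ← (h' q hq).2, thetaFun, deriv_fun_sub (h q hq).1 (h' q hq).1, mul_sub]; rfl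

lemma mul (h : HasTheta f g V) (h' : HasTheta f' g' V) :
    HasTheta (fun q => f q * f' q) (fun q => g q * f' q + f q * g' q) V := fun q hq => by
  refine ⟨(h q hq).1.mul (h' q hq).1, ?_⟩
  beta_reduce
  rw [← (h q hq).2, ← (h' q hq).2, thetaFun, deriv_fun_mul (h q hq).1 (h' q hq).1, thetaFun,
    thetaFun]
  ring

lemma const (c : ℂ) : HasTheta (fun _ => c) (fun _ => 0) V := fun q _ =>
  ⟨differentiableAt_const c, by simp [thetaFun]⟩

lemma const_mul (c : ℂ) (h : HasTheta f g V) : HasTheta (fun q => c * f q) (fun q => c * g q) V :=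
  ((const c).mul h).congr_right fun q _ => by ring

lemma inv (h : HasTheta f g V) (h0 : ∀ q ∈ V, f q ≠ 0) :
    HasTheta (fun q => (f q)⁻¹) (fun q => -g q / f q ^ 2) V := fun q hq => by
  have := (h q hq).1.hasDerivAt.fun_inv (h0 q hq)
  refine ⟨this.differentiableAt, ?_⟩
  beta_reduce
  rw [← (h q hq).2, thetaFun, this.deriv, thetaFun]
  ring

lemma comp {y Y t w : ℂ → ℂ} {U : Set ℂ} (hy : HasTheta y Y U)
    (ht : HasTheta t (fun q => w q * t q) V) (hU : ∀ q ∈ V, t q ∈ U) :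
    HasTheta (fun q => y (t q)) (fun q => w q * Y (t q)) V := fun q hq => by
  have h1 := (hy _ (hU q hq)).1.hasDerivAt.comp q (ht q hq).1.hasDerivAt
  refine ⟨h1.differentiableAt, ?_⟩
  have h2 := (ht q hq).2
  have h3 : deriv (fun q => y (t q)) q = _ := h1.deriv
  beta_reduce at h2 ⊢
  rw [← (hy _ (hU q hq)).2, thetaFun, h3]
  rw [thetaFun] at h2 ⊢
  linear_combination deriv y (t q) * h2

lemma unique (h : HasTheta f g V) (h' : HasTheta f' g' V) (hV : IsOpen V)
    (hf : ∀ q ∈ V, f q = f' q) {q : ℂ} (hq : q ∈ V) : g q = g' q := by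
  rw [← (h q hq).2, ← (h' q hq).2, thetaFun, thetaFun]
  rw [Filter.EventuallyEq.deriv_eq]
  filter_upwards [hV.mem_nhds hq] with z hz using hf z hz

end HasTheta

lemma EvalOn.hasTheta {p : ℂ⟦X⟧} {f : ℂ → ℂ} {r : ℝ} (h : EvalOn p f r) :
    HasTheta f (thetaFun f) (Metric.ball 0 r) := fun _ hq =>
  ⟨h.differentiableOn.differentiableAt (Metric.isOpen_ball.mem_nhds hq), rfl⟩

lemma HasTheta.evalOn {p : ℂ⟦X⟧} {f g : ℂ → ℂ} {r : ℝ} (hf : HasTheta f g (Metric.ball 0 r))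
    (h : EvalOn p f r) : EvalOn (_root_.theta p) g r :=
  h.theta.congr fun z hz => (hf z (by simpa using hz)).2

namespace MukaiCase

/-- The symbol, with uniform parameters. -/
def P (v : MukaiCase) (x : ℂ) : ℂ := 1 - 2 * v.al * x + v.ka * x ^ 2

lemma symbol_eq (v : MukaiCase) (x : ℂ) : v.symbol x = v.P x := by
  cases v <;> simp only [symbol, P, al, ka] <;> push_cast <;> ring

/-- The differential operator in terms of the iterated `D`-derivatives of a function. -/
def opFun (v : MukaiCase) (y0 y1 y2 y3 : ℂ → ℂ) (x : ℂ) : ℂ :=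
  y3 x - x * (2 * v.al * y3 x + 3 * v.al * y2 x + (v.al + 2 * v.be) * y1 x + v.be * y0 x) +
    v.ka * x ^ 2 * (y3 x + 3 * y2 x + 3 * y1 x + y0 x)

/-- The formal derivative of the operator with respect to `D`. -/
def opFun' (v : MukaiCase) (y0 y1 y2 : ℂ → ℂ) (x : ℂ) : ℂ :=
  3 * y2 x - x * (6 * v.al * y2 x + 6 * v.al * y1 x + (v.al + 2 * v.be) * y0 x) +
    v.ka * x ^ 2 * (3 * y2 x + 6 * y1 x + 3 * y0 x)

variable {V U : Set ℂ}

lemma hasTheta_phi (v : MukaiCase) (hV : ∀ q ∈ V, ‖q‖ < 1) :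
    HasTheta v.phi (fun q => v.u q * v.phi q) V := fun q hq =>
  ⟨(hasDerivAt_of_norm_lt v.differentiableOn_phi (hV q hq)).differentiableAt,
    v.relations.theta_phi q (hV q hq)⟩

lemma hasTheta_t (v : MukaiCase) (hV : ∀ q ∈ V, ‖q‖ < 1) :
    HasTheta v.t (fun q => v.w q * v.t q) V := fun q hq =>
  ⟨(hasDerivAt_of_norm_lt v.differentiableOn_t (hV q hq)).differentiableAt, v.theta_t (hV q hq)⟩

lemma hasTheta_u (v : MukaiCase) (hV : ∀ q ∈ V, ‖q‖ < 1) :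
    HasTheta v.u (fun q => v.u q ^ 2 / 2 +
      v.phi q ^ 2 * (v.be * v.t q - v.ka * v.t q ^ 2 / 2)) V := fun q hq => by
  refine ⟨(hasDerivAt_of_norm_lt v.differentiableOn_u (hV q hq)).differentiableAt, ?_⟩
  have := v.relations.theta_u q (hV q hq)
  rw [← v.t_mul_phi (hV q hq)] at this
  linear_combination this / 2

/-- Obtained by differentiating w² = Φ²P(t) and dividing by 2w, which is the only reason for
requiring w ≠ 0. -/
lemma hasTheta_w (v : MukaiCase) (hV : ∀ q ∈ V, ‖q‖ < 1) (hVo : IsOpen V)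
    (hw : ∀ q ∈ V, v.w q ≠ 0) :
    HasTheta v.w (fun q => v.u q * v.w q +
      v.phi q ^ 2 * (-v.al * v.t q + v.ka * v.t q ^ 2)) V := by
  have h0 : HasTheta v.w (thetaFun v.w) V := fun q hq =>
    ⟨(hasDerivAt_of_norm_lt v.differentiableOn_w (hV q hq)).differentiableAt, rfl⟩
  have ht := v.hasTheta_t hV
  have hp := v.hasTheta_phi hV
  have h1 := (hp.mul hp).mul (((HasTheta.const 1).sub (ht.const_mul (2 * v.al))).add
    ((ht.mul ht).const_mul v.ka))
  refine h0.congr_right fun q hq => ?_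
  have h2 := (h0.mul h0).unique h1 hVo (fun q hq => by
    have := v.w_sq (hV q hq)
    linear_combination this) hq
  have h3 := v.w_sq (hV q hq)
  apply mul_left_cancel₀ (hw q hq)
  linear_combination h2 / 2 - v.u q * h3

/-- Dividing by Φ and passing from t to q turns L into θ³, up to the factor Φw. The first derivative
is (w·y₁ − u·y₀)/Φ; after that w² is replaced by Φ²P(t) and θu, θw by their closed forms, so no new
functions appear. -/
lemma hasTheta_comp_t_div_phi (v : MukaiCase) (hV : ∀ q ∈ V, ‖q‖ < 1) (hVo : IsOpen V)
    (hw : ∀ q ∈ V, v.w q ≠ 0) (hU : ∀ q ∈ V, v.t q ∈ U) {y0 y1 y2 y3 : ℂ → ℂ}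
    (h0 : HasTheta y0 y1 U) (h1 : HasTheta y1 y2 U) (h2 : HasTheta y2 y3 U) :
    ∃ g1 g2 : ℂ → ℂ, HasTheta (fun q => y0 (v.t q) * (v.phi q)⁻¹) g1 V ∧ HasTheta g1 g2 V ∧
      HasTheta g2 (fun q => v.phi q * v.w q * v.opFun y0 y1 y2 y3 (v.t q)) V := by
  have ht := v.hasTheta_t hV
  have hp := v.hasTheta_phi hV
  have hp' : HasTheta (fun q => (v.phi q)⁻¹) (fun q => -v.u q * (v.phi q)⁻¹) V :=
    (hp.inv fun q hq => v.phi_ne_zero (hV q hq)).congr_right fun q hq => by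
      have := v.phi_ne_zero (hV q hq)
      field_simp
  have hu := v.hasTheta_u hV
  have hW := v.hasTheta_w hV hVo hw
  have k0 := h0.comp ht hU
  have k1 := h1.comp ht hU
  have k2 := h2.comp ht hU
  have hP := ((HasTheta.const 1).sub (ht.const_mul (2 * v.al))).add ((ht.mul ht).const_mul v.ka)
  have hQ := (ht.const_mul (-v.al)).add ((ht.mul ht).const_mul v.ka)
  have hR := (ht.const_mul (-v.be)).add ((ht.mul ht).const_mul (v.ka / 2))
  have hZ := ((hP.mul k2).add (hQ.mul k1)).add (hR.mul k0)
  have e1 := (((hW.mul k1).sub (hu.mul k0)).mul hp')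
  have e2 := (hp.mul hZ).add
    ((((hu.mul k0).const_mul (1 / 2)).sub (hW.mul k1)).mul (hu.mul hp'))
  refine ⟨_, _, (k0.mul hp').congr_right fun q hq => ?_, e1.congr_right fun q hq => ?_,
    e2.congr_right fun q hq => ?_⟩
  · ring
  · have hn := v.phi_ne_zero (hV q hq)
    have hs := v.w_sq (hV q hq)
    field_simp
    linear_combination (2 * y2 (v.t q)) * hs
  · have hn := v.phi_ne_zero (hV q hq)
    have hs := v.w_sq (hV q hq)
    simp only [opFun]
    field_simp
    linear_combination (-4 * v.u q * y2 (v.t q)) * hs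

end MukaiCase

/-! ### The operator on formal power series -/

namespace MukaiCase

/-- The differential operator in terms of the iterated `D`-derivatives of a power series. -/
def opSeries (v : MukaiCase) (p0 p1 p2 p3 : ℂ⟦X⟧) : ℂ⟦X⟧ :=
  p3 - PowerSeries.X * ((2 * v.al : ℂ) • p3 + (3 * v.al : ℂ) • p2 + (v.al + 2 * v.be : ℂ) • p1 +
    (v.be : ℂ) • p0) +
    (v.ka : ℂ) • (PowerSeries.X * (PowerSeries.X * (p3 + (3 : ℂ) • p2 + (3 : ℂ) • p1 + p0)))

/-- The formal derivative of the operator with respect to `D`, on power series. -/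
def opSeries' (v : MukaiCase) (p0 p1 p2 : ℂ⟦X⟧) : ℂ⟦X⟧ :=
  (3 : ℂ) • p2 - PowerSeries.X * ((6 * v.al : ℂ) • p2 + (6 * v.al : ℂ) • p1 +
    (v.al + 2 * v.be : ℂ) • p0) +
    (v.ka : ℂ) • (PowerSeries.X * (PowerSeries.X * ((3 : ℂ) • p2 + (6 : ℂ) • p1 + (3 : ℂ) • p0)))

lemma op_expand {R : Type*} [Ring R] (v : MukaiCase) (t s : R) : v.op t s =
    s * s * s - t * ((2 * v.al : ℤ) • (s * s * s) + (3 * v.al : ℤ) • (s * s) +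
      (v.al + 2 * v.be : ℤ) • s + (v.be : ℤ) • 1) +
      v.ka • (t * (t * (s * s * s + (3 : ℤ) • (s * s) + (3 : ℤ) • s + 1))) := by
  cases v <;> simp only [op, al, be, ka, Int.reduceMul, Int.reduceAdd] <;> noncomm_ring

lemma tMul_apply (p : ℂ⟦X⟧) : tMul p = PowerSeries.X * p := rfl

lemma op_apply (v : MukaiCase) (p : ℂ⟦X⟧) : v.op tMul theta p =
    v.opSeries p (theta p) (theta (theta p)) (theta (theta (theta p))) := by
  rw [op_expand]
  simp only [LinearMap.add_apply, LinearMap.sub_apply, Module.End.mul_apply, LinearMap.smul_apply,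
    tMul_apply, Module.End.one_apply, opSeries, ← Int.cast_smul_eq_zsmul ℂ]
  push_cast
  rfl

lemma thetaLog_apply (f h : ℂ⟦X⟧) : thetaLog (f, h) = (theta f + h, theta h) := by
  simp [thetaLog]

lemma tMulLog_apply (f h : ℂ⟦X⟧) :
    tMulLog (f, h) = (PowerSeries.X * f, PowerSeries.X * h) := rfl

/-- Commuting L past log t produces its formal derivative: L(h log t) = (Lh) log t + (∂L/∂D)h. -/
lemma op_log_apply_fst (v : MukaiCase) (f h : ℂ⟦X⟧) : (v.op tMulLog thetaLog (f, h)).1 =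
    v.op tMul theta f + v.opSeries' h (theta h) (theta (theta h)) := by
  rw [op_expand, op_apply]
  simp only [LinearMap.add_apply, LinearMap.sub_apply, Module.End.mul_apply, LinearMap.smul_apply,
    tMulLog_apply, thetaLog_apply, Module.End.one_apply, opSeries, opSeries', map_add,
    Prod.fst_add, Prod.fst_sub, Prod.smul_mk, Prod.mk_add_mk,
    ← Int.cast_smul_eq_zsmul ℂ]
  simp only [PowerSeries.smul_eq_C_mul]
  push_cast
  simp only [map_add, map_mul, map_ofNat, map_intCast]
  ring

lemma evalOn_opSeries (v : MukaiCase) {p0 p1 p2 p3 : ℂ⟦X⟧} {y0 y1 y2 y3 : ℂ → ℂ} {r : ℝ}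
    (h0 : EvalOn p0 y0 r) (h1 : EvalOn p1 y1 r) (h2 : EvalOn p2 y2 r) (h3 : EvalOn p3 y3 r) :
    EvalOn (v.opSeries p0 p1 p2 p3) (v.opFun y0 y1 y2 y3) r := by
  refine ((h3.sub ((((h3.smul _).add (h2.smul _)).add (h1.smul _)).add (h0.smul _)).X_mul).add
    ((((h3.add (h2.smul _)).add (h1.smul _)).add h0).X_mul.X_mul.smul _)).congr fun z _ => ?_
  simp only [Pi.add_apply, Pi.sub_apply, Pi.smul_apply, smul_eq_mul, opFun]
  ring

lemma evalOn_opSeries' (v : MukaiCase) {p0 p1 p2 : ℂ⟦X⟧} {y0 y1 y2 : ℂ → ℂ} {r : ℝ}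
    (h0 : EvalOn p0 y0 r) (h1 : EvalOn p1 y1 r) (h2 : EvalOn p2 y2 r) :
    EvalOn (v.opSeries' p0 p1 p2) (v.opFun' y0 y1 y2) r := by
  refine (((h2.smul _).sub (((h2.smul _).add (h1.smul _)).add (h0.smul _)).X_mul).add
    ((((h2.smul _).add (h1.smul _)).add (h0.smul _)).X_mul.X_mul.smul _)).congr fun z _ => ?_
  simp only [Pi.add_apply, Pi.sub_apply, Pi.smul_apply, smul_eq_mul, opFun']
  ring

lemma coeff_op_one (v : MukaiCase) (p : ℂ⟦X⟧) : PowerSeries.coeff 1 (v.op tMul theta p) =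
    PowerSeries.coeff 1 p - v.be * PowerSeries.coeff 0 p := by
  rw [op_apply, ← zero_add 1]
  simp only [opSeries, map_add, map_sub, PowerSeries.coeff_smul, PowerSeries.coeff_zero_X_mul,
    PowerSeries.coeff_succ_X_mul, coeff_theta, smul_eq_mul]
  push_cast
  ring

lemma coeff_op_succ_succ (v : MukaiCase) (p : ℂ⟦X⟧) (n : ℕ) :
    PowerSeries.coeff (n + 2) (v.op tMul theta p) =
    (n + 2) ^ 3 * PowerSeries.coeff (n + 2) p - (2 * n + 3) * (v.al * (n + 1) * (n + 2) + v.be) *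
      PowerSeries.coeff (n + 1) p + v.ka * (n + 1) ^ 3 * PowerSeries.coeff n p := by
  rw [op_apply, show n + 2 = (n + 1) + 1 from rfl]
  simp only [opSeries, map_add, map_sub, PowerSeries.coeff_smul,
    PowerSeries.coeff_succ_X_mul, coeff_theta, smul_eq_mul]
  push_cast
  ring

end MukaiCase

/-! ### Convergence of formal solutions -/

lemma EvalOn.exists_bound {p : ℂ⟦X⟧} {f : ℂ → ℂ} {r : ℝ} (h : EvalOn p f r) (hr : 0 < r) :
    ∃ C M : ℝ, 0 < C ∧ 0 < M ∧ ∀ n, ‖PowerSeries.coeff n p‖ ≤ C * M ^ n := by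
  have hz : ‖((r / 2 : ℝ) : ℂ)‖ = r / 2 := by
    rw [Complex.norm_real, Real.norm_of_nonneg (by positivity)]
  have h1 := (h ((r / 2 : ℝ) : ℂ) (by rw [hz]; linarith)).summable.tendsto_atTop_zero
  obtain ⟨C, hC⟩ := h1.norm.bddAbove_range
  refine ⟨max C 1, (r / 2)⁻¹, by positivity, by positivity, fun n => ?_⟩
  have := hC ⟨n, rfl⟩
  simp only [norm_mul, norm_pow, hz] at this
  rw [inv_pow, ← div_eq_mul_inv, le_div_iff₀ (by positivity)]
  exact this.trans (le_max_left _ _)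

lemma evalOn_of_bound {p : ℂ⟦X⟧} {C M : ℝ} (hM : 0 < M)
    (h : ∀ n, ‖PowerSeries.coeff n p‖ ≤ C * M ^ n) :
    EvalOn p (fun z => ∑' n, PowerSeries.coeff n p * z ^ n) M⁻¹ := by
  intro z hz
  refine Summable.hasSum (Summable.of_norm_bounded (g := fun n => C * (M * ‖z‖) ^ n) ?_ ?_)
  · refine (summable_geometric_of_lt_one (by positivity) ?_).mul_left C
    rwa [← lt_inv_mul_iff₀ hM, mul_one]
  · intro n
    rw [norm_mul, norm_pow, mul_pow, ← mul_assoc]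
    gcongr
    exact h n

namespace MukaiCase

/-- The indicial polynomial n³ dominates the other coefficients of the three-term recurrence, so
dividing by it leaves bounded multipliers and a geometric majorant closes the induction. -/
lemma exists_bound_of_op (v : MukaiCase) {p : ℂ⟦X⟧} {C M : ℝ} (hC : 0 < C) (hM : 0 < M)
    (h : ∀ n, ‖PowerSeries.coeff n (v.op tMul theta p)‖ ≤ C * M ^ n) :
    ∃ C' K : ℝ, 0 < K ∧ ∀ n, ‖PowerSeries.coeff n p‖ ≤ C' * K ^ n := by
  set c1 : ℝ := 2 * (|(v.al : ℝ)| + |(v.be : ℝ)|) with hc1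
  set c2 : ℝ := |(v.ka : ℝ)| with hc2
  have hc1' : 0 ≤ c1 := by positivity
  have hc2' : 0 ≤ c2 := by positivity
  -- With these K and C', half of C'Kⁿ absorbs the inhomogeneous term and the other half the two
  -- recurrence terms.
  set K := M + 1 + 2 * (c1 + c2) with hK
  set C' := 2 * C + ‖PowerSeries.coeff 0 p‖ + ‖PowerSeries.coeff 1 p‖ with hC'
  have hK1 : 1 ≤ K := by linarith
  have hC'0 : 0 ≤ C' := by positivity
  refine ⟨C', K, by linarith, fun n => ?_⟩
  have key : ∀ n, ‖PowerSeries.coeff (n + 2) p‖ ≤ C * M ^ (n + 2) +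
      c1 * ‖PowerSeries.coeff (n + 1) p‖ + c2 * ‖PowerSeries.coeff n p‖ := by
    intro n
    have h1 := v.coeff_op_succ_succ p n
    have hn : (0 : ℝ) ≤ n := Nat.cast_nonneg n
    have h2 : (n + 2 : ℝ) ^ 3 * ‖PowerSeries.coeff (n + 2) p‖ ≤
        C * M ^ (n + 2) + (n + 2 : ℝ) ^ 3 * (c1 * ‖PowerSeries.coeff (n + 1) p‖) +
          (n + 2 : ℝ) ^ 3 * (c2 * ‖PowerSeries.coeff n p‖) := by
      have e1 : (n + 2 : ℝ) ^ 3 * ‖PowerSeries.coeff (n + 2) p‖ =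
          ‖(n + 2 : ℂ) ^ 3 * PowerSeries.coeff (n + 2) p‖ := by
        rw [norm_mul, norm_pow]
        norm_cast
      have e2 : (n + 2 : ℂ) ^ 3 * PowerSeries.coeff (n + 2) p =
          PowerSeries.coeff (n + 2) (v.op tMul theta p) +
          (((2 * n + 3) * (v.al * (n + 1) * (n + 2) + v.be) : ℝ) : ℂ) *
          PowerSeries.coeff (n + 1) p - ((v.ka * (n + 1) ^ 3 : ℝ) : ℂ) *
            PowerSeries.coeff n p := by
        rw [h1]; push_cast; ring
      rw [e1, e2]
      refine (norm_sub_le _ _).trans (add_le_add ((norm_add_le _ _).trans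
        (add_le_add (h _) ?_)) ?_)
      · rw [norm_mul, ← mul_assoc, Complex.norm_real, Real.norm_eq_abs, abs_mul]
        refine mul_le_mul_of_nonneg_right ?_ (norm_nonneg _)
        calc |(2 * n + 3 : ℝ)| * |v.al * (n + 1 : ℝ) * (n + 2) + v.be|
            ≤ (2 * (n + 2)) * ((|(v.al : ℝ)| + |(v.be : ℝ)|) * (n + 2) ^ 2) := by
              gcongr
              · rw [abs_of_nonneg (by positivity)]; linarith
              · refine (abs_add_le _ _).trans ?_
                rw [abs_mul, abs_mul, abs_of_nonneg (by positivity : (0 : ℝ) ≤ n + 1),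
                  abs_of_nonneg (by positivity : (0 : ℝ) ≤ n + 2)]
                have a1 := abs_nonneg (v.al : ℝ)
                have a2 := abs_nonneg (v.be : ℝ)
                nlinarith [mul_nonneg a1 hn, mul_nonneg a2 hn, mul_nonneg a2 (mul_nonneg hn hn)]
          _ = (n + 2 : ℝ) ^ 3 * c1 := by rw [hc1]; ring
      · rw [norm_mul, ← mul_assoc, Complex.norm_real, Real.norm_eq_abs, abs_mul]
        refine mul_le_mul_of_nonneg_right ?_ (norm_nonneg _)
        rw [abs_of_nonneg (by positivity : (0 : ℝ) ≤ (n + 1) ^ 3), mul_comm]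
        gcongr
        norm_num
    have h3 : (1 : ℝ) ≤ (n + 2 : ℝ) ^ 3 := one_le_pow₀ (by linarith)
    have h4 : C * M ^ (n + 2) ≤ (n + 2 : ℝ) ^ 3 * (C * M ^ (n + 2)) :=
      le_mul_of_one_le_left (by positivity) h3
    have h5 : (0 : ℝ) < (n + 2 : ℝ) ^ 3 := by positivity
    refine le_of_mul_le_mul_left ?_ h5
    linarith
  induction n using Nat.twoStepInduction with
  | zero => rw [pow_zero, mul_one, hC']; linarith [norm_nonneg (PowerSeries.coeff 1 p)]
  | one =>
    rw [pow_one]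
    calc ‖PowerSeries.coeff 1 p‖ ≤ C' := by
          rw [hC']; linarith [norm_nonneg (PowerSeries.coeff 0 p)]
      _ ≤ C' * K := le_mul_of_one_le_right hC'0 hK1
  | more n ih1 ih2 =>
    have hKn : K ^ n ≤ K ^ (n + 1) := pow_le_pow_right₀ hK1 (by omega)
    have hMn : C * M ^ (n + 2) ≤ C' / 2 * K ^ (n + 2) := by
      have hMK : M ≤ K := by linarith
      have hCC : C ≤ C' / 2 := by
        rw [hC']; linarith [norm_nonneg (PowerSeries.coeff 1 p), norm_nonneg (PowerSeries.coeff 0 p)]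
      gcongr
    calc ‖PowerSeries.coeff (n + 2) p‖ ≤ C * M ^ (n + 2) +
      c1 * ‖PowerSeries.coeff (n + 1) p‖ + c2 * ‖PowerSeries.coeff n p‖ := key n
      _ ≤ C' / 2 * K ^ (n + 2) + c1 * (C' * K ^ (n + 1)) + c2 * (C' * K ^ (n + 1)) := by
        have : C' * K ^ n ≤ C' * K ^ (n + 1) := by gcongr
        have := ih1.trans this
        gcongr
      _ = C' / 2 * K ^ (n + 2) + C' / 2 * K ^ (n + 1) * (2 * (c1 + c2)) := by ring
      _ ≤ C' / 2 * K ^ (n + 2) + C' / 2 * K ^ (n + 1) * K := by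
        gcongr; linarith
      _ = C' * K ^ (n + 2) := by ring

/-- Formal solutions of the inhomogeneous equation with convergent right-hand side converge. -/
lemma exists_evalOn_of_op (v : MukaiCase) {p : ℂ⟦X⟧} {f : ℂ → ℂ} {r : ℝ} (hr : 0 < r)
    (h : EvalOn (v.op tMul theta p) f r) :
    ∃ ρ > 0, EvalOn p (fun z => ∑' n, PowerSeries.coeff n p * z ^ n) ρ := by
  obtain ⟨C, M, hC, hM, hb⟩ := h.exists_bound hr
  obtain ⟨C', K, hK, hb'⟩ := v.exists_bound_of_op hC hM hb
  exact ⟨K⁻¹, inv_pos.mpr hK, evalOn_of_bound hK hb'⟩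

end MukaiCase

/-! ### The solutions as functions of `q` -/

lemma EvalOn.unique {p : ℂ⟦X⟧} {f g : ℂ → ℂ} {r : ℝ} (h : EvalOn p f r) (h' : EvalOn p g r)
    {z : ℂ} (hz : ‖z‖ < r) : f z = g z := (h z hz).unique (h' z hz)

/-- On coefficients θ³ is multiplication by n³, so only the constant term survives. Holomorphy at q
= 0 thus excludes the solutions log q and (log q)². -/
lemma EvalOn.eq_const_of_theta {p : ℂ⟦X⟧} {f : ℂ → ℂ} {r : ℝ} (h : EvalOn p f r)
    (h3 : EvalOn (_root_.theta (_root_.theta (_root_.theta p))) (fun _ => 0) r) {z : ℂ}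
    (hz : ‖z‖ < r) : f z = f 0 := by
  have hr : 0 < r := (norm_nonneg z).trans_lt hz
  have h0 : EvalOn (PowerSeries.C 0) (fun _ => (0 : ℂ)) r := evalOn_const 0 r
  have h4 := h3.eq_of_eventuallyEq h0 hr hr EventuallyEq.rfl
  have h5 : ∀ n ≠ 0, PowerSeries.coeff n p = 0 := fun n hn => by
    have := congrArg (PowerSeries.coeff n) h4
    rw [coeff_theta, coeff_theta, coeff_theta, map_zero, map_zero] at this
    have hn' : (n : ℂ) ≠ 0 := by exact_mod_cast hn
    simpa [hn'] using this
  rw [h.apply_zero hr]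
  refine hasSum_unique_of_eq (h z hz)
    (hasSum_ite_eq 0 (PowerSeries.coeff 0 p)) fun n => ?_
  split_ifs with hn
  · simp [hn]
  · rw [h5 n hn, zero_mul]

namespace MukaiCase

lemma exists_radius (v : MukaiCase) {ρ : ℝ} (hρ : 0 < ρ) :
    ∃ r > 0, r ≤ 1 ∧ ∀ q : ℂ, ‖q‖ < r → ‖v.t q‖ < ρ ∧ v.w q ≠ 0 := by
  have hb := Metric.ball_mem_nhds (0 : ℂ) one_pos
  have h1 : ∀ᶠ q in 𝓝 (0 : ℂ), ‖v.t q‖ < ρ := by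
    have := ((v.differentiableOn_t.differentiableAt hb).continuousAt).norm
    refine this.eventually_lt continuousAt_const ?_
    simpa [v.t_zero] using hρ
  have h2 : ∀ᶠ q in 𝓝 (0 : ℂ), v.w q ≠ 0 := by
    refine (v.differentiableOn_w.differentiableAt hb).continuousAt.eventually_ne ?_
    rw [v.w_zero]; exact one_ne_zero
  obtain ⟨r, hr, h⟩ := Metric.eventually_nhds_iff.mp (h1.and h2)
  exact ⟨min r 1, by positivity, min_le_right _ _, fun q hq =>
    h (by simpa using hq.trans_le (min_le_left _ _))⟩

lemma exists_evalOn_comp_t (v : MukaiCase) {p : ℂ⟦X⟧} {y e : ℂ → ℂ} {ρ r : ℝ}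
    (hy : EvalOn p y ρ) (he : EvalOn (v.op tMul theta p) e ρ) (hr1 : r ≤ 1)
    (hr : ∀ q : ℂ, ‖q‖ < r → ‖v.t q‖ < ρ ∧ v.w q ≠ 0) :
    ∃ pH : ℂ⟦X⟧, EvalOn pH (fun q => y (v.t q) * (v.phi q)⁻¹) r ∧
      EvalOn (theta (theta (theta pH))) (fun q => v.phi q * v.w q * e (v.t q)) r := by
  have hmem : ∀ {s : ℝ} {q : ℂ}, q ∈ Metric.ball (0 : ℂ) s → ‖q‖ < s := fun h => by simpa using h
  obtain ⟨g1, g2, h1, h2, h3⟩ := v.hasTheta_comp_t_div_phi (V := Metric.ball 0 r)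
    (U := Metric.ball 0 ρ) (fun q hq => (hmem hq).trans_le hr1) Metric.isOpen_ball
    (fun q hq => (hr q (hmem hq)).2) (fun q hq => by simpa using (hr q (hmem hq)).1) hy.hasTheta
    hy.theta.hasTheta hy.theta.theta.hasTheta
  have hH := EvalOn.of_differentiableOn (fun q hq => (h1 q hq).1.differentiableWithinAt)
  refine ⟨_, hH, (h3.evalOn (h2.evalOn (h1.evalOn hH))).congr fun q hq => ?_⟩
  rw [op_apply] at he
  rw [he.unique (v.evalOn_opSeries hy hy.theta hy.theta.theta hy.theta.theta.theta) (hr q hq).1]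

variable {a b g : ℕ → ℂ}

lemma IsSolutionA.exists_evalOn {v : MukaiCase} (ha : v.IsSolutionA a) :
    ∃ ρ > 0, EvalOn (PowerSeries.mk a) (fun z => ∑' n, a n * z ^ n) ρ := by
  have h0 : EvalOn (v.op tMul theta (PowerSeries.mk a)) (fun _ => 0) 1 := by
    rw [ha.2, ← map_zero PowerSeries.C]; exact evalOn_const 0 1
  simpa using v.exists_evalOn_of_op one_pos h0

/-- D − 1 multiplies the n-th coefficient by n − 1, so only degree one survives, and b₀ = 0, b₁ = 1
fix its coefficient. -/
lemma IsSolutionB.op_eq {v : MukaiCase} (hb : v.IsSolutionB b) :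
    v.op tMul theta (PowerSeries.mk b) = PowerSeries.X := by
  ext n
  have h1 := congrArg (PowerSeries.coeff n) hb.2.2
  rw [LinearMap.sub_apply, Module.End.one_apply, map_sub, coeff_theta, map_zero] at h1
  rcases eq_or_ne n 1 with rfl | hn
  · rw [coeff_op_one, PowerSeries.coeff_mk, PowerSeries.coeff_mk, hb.1, hb.2.1]; simp
  · have : (n : ℂ) - 1 ≠ 0 := sub_ne_zero.mpr (by exact_mod_cast hn)
    rw [PowerSeries.coeff_X, if_neg hn]
    apply mul_left_cancel₀ this
    linear_combination h1

lemma evalOn_X (r : ℝ) : EvalOn PowerSeries.X (fun z => z) r := by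
  have := (evalOn_const 1 r).X_mul
  rw [map_one, mul_one] at this
  exact this.congr fun z _ => mul_one z

lemma IsSolutionB.exists_evalOn {v : MukaiCase} (hb : v.IsSolutionB b) :
    ∃ ρ > 0, EvalOn (PowerSeries.mk b) (fun z => ∑' n, b n * z ^ n) ρ := by
  have h0 : EvalOn (v.op tMul theta (PowerSeries.mk b)) (fun z => z) 1 := hb.op_eq ▸ evalOn_X 1
  simpa using v.exists_evalOn_of_op one_pos h0

lemma tsum_mul_zero_pow (c : ℕ → ℂ) : ∑' n, c n * (0 : ℂ) ^ n = c 0 := by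
  rw [tsum_eq_single 0 (fun n hn => by simp [hn])]; simp

lemma IsSolutionA.hasSum_phi {v : MukaiCase} (ha : v.IsSolutionA a) :
    ∃ r > 0, ∀ q : ℂ, ‖q‖ < r → HasSum (fun n => a n * v.t q ^ n) (v.phi q) := by
  obtain ⟨ρ, hρ, hA⟩ := ha.exists_evalOn
  obtain ⟨r, hr, hr1, h⟩ := v.exists_radius hρ
  have h0 : EvalOn (v.op tMul theta (PowerSeries.mk a)) (fun _ => 0) ρ := by
    rw [ha.2, ← map_zero PowerSeries.C]; exact evalOn_const 0 ρ
  obtain ⟨pH, hH, hH3⟩ := v.exists_evalOn_comp_t hA h0 hr1 h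
  refine ⟨r, hr, fun q hq => ?_⟩
  have hc := hH.eq_const_of_theta (hH3.congr fun q _ => by simp) hq
  simp only [v.t_zero, v.phi_zero, tsum_mul_zero_pow, ha.1] at hc
  have hs := hA _ (h q hq).1
  simp only [PowerSeries.coeff_mk] at hs
  have h1 : ∑' n, a n * v.t q ^ n = v.phi q := by
    have := v.phi_ne_zero (hq.trans_le hr1)
    field_simp at hc
    linear_combination hc
  rwa [h1] at hs

lemma IsSolutionB.hasSum_eichler {v : MukaiCase} (hb : v.IsSolutionB b) :
    ∃ r > 0, ∀ q : ℂ, ‖q‖ < r → HasSum (fun n => b n * v.t q ^ n)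
      (v.phi q * eichler (fun n => PowerSeries.coeff n v.formFSeries) q) := by
  obtain ⟨ρ, hρ, hB⟩ := hb.exists_evalOn
  obtain ⟨r, hr, hr1, h⟩ := v.exists_radius hρ
  have h0 : EvalOn (v.op tMul theta (PowerSeries.mk b)) (fun z => z) ρ := hb.op_eq ▸ evalOn_X ρ
  obtain ⟨pH, hH, hH3⟩ := v.exists_evalOn_comp_t hB h0 hr1 h
  -- The right-hand side Φ·w·t of the transformed equation equals wψ, which is F.
  have hF : theta (theta (theta pH)) = v.formFSeries := by
    refine (hH3.congr (f' := v.formF) fun q hq => ?_).eq_of_eventuallyEq v.evalOn_formF hr one_pos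
      EventuallyEq.rfl
    have hq1 := hq.trans_le hr1
    rw [v.relations.F_eq q hq1, ← v.t_mul_phi hq1]; ring
  have hcoeff : ∀ n, PowerSeries.coeff n pH =
      PowerSeries.coeff n v.formFSeries / (n : ℂ) ^ 3 := by
    intro n
    rcases eq_or_ne n 0 with rfl | hn
    · rw [← hH.apply_zero hr]
      simp [v.t_zero, tsum_mul_zero_pow, hb.1]
    · have hn' : (n : ℂ) ≠ 0 := by exact_mod_cast hn
      rw [← hF, coeff_theta, coeff_theta, coeff_theta]
      field_simp
  refine ⟨r, hr, fun q hq => ?_⟩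
  have hs := hB _ (h q hq).1
  have hq1 := (hH q hq).tsum_eq
  simp only [PowerSeries.coeff_mk, hcoeff] at hs hq1
  rw [eichler, hq1]
  have := v.phi_ne_zero (hq.trans_le hr1)
  field_simp
  exact hs

/-- `t(q) / q`. -/
def tQuot (v : MukaiCase) : ℂ → ℂ := dslope v.t 0

lemma tQuot_zero (v : MukaiCase) : v.tQuot 0 = 1 := by rw [tQuot, dslope_same, deriv_t_zero]

lemma mul_tQuot (v : MukaiCase) (q : ℂ) : q * v.tQuot q = v.t q := by
  have := sub_smul_dslope v.t 0 q
  simpa [v.t_zero, tQuot] using this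

lemma differentiableOn_tQuot (v : MukaiCase) : DifferentiableOn ℂ v.tQuot (Metric.ball 0 1) :=
  (Complex.differentiableOn_dslope (Metric.ball_mem_nhds _ one_pos)).mpr v.differentiableOn_t

lemma hasTheta_log_tQuot (v : MukaiCase) {r : ℝ} (hr1 : r ≤ 1)
    (hs : ∀ q : ℂ, ‖q‖ < r → v.tQuot q ∈ Complex.slitPlane) :
    HasTheta (fun q => Complex.log (v.tQuot q)) (fun q => v.w q - 1) (Metric.ball 0 r) := by
  intro q hq
  have hq' : ‖q‖ < r := by simpa using hq
  have hq1 := hq'.trans_le hr1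
  have hd := hasDerivAt_of_norm_lt v.differentiableOn_tQuot hq1
  have hl := hd.clog (hs q hq')
  refine ⟨hl.differentiableAt, ?_⟩
  beta_reduce
  rw [thetaFun, hl.deriv]
  rcases eq_or_ne q 0 with rfl | h0
  · rw [v.w_zero]; simp
  have hne : v.tQuot q ≠ 0 := Complex.slitPlane_ne_zero (hs q hq')
  have h2 := v.theta_t hq1
  have h3 : deriv v.t q = 1 * v.tQuot q + q * deriv v.tQuot q := by
    have := ((hasDerivAt_id' q).fun_mul hd).deriv
    rw [← this]
    congr 1
    ext z
    exact (v.mul_tQuot z).symm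
  rw [thetaFun, h3, ← v.mul_tQuot q] at h2
  field_simp
  apply mul_left_cancel₀ h0
  linear_combination h2

lemma IsSolutionLog.op_eq {v : MukaiCase} (hg : v.IsSolutionLog a g) :
    v.op tMul theta (PowerSeries.mk g) = -v.opSeries' (PowerSeries.mk a)
      (theta (PowerSeries.mk a)) (theta (theta (PowerSeries.mk a))) := by
  have := v.op_log_apply_fst (PowerSeries.mk g) (PowerSeries.mk a)
  rw [hg.2] at this
  exact eq_neg_of_add_eq_zero_left this.symm

/-- As w − 1 = θ log(t/q), this evaluates θ³ log(t/q). It is the exact negative of what L(G) =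
−(∂L/∂D)A contributes to θ³(G(t)/Φ). The comparison uses the identities obtained by differentiating
A(t) = Φ. -/
lemma exists_theta_theta_w (v : MukaiCase) {A : ℂ → ℂ} {pA : ℂ⟦X⟧} {ρ r : ℝ} (hr1 : r ≤ 1)
    (hA : EvalOn pA A ρ) (hr : ∀ q : ℂ, ‖q‖ < r → ‖v.t q‖ < ρ ∧ v.w q ≠ 0)
    (hAt : ∀ q : ℂ, ‖q‖ < r → A (v.t q) = v.phi q) :
    ∃ W : ℂ → ℂ, HasTheta v.w W (Metric.ball 0 r) ∧ HasTheta W (fun q => v.phi q * v.w q *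
      v.opFun' A (thetaFun A) (thetaFun (thetaFun A)) (v.t q)) (Metric.ball 0 r) := by
  have hmem : ∀ {s : ℝ} {q : ℂ}, q ∈ Metric.ball (0 : ℂ) s → ‖q‖ < s := fun h => by simpa using h
  have hV : ∀ q ∈ Metric.ball (0 : ℂ) r, ‖q‖ < 1 := fun q hq => (hmem hq).trans_le hr1
  have hU : ∀ q ∈ Metric.ball (0 : ℂ) r, v.t q ∈ Metric.ball (0 : ℂ) ρ := fun q hq => by
    simpa using (hr q (hmem hq)).1
  have ht := v.hasTheta_t hV
  have hp := v.hasTheta_phi hV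
  have hu := v.hasTheta_u hV
  have hW := v.hasTheta_w hV Metric.isOpen_ball fun q hq => (hr q (hmem hq)).2
  have k0 := hA.hasTheta.comp ht hU
  have k1 := hA.theta.hasTheta.comp ht hU
  have hQ := (ht.const_mul (-v.al)).add ((ht.mul ht).const_mul v.ka)
  have hW2 := (hu.mul hW).add ((hp.mul hp).mul hQ)
  refine ⟨_, hW.congr_right fun q hq => ?_, hW2.congr_right fun q hq => ?_⟩
  · ring
  · have e1 : ∀ q ∈ Metric.ball (0 : ℂ) r, _ := fun q hq =>
      k0.unique hp Metric.isOpen_ball (fun q hq => hAt q (hmem hq)) hq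
    have e2 := (hW.mul k1).unique (hu.mul hp) Metric.isOpen_ball e1 hq
    have e1 := e1 q hq
    have hs := v.w_sq (hV q hq)
    have hA0 := hAt q (hmem hq)
    apply mul_left_cancel₀ (v.phi_ne_zero (hV q hq))
    simp only [opFun', hA0]
    linear_combination (3 * v.w q * thetaFun (thetaFun A) (v.t q)) * hs - 3 * v.w q * e2 +
      (3 * (v.u q * v.w q + v.phi q ^ 2 * (-v.al * v.t q + v.ka * v.t q ^ 2)) -
        6 * v.phi q ^ 2 * (-v.al * v.t q + v.ka * v.t q ^ 2)) * e1

lemma IsSolutionLog.modularParam_t {v : MukaiCase} (ha : v.IsSolutionA a)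
    (hg : v.IsSolutionLog a g) :
    ∃ r > 0, ∀ q : ℂ, ‖q‖ < r →
      Summable (fun n => g n * v.t q ^ n) ∧ modularParam a g (v.t q) = q := by
  obtain ⟨ρ₁, hρ₁, hA⟩ := ha.exists_evalOn
  have hA' := (v.evalOn_opSeries' hA hA.theta hA.theta.theta).neg
  rw [← hg.op_eq] at hA'
  obtain ⟨ρ₂, hρ₂, hG⟩ := v.exists_evalOn_of_op hρ₁ hA'
  simp only [PowerSeries.coeff_mk] at hG
  have hρ : 0 < min ρ₁ ρ₂ := lt_min hρ₁ hρ₂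
  obtain ⟨r₁, hr₁, hr₁1, h⟩ := v.exists_radius hρ
  obtain ⟨r₂, hr₂, hphi⟩ := ha.hasSum_phi
  -- Since t/q tends to 1, the principal branch of log(t/q) is holomorphic near 0 and vanishes
  -- there.
  have hsl : ∀ᶠ q in 𝓝 (0 : ℂ), v.tQuot q ∈ Complex.slitPlane := by
    have := (v.differentiableOn_tQuot.differentiableAt
      (Metric.ball_mem_nhds _ one_pos)).continuousAt
    refine this.eventually_mem (Complex.isOpen_slitPlane.mem_nhds ?_)
    rw [tQuot_zero]; exact Complex.one_mem_slitPlane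
  obtain ⟨r₃, hr₃, hsl⟩ := Metric.eventually_nhds_iff.mp hsl
  set r := min r₁ (min r₂ r₃) with hr
  have hr0 : 0 < r := by positivity
  have hrr₁ : r ≤ r₁ := min_le_left _ _
  have hrr₂ : r ≤ r₂ := (min_le_right _ _).trans (min_le_left _ _)
  have hrr₃ : r ≤ r₃ := (min_le_right _ _).trans (min_le_right _ _)
  have hr1 := hrr₁.trans hr₁1
  have hrad : ∀ q : ℂ, ‖q‖ < r → ‖v.t q‖ < min ρ₁ ρ₂ ∧ v.w q ≠ 0 := fun q hq =>
    h q (hq.trans_le hrr₁)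
  obtain ⟨pH, hH, hH3⟩ := v.exists_evalOn_comp_t (hG.mono (min_le_right ρ₁ ρ₂))
    (hA'.mono (min_le_left ρ₁ ρ₂)) hr1 hrad
  have hAt : ∀ q : ℂ, ‖q‖ < r → ∑' n, a n * v.t q ^ n = v.phi q := fun q hq =>
    (hphi q (hq.trans_le hrr₂)).tsum_eq
  obtain ⟨W, hW, hW2⟩ := v.exists_theta_theta_w hr1 hA
    (fun q hq => ⟨(hrad q hq).1.trans_le (min_le_left _ _), (hrad q hq).2⟩) hAt
  have hL := v.hasTheta_log_tQuot hr1 fun q hq => hsl (by simpa using hq.trans_le hrr₃)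
  have hLs := EvalOn.of_differentiableOn (fun q hq => (hL q hq).1.differentiableWithinAt)
  have hL3 := hW2.evalOn (((hW.sub (HasTheta.const 1)).congr_right (g' := W)
    fun q _ => by ring).evalOn (hL.evalOn hLs))
  have hK := hLs.add hH
  have hK3 := hL3.add hH3
  rw [← map_add, ← map_add, ← map_add] at hK3
  refine ⟨r, hr0, fun q hq => ?_⟩
  -- The third θ-derivatives of log(t/q) and G(t)/Φ cancel, so their sum keeps its value 0 at the
  -- origin.
  have hc := hK.eq_const_of_theta (hK3.congr fun q _ => by
    simp only [Pi.add_apply, Pi.neg_apply]; ring) hq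
  simp only [Pi.add_apply, v.t_zero, tQuot_zero, Complex.log_one, tsum_mul_zero_pow, hg.1,
    zero_mul, add_zero] at hc
  have hs := hG _ ((hrad q hq).1.trans_le (min_le_right _ _))
  simp only [PowerSeries.coeff_mk] at hs
  refine ⟨hs.summable, ?_⟩
  have hne : v.tQuot q ≠ 0 := Complex.slitPlane_ne_zero (hsl (by simpa using hq.trans_le hrr₃))
  rw [modularParam, hAt q hq, div_eq_mul_inv, ← v.mul_tQuot q]
  nth_rewrite 1 [← Complex.exp_log hne]
  rw [mul_assoc, ← Complex.exp_add, v.mul_tQuot q, hc, Complex.exp_zero, mul_one]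

end MukaiCase

/-! ### The L-function -/

lemma HasSum.of_eq {f g : ℕ → ℂ} {a b : ℂ} (h : HasSum f a) (hfg : ∀ n, f n = g n)
    (hab : a = b) : HasSum g b := by
  obtain rfl : f = g := funext hfg
  exact hab ▸ h

lemma LSeriesHasSum.pow_mul {f : ℕ → ℂ} {s a : ℂ} (k : ℕ) (h : LSeriesHasSum f (s - k) a) :
    LSeriesHasSum (fun n => (n : ℂ) ^ k * f n) s a := by
  refine HasSum.of_eq h (fun n => ?_) rfl
  rcases eq_or_ne n 0 with rfl | hn
  · simp
  · have hn' : (n : ℂ) ≠ 0 := by exact_mod_cast hn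
    rw [LSeries.term_of_ne_zero hn, LSeries.term_of_ne_zero hn, Complex.cpow_sub _ _ hn',
      Complex.cpow_natCast]
    have : (n : ℂ) ^ s ≠ 0 := by simp [Complex.cpow_eq_zero_iff, hn']
    field_simp

lemma convolution_one_pow (k n : ℕ) :
    LSeries.convolution (1 : ℕ → ℂ) (fun n => (n : ℂ) ^ k) n =
      (ArithmeticFunction.sigma k n : ℂ) := by
  rw [LSeries.convolution_def]
  simp only [Pi.one_apply, one_mul]
  rw [ArithmeticFunction.sigma_apply, Nat.cast_sum,
    Nat.sum_divisorsAntidiagonal' (f := fun _ d => (d : ℂ) ^ k)]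
  simp

/-- Complete multiplicativity of χ makes χ·σ_k the Dirichlet convolution of χ with nᵏχ(n). -/
lemma LSeriesHasSum_mul_sigma {M : ℕ} (χ : DirichletCharacter ℂ M) (k : ℕ) {s : ℂ}
    (hs : k + 1 < s.re) :
    LSeriesHasSum (fun n => χ n * (ArithmeticFunction.sigma k n : ℂ)) s
      (LSeries (χ ·) s * LSeries (χ ·) (s - k)) := by
  have h1 : 1 < s.re := by
    have : (0 : ℝ) ≤ k := Nat.cast_nonneg k
    linarith
  have h2 : 1 < (s - k).re := by simp; linarith
  have e1 := (χ.LSeriesSummable_of_one_lt_re h1).LSeriesHasSum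
  have e2 := LSeriesHasSum.pow_mul k (χ.LSeriesSummable_of_one_lt_re h2).LSeriesHasSum
  have e3 := e1.convolution e2
  refine (LSeriesHasSum_congr s _ fun {n} hn => ?_).mp e3
  have h3 := congrFun (χ.mul_convolution_distrib 1 (fun n => (n : ℂ) ^ k)) n
  rw [Pi.mul_apply, convolution_one_pow k n] at h3
  rw [← h3]
  refine congrFun (LSeries.convolution_congr (fun {n} _ => ?_) fun {n} _ => ?_) n
  · simp
  · simp [mul_comm]

lemma LSeriesHasSum_sigma (k : ℕ) {s : ℂ} (hs : k + 1 < s.re) :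
    LSeriesHasSum (fun n => (ArithmeticFunction.sigma k n : ℂ)) s
      (riemannZeta s * riemannZeta (s - k)) := by
  have h1 : 1 < s.re := by
    have : (0 : ℝ) ≤ k := Nat.cast_nonneg k
    linarith
  have h2 : 1 < (s - k).re := by simp; linarith
  have h := LSeriesHasSum_mul_sigma (1 : DirichletCharacter ℂ 1) k hs
  rw [DirichletCharacter.LSeries_modOne_eq, LSeries_one_eq_riemannZeta h1,
    LSeries_one_eq_riemannZeta h2] at h
  refine (LSeriesHasSum_congr s _ fun {n} hn => ?_).mp h
  have : (1 : DirichletCharacter ℂ 1) n = 1 := congrFun DirichletCharacter.modOne_eq_one n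
  rw [this, one_mul]

lemma LSeriesHasSum.dilate {f : ℕ → ℂ} {s a : ℂ} {i : ℕ} (hi : 0 < i) (h : LSeriesHasSum f s a) :
    LSeriesHasSum (fun n => if i ∣ n then f (n / i) else 0) s ((i : ℂ) ^ (-s) * a) := by
  have hinj : Function.Injective fun n : ℕ => i * n := fun a b hab =>
    Nat.eq_of_mul_eq_mul_left hi hab
  refine (hinj.hasSum_iff fun n hn => ?_).mp ?_
  · have : ¬ i ∣ n := fun ⟨m, hm⟩ => hn ⟨m, hm.symm⟩
    simp [LSeries.term_def, this]
  · refine HasSum.of_eq (h.mul_left ((i : ℂ) ^ (-s))) (fun n => ?_) rfl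
    simp only [Function.comp_apply, LSeries.term_def]
    rcases eq_or_ne n 0 with rfl | hn
    · simp
    · have hin : i * n ≠ 0 := mul_ne_zero hi.ne' hn
      rw [if_neg hn, if_neg hin, if_pos (dvd_mul_right i n), Nat.mul_div_cancel_left _ hi,
        Nat.cast_mul, Complex.natCast_mul_natCast_cpow, Complex.cpow_neg]
      ring

/-- The entire function `(s - 1) ζ(s)`. -/
def zetaReg : ℂ → ℂ := Function.update (fun s => (s - 1) * riemannZeta s) 1 1

lemma zetaReg_of_ne {s : ℂ} (hs : s ≠ 1) : zetaReg s = (s - 1) * riemannZeta s :=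
  Function.update_of_ne hs _ _

lemma differentiable_zetaReg : Differentiable ℂ zetaReg := by
  intro s
  rcases eq_or_ne s 1 with rfl | hs
  · refine (Complex.analyticAt_of_differentiable_on_punctured_nhds_of_continuousAt ?_
      (continuousAt_update_same.mpr riemannZeta_residue_one)).differentiableAt
    filter_upwards [self_mem_nhdsWithin] with z hz
    have hz : z ≠ 1 := hz
    refine DifferentiableAt.congr_of_eventuallyEq (f := fun s => (s - 1) * riemannZeta s)
      ((differentiableAt_id.sub_const 1).mul (differentiableAt_riemannZeta hz)) ?_
    filter_upwards [isOpen_ne.mem_nhds hz] with y hy using zetaReg_of_ne hy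
  · refine DifferentiableAt.congr_of_eventuallyEq (f := fun s => (s - 1) * riemannZeta s)
      ((differentiableAt_id.sub_const 1).mul (differentiableAt_riemannZeta hs)) ?_
    filter_upwards [isOpen_ne.mem_nhds hs] with y hy using zetaReg_of_ne hy

lemma differentiable_dslope {f : ℂ → ℂ} (hf : Differentiable ℂ f) (c : ℂ) :
    Differentiable ℂ (dslope f c) := by
  rw [← differentiableOn_univ] at hf ⊢
  exact (Complex.differentiableOn_dslope univ_mem).mpr hf

/-- The entire function equal to `E(s) ζ(s) ζ(s - 3)` where `E(4) = 0`. -/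
def zetaProd (E : ℂ → ℂ) (s : ℂ) : ℂ :=
  dslope E 4 s * dslope (fun s => zetaReg (s - 3)) 1 s * zetaReg s

lemma differentiable_zetaProd {E : ℂ → ℂ} (hE : Differentiable ℂ E) :
    Differentiable ℂ (zetaProd E) :=
  ((differentiable_dslope hE 4).mul (differentiable_dslope
    (differentiable_zetaReg.comp (differentiable_id.sub_const 3)) 1)).mul differentiable_zetaReg

/-- The pole of ζ(s − 3) at 4 is cancelled by the zero of E, and the pole of ζ(s) at 1 by the
trivial zero ζ(−2) = 0. -/
lemma zetaProd_eq {E : ℂ → ℂ} (hE : E 4 = 0) {s : ℂ} (h1 : s ≠ 1) (h4 : s ≠ 4) :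
    zetaProd E s = E s * riemannZeta s * riemannZeta (s - 3) := by
  have e1 : zetaReg ((1 : ℂ) - 3) = 0 := by
    rw [zetaReg_of_ne (by norm_num)]
    have := riemannZeta_neg_two_mul_nat_add_one 0
    norm_num at this ⊢
    exact this
  have d1 : s - 1 ≠ 0 := sub_ne_zero.mpr h1
  have d4 : s - 4 ≠ 0 := sub_ne_zero.mpr h4
  have h4' : s - 3 ≠ 1 := fun h => h4 (by linear_combination h)
  rw [zetaProd, dslope_of_ne _ h4, dslope_of_ne _ h1, slope_def_field, slope_def_field, hE, e1,
    zetaReg_of_ne h1, zetaReg_of_ne h4']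
  have : s - 3 - 1 = s - 4 := by ring
  rw [this]
  field_simp
  ring

/-- The quadratic character modulo `3`. -/
def quadChar3 : DirichletCharacter ℂ 3 :=
  (quadraticChar (ZMod 3)).ringHomComp (Int.castRingHom ℂ)

lemma quadChar3_apply (n : ℕ) : quadChar3 n = chi3 n := by
  simp [quadChar3, chi3, legendreSym]

lemma quadChar3_ne_one : quadChar3 ≠ 1 := by
  intro h
  have := quadChar3_apply 2
  rw [h, chi3_eq] at this
  have hu : IsUnit ((2 : ℕ) : ZMod 3) := by decide
  rw [MulChar.one_apply hu] at this
  norm_num at this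

namespace MukaiCase

/-- The Euler factors at `2` and `3` in the cases `V12` and `V16`. -/
def eulerFactor : MukaiCase → ℂ → ℂ
  | V12, s => 1 - 7 * 2 ^ (2 - s) + 7 * 3 ^ (2 - s) - 6 ^ (2 - s)
  | V16, s => 1 - 21 / 4 * 2 ^ (2 - s) + 21 / 4 * 4 ^ (2 - s) - 8 ^ (2 - s)
  | V18, _ => 0

lemma differentiable_eulerFactor (v : MukaiCase) : Differentiable ℂ v.eulerFactor := by
  have h : ∀ c : ℂ, c ≠ 0 → Differentiable ℂ fun s : ℂ => c ^ (2 - s) := fun c hc =>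
    ((differentiable_const _).sub differentiable_id).const_cpow (Or.inl hc)
  cases v
  · exact (((differentiable_const _).sub ((h 2 (by norm_num)).const_mul _)).add
      ((h 3 (by norm_num)).const_mul _)).sub (h 6 (by norm_num))
  · exact (((differentiable_const _).sub ((h 2 (by norm_num)).const_mul _)).add
      ((h 4 (by norm_num)).const_mul _)).sub (h 8 (by norm_num))
  · exact differentiable_const _

lemma eulerFactor_four (v : MukaiCase) : v.eulerFactor 4 = 0 := by
  have h : (2 - 4 : ℂ) = -((2 : ℕ) : ℂ) := by norm_num
  cases v <;> simp only [eulerFactor, h, Complex.cpow_neg, Complex.cpow_natCast] <;> norm_num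

/-- The L-function of `F`. -/
def lFun : MukaiCase → ℂ → ℂ
  | V12 => zetaProd (eulerFactor V12)
  | V16 => zetaProd (eulerFactor V16)
  | V18 => fun s => quadChar3.LFunction s * quadChar3.LFunction (s - 3)

/-- Substituting qⁱ contributes i^(−s), and the normalisation of E_{4,i} contributes i². The
constant term is invisible, because an L-series term at 0 is zero by convention. -/
lemma LSeriesHasSum_eis4 {i : ℕ} (hi : 0 < i) {s : ℂ} (hs : 4 < s.re) :
    LSeriesHasSum (fun n => PowerSeries.coeff n (eis4Series i)) s
      ((i : ℂ) ^ (2 - s) * (riemannZeta s * riemannZeta (s - 3))) := by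
  have h := ((LSeriesHasSum_sigma 3 (s := s) (by norm_num; exact hs)).dilate hi).mul_left
    ((i : ℂ) ^ 2)
  have hi' : (i : ℂ) ≠ 0 := by exact_mod_cast hi.ne'
  have e : (i : ℂ) ^ (2 - s) = (i : ℂ) ^ 2 * (i : ℂ) ^ (-s) := by
    rw [sub_eq_add_neg, Complex.cpow_add _ _ hi', Complex.cpow_ofNat]
  rw [e, mul_assoc]
  refine HasSum.of_eq h (fun n => ?_) rfl
  rcases eq_or_ne n 0 with rfl | hn
  · simp
  · rw [LSeries.term_of_ne_zero hn, LSeries.term_of_ne_zero hn, coeff_eis4Series, if_neg hn]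
    ring

lemma LSeriesHasSum_eis4_comb (c : ℂ) {i j k : ℕ} (hi : 0 < i) (hj : 0 < j) (hk : 0 < k) {s : ℂ}
    (hs : 4 < s.re) :
    LSeriesHasSum (fun n => PowerSeries.coeff n (eis4Series 1 - c • eis4Series i +
      c • eis4Series j - eis4Series k)) s
      ((1 - c * (i : ℂ) ^ (2 - s) + c * (j : ℂ) ^ (2 - s) - (k : ℂ) ^ (2 - s)) * riemannZeta s *
        riemannZeta (s - 3)) := by
  have e := (((LSeriesHasSum_eis4 (i := 1) one_pos hs).sub
    ((LSeriesHasSum_eis4 hi hs).smul c)).add ((LSeriesHasSum_eis4 hj hs).smul c)).sub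
    (LSeriesHasSum_eis4 hk hs)
  refine HasSum.of_eq e (fun n => ?_) ?_
  · congr 1
  · rw [Nat.cast_one, Complex.one_cpow]
    ring

lemma differentiable_lFun (v : MukaiCase) : Differentiable ℂ v.lFun := by
  cases v
  · exact differentiable_zetaProd (differentiable_eulerFactor _)
  · exact differentiable_zetaProd (differentiable_eulerFactor _)
  · exact (DirichletCharacter.differentiable_LFunction quadChar3_ne_one).mul
      ((DirichletCharacter.differentiable_LFunction quadChar3_ne_one).comp
        (differentiable_id.sub_const 3))

lemma lFun_isLFunction (v : MukaiCase) :
    IsLFunction (fun n => PowerSeries.coeff n v.formFSeries) v.lFun := by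
  refine ⟨v.differentiable_lFun, fun s hs => ?_⟩
  have h1 : s ≠ 1 := by rintro rfl; norm_num at hs
  have h4 : s ≠ 4 := by rintro rfl; norm_num at hs
  cases v
  · have e := LSeriesHasSum_eis4_comb 7 (i := 2) (j := 3) (k := 6) (by norm_num) (by norm_num)
      (by norm_num) hs
    have : lFun V12 s = _ := zetaProd_eq (eulerFactor_four V12) h1 h4
    rw [this, eulerFactor, formFSeries]
    exact_mod_cast e
  · have e := LSeriesHasSum_eis4_comb (21 / 4) (i := 2) (j := 4) (k := 8) (by norm_num)
      (by norm_num) (by norm_num) hs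
    have : lFun V16 s = _ := zetaProd_eq (eulerFactor_four V16) h1 h4
    rw [this, eulerFactor, formFSeries]
    exact_mod_cast e
  · have := LSeriesHasSum_mul_sigma quadChar3 3 (s := s) (by norm_num; exact hs)
    have h2 : 1 < (s - 3).re := by simp; linarith
    have e : lFun V18 s = LSeries (quadChar3 ·) s * LSeries (quadChar3 ·) (s - 3) := by
      rw [← DirichletCharacter.LFunction_eq_LSeries _ (by linarith),
        ← DirichletCharacter.LFunction_eq_LSeries _ h2]
      rfl
    rw [e]
    refine (LSeriesHasSum_congr s _ fun {n} _ => ?_).mp this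
    rw [quadChar3_apply, formFSeries, coeff_sigmaSeries]

lemma lShape_lFun (v : MukaiCase) : v.LShape v.lFun := by
  cases v
  · exact fun s h1 h4 => zetaProd_eq (eulerFactor_four V12) h1 h4
  · exact fun s h1 h4 => zetaProd_eq (eulerFactor_four V16) h1 h4
  · intro s hs
    have h1 : 1 < s.re := by linarith
    have h2 : 1 < (s - 3).re := by simp; linarith
    have e : lFun V18 s = LSeries (quadChar3 ·) (s - 3) * LSeries (quadChar3 ·) s := by
      rw [← DirichletCharacter.LFunction_eq_LSeries _ h1,
        ← DirichletCharacter.LFunction_eq_LSeries _ h2, mul_comm]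
      rfl
    rw [e]
    have := (quadChar3.LSeries_eulerProduct_hasProd h2).mul
      (quadChar3.LSeries_eulerProduct_hasProd h1)
    simpa [quadChar3_apply, chi3] using this

end MukaiCase

/-! ### The Eichler integral -/

lemma EvalOn.eichler {p : ℂ⟦X⟧} {f : ℂ → ℂ} (h : EvalOn p f 1) :
    EvalOn (PowerSeries.mk fun n => PowerSeries.coeff n p / (n : ℂ) ^ 3)
      (eichler fun n => PowerSeries.coeff n p) 1 := by
  intro z hz
  simp only [PowerSeries.coeff_mk]
  refine Summable.hasSum (Summable.of_norm_bounded (h z hz).summable.norm fun n => ?_)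
  rw [norm_mul, norm_mul]
  gcongr
  rw [norm_div, norm_pow, Complex.norm_natCast]
  rcases eq_or_ne n 0 with rfl | hn
  · simp
  · refine div_le_self (norm_nonneg _) (one_le_pow₀ ?_)
    exact_mod_cast Nat.one_le_iff_ne_zero.mpr hn

lemma theta_cube_eichler {p : ℂ⟦X⟧} {f : ℂ → ℂ} (h : EvalOn p f 1)
    (h0 : PowerSeries.coeff 0 p = 0) {q : ℂ} (hq : ‖q‖ < 1) :
    thetaFun (thetaFun (thetaFun (eichler fun n => PowerSeries.coeff n p))) q = f q := by
  refine EvalOn.unique (p := p) ?_ h hq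
  convert h.eichler.theta.theta.theta using 1
  ext n
  rw [coeff_theta, coeff_theta, coeff_theta, PowerSeries.coeff_mk]
  rcases eq_or_ne n 0 with rfl | hn
  · simp [h0]
  · have : (n : ℂ) ≠ 0 := by exact_mod_cast hn
    field_simp

lemma EvalOn.hasDerivAt_comp_nome {p : ℂ⟦X⟧} {f : ℂ → ℂ} (h : EvalOn p f 1) (c : ℂ) {τ : ℂ}
    (hτ : 0 < τ.im) : HasDerivAt (fun τ => c * f (nome τ))
      (c * (2 * Real.pi * Complex.I) * thetaFun f (nome τ)) τ := by
  have hd : DifferentiableAt ℂ f (nome τ) := h.differentiableOn.differentiableAt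
    (Metric.isOpen_ball.mem_nhds (by simpa using norm_nome_lt_one hτ))
  refine ((hd.hasDerivAt.comp τ (hasDerivAt_nome τ)).const_mul c).congr_deriv ?_
  rw [thetaFun]
  ring

lemma isOpen_im_pos : IsOpen {τ : ℂ | 0 < τ.im} := isOpen_lt continuous_const Complex.continuous_im

lemma isPreconnected_im_pos : IsPreconnected {τ : ℂ | 0 < τ.im} :=
  (convex_halfSpace_im_gt 0).isPreconnected

lemma exists_eq_const_of_hasDerivAt_zero {f : ℂ → ℂ}
    (h : ∀ τ : ℂ, 0 < τ.im → HasDerivAt f 0 τ) : ∃ c, ∀ τ : ℂ, 0 < τ.im → f τ = c := by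
  refine isOpen_im_pos.exists_is_const_of_deriv_eq_zero isPreconnected_im_pos
    (fun τ hτ => (h τ hτ).differentiableAt.differentiableWithinAt) fun τ hτ => (h τ hτ).deriv

lemma exists_quadratic_of_hasDerivAt {f f1 f2 : ℂ → ℂ}
    (h0 : ∀ τ : ℂ, 0 < τ.im → HasDerivAt f (f1 τ) τ)
    (h1 : ∀ τ : ℂ, 0 < τ.im → HasDerivAt f1 (f2 τ) τ)
    (h2 : ∀ τ : ℂ, 0 < τ.im → HasDerivAt f2 0 τ) :
    ∃ a b c, ∀ τ : ℂ, 0 < τ.im → f τ = a + b * τ + c * τ ^ 2 := by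
  obtain ⟨c, hc⟩ := exists_eq_const_of_hasDerivAt_zero h2
  obtain ⟨b, hb⟩ := exists_eq_const_of_hasDerivAt_zero (f := fun τ => f1 τ - c * τ) fun τ hτ => by
    refine ((h1 τ hτ).sub ((hasDerivAt_id' τ).const_mul c)).congr_deriv ?_
    rw [hc τ hτ]; ring
  obtain ⟨a, ha⟩ := exists_eq_const_of_hasDerivAt_zero
      (f := fun τ => f τ - b * τ - c / 2 * τ ^ 2) fun τ hτ => by
    refine (((h0 τ hτ).sub ((hasDerivAt_id' τ).const_mul b)).sub
      ((hasDerivAt_pow 2 τ).const_mul (c / 2))).congr_deriv ?_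
    have := hb τ hτ
    push_cast
    linear_combination this
  exact ⟨a, b, c / 2, fun τ hτ => by linear_combination ha τ hτ⟩

/-- The period polynomial of a weight four form which is an eigenform of the Fricke involution. -/
lemma exists_period {N : ℕ} (hN : 0 < N) {f0 f1 f2 f3 : ℂ → ℂ}
    (h0 : ∀ τ : ℂ, 0 < τ.im → HasDerivAt f0 (f1 τ) τ)
    (h1 : ∀ τ : ℂ, 0 < τ.im → HasDerivAt f1 (f2 τ) τ)
    (h2 : ∀ τ : ℂ, 0 < τ.im → HasDerivAt f2 (f3 τ) τ)
    (h3 : ∀ τ : ℂ, 0 < τ.im → f3 (-1 / (N * τ)) = -(N ^ 2 * τ ^ 4) * f3 τ) :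
    ∃ K, ∀ τ : ℂ, 0 < τ.im → f0 τ + N * τ ^ 2 * f0 (-1 / (N * τ)) = K * (1 + N * τ ^ 2) := by
  have hN0 : (N : ℂ) ≠ 0 := by exact_mod_cast hN.ne'
  have hne : ∀ τ : ℂ, 0 < τ.im → τ ≠ 0 := fun τ hτ => by rintro rfl; simp at hτ
  have him : ∀ τ : ℂ, 0 < τ.im → 0 < (-1 / (N * τ) : ℂ).im := fun τ hτ => by
    have := im_neg_one_div_pos (N := N) (by exact_mod_cast hN) hτ
    simpa using this
  have hS : ∀ τ : ℂ, 0 < τ.im →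
      HasDerivAt (fun τ : ℂ => -1 / (N * τ)) (1 / (N * τ ^ 2)) τ := fun τ hτ => by
    have := hne τ hτ
    have h := ((hasDerivAt_id' τ).const_mul (N : ℂ)).fun_inv (mul_ne_zero hN0 this)
    refine (h.const_mul (-1)).congr_deriv ?_ |>.congr_of_eventuallyEq (.of_forall fun z => ?_)
    · field_simp
    · simp [div_eq_mul_inv]
  have s0 : ∀ τ : ℂ, 0 < τ.im → HasDerivAt (fun τ : ℂ => f0 (-1 / (N * τ)))
      (f1 (-1 / (N * τ)) * (1 / (N * τ ^ 2))) τ := fun τ hτ =>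
    (h0 _ (him τ hτ)).comp τ (hS τ hτ)
  have s1 : ∀ τ : ℂ, 0 < τ.im → HasDerivAt (fun τ : ℂ => f1 (-1 / (N * τ)))
      (f2 (-1 / (N * τ)) * (1 / (N * τ ^ 2))) τ := fun τ hτ =>
    (h1 _ (him τ hτ)).comp τ (hS τ hτ)
  have s2 : ∀ τ : ℂ, 0 < τ.im → HasDerivAt (fun τ : ℂ => f2 (-1 / (N * τ)))
      (f3 (-1 / (N * τ)) * (1 / (N * τ ^ 2))) τ := fun τ hτ =>
    (h2 _ (him τ hτ)).comp τ (hS τ hτ)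
  -- Bol's identity: the third derivative of τ²·f(−1/(Nτ)) involves only the third derivative of f,
  -- which the weight-four law cancels against that of f(τ).
  obtain ⟨a, b, c, habc⟩ := exists_quadratic_of_hasDerivAt
    (f := fun τ => f0 τ + N * τ ^ 2 * f0 (-1 / (N * τ)))
    (f1 := fun τ => f1 τ + (2 * N * τ * f0 (-1 / (N * τ)) + f1 (-1 / (N * τ))))
    (f2 := fun τ => f2 τ + (2 * N * f0 (-1 / (N * τ)) + 2 * τ⁻¹ * f1 (-1 / (N * τ)) +
      (N : ℂ)⁻¹ * (τ⁻¹ * τ⁻¹) * f2 (-1 / (N * τ))))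
    (fun τ hτ => by
      have := hne τ hτ
      refine ((h0 τ hτ).add (((hasDerivAt_pow 2 τ).const_mul (N : ℂ)).fun_mul
        (s0 τ hτ))).congr_deriv ?_
      push_cast
      field_simp)
    (fun τ hτ => by
      have := hne τ hτ
      refine ((h1 τ hτ).add ((((hasDerivAt_id' τ).const_mul (2 * N : ℂ)).fun_mul
        (s0 τ hτ)).add (s1 τ hτ))).congr_deriv ?_
      field_simp)
    (fun τ hτ => by
      have hτ0 := hne τ hτ
      have hi := hasDerivAt_inv hτ0
      refine ((h2 τ hτ).add ((((s0 τ hτ).const_mul (2 * N : ℂ)).add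
        ((hi.const_mul 2).fun_mul (s1 τ hτ))).add
        (((hi.fun_mul hi).const_mul ((N : ℂ)⁻¹)).fun_mul (s2 τ hτ)))).congr_deriv ?_
      rw [h3 τ hτ]
      field_simp
      ring)
  -- The left side of the period relation at −1/(Nτ), times Nτ², is again the left side at τ; the
  -- quadratic polynomial inherits this symmetry. Two sample points then suffice to extract its
  -- coefficients.
  have key : ∀ τ : ℂ, 0 < τ.im → (a * N - c) * τ ^ 2 - 2 * b * τ - (a * N - c) / N = 0 := by
    intro τ hτ
    have hτ0 := hne τ hτ
    have e1 := habc τ hτ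
    have e2 := habc _ (him τ hτ)
    have e3 : (-1 / (N * (-1 / (N * τ))) : ℂ) = τ := by field_simp
    rw [e3] at e2
    field_simp at e1 e2 ⊢
    linear_combination (N : ℂ) * e1 - e2
  have k1 := key Complex.I (by simp)
  have k2 := key (2 * Complex.I) (by simp)
  have hI := Complex.I_sq
  have hN1 : (N : ℂ)⁻¹ - 2 ≠ 0 := by
    intro h
    have h1 : (1 : ℂ) = ((2 * N : ℕ) : ℂ) := by push_cast; field_simp at h; linear_combination h
    have : 1 = 2 * N := by exact_mod_cast h1
    omega
  have hd : a * N - c = 0 := by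
    apply (mul_eq_zero.mp (_ : ((N : ℂ)⁻¹ - 2) * (a * N - c) = 0)).resolve_left hN1
    linear_combination k2 - 2 * k1 - 2 * (a * N - c) * hI
  have hb : b = 0 := by
    rw [hd] at k1
    have : 2 * b * Complex.I = 0 := by linear_combination -k1
    simpa using this
  refine ⟨a, fun τ hτ => ?_⟩
  have := habc τ hτ
  simp only [hb] at this
  rw [this]
  linear_combination -τ ^ 2 * hd

/-! ### Values of L-functions as limits of Lambert-type series -/

/-- The Mellin transform of g is (2π)^(−s)Γ(s)L(s), and its residue at s = 0 is the limit K of g at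
0. To avoid residues, K·exp(−t) is subtracted: the difference is O(t) at 0, so its transform is
holomorphic for Re s > −1, and s times it vanishes at s = 0. -/
lemma eq_of_mellin {c : ℕ → ℂ} {g : ℝ → ℂ} {K : ℂ} {L : ℂ → ℂ} (hc0 : c 0 = 0)
    (hg : ∀ t : ℝ, 0 < t → HasSum (fun n : ℕ => c n * Real.exp (-(2 * Real.pi * n) * t)) (g t))
    (hL : Differentiable ℂ L) (hLs : ∀ s : ℂ, 1 < s.re → LSeriesHasSum c s (L s))
    (hcont : ContinuousOn g (Set.Ioi 0)) (htop : g =O[atTop] fun t => Real.exp (-1 * t))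
    (h0 : (fun t => g t - K) =O[𝓝[>] 0] fun t : ℝ => t) : L 0 = K := by
  set e : ℝ → ℂ := fun t => (Real.exp (-t) : ℂ) with he
  have hecont : Continuous e := by fun_prop
  have hloc : ∀ {u : ℝ → ℂ}, ContinuousOn u (Set.Ioi 0) →
      MeasureTheory.LocallyIntegrableOn u (Set.Ioi 0) := fun h =>
    h.locallyIntegrableOn measurableSet_Ioi
  have hetop : e =O[atTop] fun t => Real.exp (-1 * t) := by
    refine Asymptotics.IsBigO.of_bound 1 (.of_forall fun t => ?_)
    simp [he, -Complex.ofReal_exp]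
  have hid : (fun t : ℝ => t) =O[𝓝[>] 0] fun _ : ℝ => (1 : ℝ) :=
    (continuous_id.tendsto (0 : ℝ)).mono_left nhdsWithin_le_nhds |>.isBigO_one ℝ
  have h1rpow : ∀ {u : ℝ → ℂ}, u =O[𝓝[>] 0] (fun _ : ℝ => (1 : ℝ)) →
      u =O[𝓝[>] 0] fun t : ℝ => t ^ (-(0 : ℝ)) := fun h => by simpa using h
  have hg1 : g =O[𝓝[>] 0] fun _ : ℝ => (1 : ℝ) := by
    have := (h0.trans hid).add (Asymptotics.isBigO_const_const K one_ne_zero (𝓝[>] (0 : ℝ)))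
    simpa using this
  have he1 : e =O[𝓝[>] 0] fun _ : ℝ => (1 : ℝ) :=
    (hecont.tendsto (0 : ℝ)).mono_left nhdsWithin_le_nhds |>.isBigO_one ℝ
  have he0 : (fun t => e t - 1) =O[𝓝[>] 0] fun t : ℝ => t := by
    have hd : HasDerivAt (fun t : ℝ => e t) (((-1 : ℝ) : ℂ)) 0 := by
      have := ((hasDerivAt_neg (0 : ℝ)).exp).ofReal_comp
      simpa [he] using this
    have := hd.isBigO_sub.mono (nhdsWithin_le_nhds (s := Set.Ioi 0))
    simpa [he] using this
  set h : ℝ → ℂ := fun t => g t - K * e t with hh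
  have hh0 : h =O[𝓝[>] 0] fun t : ℝ => t ^ (-(-1 : ℝ)) := by
    have := h0.sub (he0.const_mul_left K)
    simp only [neg_neg, Real.rpow_one]
    refine this.congr_left fun t => ?_
    simp only [hh]; ring
  have hhtop : h =O[atTop] fun t => Real.exp (-1 * t) := htop.sub (hetop.const_mul_left K)
  have hhd : ∀ s : ℂ, -1 < s.re → DifferentiableAt ℂ (mellin h) s := fun s hs =>
    mellin_differentiableAt_of_isBigO_rpow_exp one_pos
      (hloc (hcont.sub (continuousOn_const.mul hecont.continuousOn))) hhtop hh0 hs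
  -- Multiplying by s replaces Γ(s) by Γ(s + 1), which is regular at 0, so this identity continues
  -- from Re s > 1 to the origin.
  have hM : ∀ s : ℂ, 1 < s.re → s * mellin h s =
      (2 * Real.pi) ^ (-s) * Complex.Gamma (s + 1) * L s - K * Complex.Gamma (s + 1) := by
    intro s hs
    have hs0 : 0 < s.re := by linarith
    have hsne : s ≠ 0 := by rintro rfl; simp at hs0
    have m1 : MellinConvergent g s := mellinConvergent_of_isBigO_rpow_exp one_pos (hloc hcont) htop
      (h1rpow hg1) hs0
    have m2 : MellinConvergent e s := mellinConvergent_of_isBigO_rpow_exp one_pos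
      (hloc hecont.continuousOn) hetop (h1rpow he1) hs0
    have m3 : mellin h s = mellin g s - K * mellin e s := by
      have := (hasMellin_sub m1 (m2.const_smul K)).2
      rw [mellin_const_smul] at this
      exact this
    have m4 : mellin e s = Complex.Gamma s := by
      rw [Complex.Gamma_eq_integral hs0, Complex.GammaIntegral_eq_mellin]
    have hLS := hLs s hs
    have hterm : ∀ n : ℕ, c n / ((2 * Real.pi * n : ℝ) : ℂ) ^ s =
        (2 * Real.pi) ^ (-s) * LSeries.term c s n := by
      intro n
      rcases eq_or_ne n 0 with rfl | hn
      · simp [hc0]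
      · rw [LSeries.term_of_ne_zero hn, Complex.ofReal_mul,
          Complex.mul_cpow_ofReal_nonneg (by positivity) (by positivity), Complex.cpow_neg]
        push_cast
        rw [div_mul_eq_div_div_swap, inv_mul_eq_div]
    have m5 : HasSum (fun n => Complex.Gamma s * c n / ((2 * Real.pi * n : ℝ) : ℂ) ^ s)
        (mellin g s) := by
      refine hasSum_mellin (fun n => ?_) hs0 (fun t ht => hg t ht) ?_
      · rcases eq_or_ne n 0 with rfl | hn
        · exact Or.inl hc0
        · right; have : (0 : ℝ) < n := by exact_mod_cast Nat.pos_of_ne_zero hn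
          positivity
      · have hsm := (hLS.summable.mul_left ((2 * Real.pi : ℂ) ^ (-s))).norm
        refine hsm.congr fun n => ?_
        rw [← hterm, norm_div]
        rcases eq_or_ne n 0 with rfl | hn
        · simp [hc0]
        · have : (0 : ℝ) < n := by exact_mod_cast Nat.pos_of_ne_zero hn
          rw [Complex.norm_cpow_eq_rpow_re_of_pos (by positivity)]
    have m6 : mellin g s = Complex.Gamma s * ((2 * Real.pi) ^ (-s) * L s) := by
      refine m5.unique (HasSum.of_eq ((hLS.mul_left ((2 * Real.pi : ℂ) ^ (-s))).mul_left
        (Complex.Gamma s)) (fun n => ?_) rfl)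
      rw [← hterm, mul_div_assoc]
    rw [m3, m4, m6, Complex.Gamma_add_one s hsne]
    ring
  set U : Set ℂ := {s | -1 < s.re} with hU
  have hUo : IsOpen U := isOpen_lt continuous_const Complex.continuous_re
  have hUc : IsPreconnected U := (convex_halfSpace_re_gt (-1)).isPreconnected
  have hpi : (2 * Real.pi : ℂ) ≠ 0 := by
    exact_mod_cast (by positivity : (2 * Real.pi : ℝ) ≠ 0)
  have hGam : DifferentiableOn ℂ (fun s => Complex.Gamma (s + 1)) U := fun s hs => by
    refine (DifferentiableAt.comp s (Complex.differentiableAt_Gamma _ fun m hm => ?_)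
      (differentiableAt_id.add_const 1)).differentiableWithinAt
    have h1 := congrArg Complex.re hm
    have h2 : -1 < s.re := hs
    simp at h1
    have : (0 : ℝ) ≤ m := Nat.cast_nonneg m
    linarith
  have d1 : DifferentiableOn ℂ (fun s => s * mellin h s) U := fun s hs =>
    (differentiableAt_id.mul (hhd s hs)).differentiableWithinAt
  have d2 : DifferentiableOn ℂ (fun s => (2 * Real.pi) ^ (-s) * Complex.Gamma (s + 1) * L s -
      K * Complex.Gamma (s + 1)) U := by
    refine (((Differentiable.differentiableOn (differentiable_id.neg.const_cpow
      (Or.inl hpi))).mul hGam).mul hL.differentiableOn).sub (hGam.const_mul K)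
  have heq := (d1.analyticOnNhd hUo).eqOn_of_preconnected_of_eventuallyEq (d2.analyticOnNhd hUo)
    hUc (z₀ := 2) (by norm_num [hU]) (by
      have : {s : ℂ | 1 < s.re} ∈ 𝓝 (2 : ℂ) :=
        (isOpen_lt continuous_const Complex.continuous_re).mem_nhds (by simp)
      filter_upwards [this] with s hs using hM s hs)
  have := heq (x := 0) (by simp [hU])
  simp only [zero_mul, neg_zero, Complex.cpow_zero, zero_add, Complex.Gamma_one, one_mul,
    mul_one] at this
  exact (sub_eq_zero.mp this.symm)

namespace MukaiCase

/-- The Eichler integral of the weight four form, as a function of `q`. -/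
def eich (v : MukaiCase) : ℂ → ℂ := eichler fun n => PowerSeries.coeff n v.formFSeries

lemma coeff_zero_formFSeries (v : MukaiCase) : PowerSeries.coeff 0 v.formFSeries = 0 := by
  rw [← v.evalOn_formF.apply_zero one_pos, v.relations.F_eq 0 (by simp), psi_zero, mul_zero]

lemma evalOn_eich (v : MukaiCase) :
    EvalOn (PowerSeries.mk fun n => PowerSeries.coeff n v.formFSeries / (n : ℂ) ^ 3) v.eich 1 :=
  v.evalOn_formF.eichler

lemma eich_zero (v : MukaiCase) : v.eich 0 = 0 := by
  rw [v.evalOn_eich.apply_zero one_pos]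
  simp

lemma hasDerivAt_eich_nome (v : MukaiCase) {τ : ℂ} (hτ : 0 < τ.im) :
    HasDerivAt (fun τ => v.eich (nome τ))
      (2 * Real.pi * Complex.I * thetaFun v.eich (nome τ)) τ := by
  simpa using v.evalOn_eich.hasDerivAt_comp_nome 1 hτ

lemma exists_period_eich (v : MukaiCase) : ∃ K, ∀ τ : ℂ, 0 < τ.im →
    v.eich (nome τ) + v.level * τ ^ 2 * v.eich (nome (-1 / (v.level * τ))) =
      K * (1 + v.level * τ ^ 2) := by
  refine exists_period v.level_pos (f3 := fun τ => 2 * Real.pi * Complex.I *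
    (2 * Real.pi * Complex.I) * (2 * Real.pi * Complex.I) * v.formF (nome τ))
    (fun τ hτ => v.hasDerivAt_eich_nome hτ)
    (fun τ hτ => v.evalOn_eich.theta.hasDerivAt_comp_nome _ hτ) (fun τ hτ => ?_) fun τ hτ => ?_
  · convert v.evalOn_eich.theta.theta.hasDerivAt_comp_nome _ hτ using 2
    exact (theta_cube_eichler v.evalOn_formF v.coeff_zero_formFSeries (norm_nome_lt_one hτ)).symm
  · rw [v.relations.F_eq _ (norm_nome_lt_one (v.im_fricke_pos hτ)),
      v.relations.F_eq _ (norm_nome_lt_one hτ), v.w_fricke hτ, v.psi_fricke hτ]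
    ring

lemma nome_mul_I (y : ℝ) : nome (y * Complex.I) = Real.exp (-(2 * Real.pi) * y) := by
  rw [nome, Complex.ofReal_exp]
  congr 1
  push_cast
  linear_combination 2 * Real.pi * y * Complex.I_sq

lemma eich_isBigO_atTop (v : MukaiCase) :
    (fun y : ℝ => v.eich (nome (y * Complex.I))) =O[atTop] fun t => Real.exp (-1 * t) := by
  have h1 : v.eich =O[𝓝 0] fun q => q := by
    have hd : DifferentiableAt ℂ v.eich 0 := v.evalOn_eich.differentiableOn.differentiableAt
      (Metric.ball_mem_nhds 0 one_pos)
    simpa [v.eich_zero] using hd.isBigO_sub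
  have ht : Tendsto (fun y : ℝ => nome (y * Complex.I)) atTop (𝓝 0) := by
    rw [tendsto_zero_iff_norm_tendsto_zero]
    have : Tendsto (fun y : ℝ => Real.exp (-(2 * Real.pi * y))) atTop (𝓝 0) :=
      Real.tendsto_exp_neg_atTop_nhds_zero.comp
        (tendsto_id.const_mul_atTop (by positivity))
    refine this.congr fun y => ?_
    rw [nome_mul_I, Complex.norm_real, Real.norm_eq_abs, Real.abs_exp]
    ring_nf
  refine (h1.comp_tendsto ht).trans ?_
  refine Asymptotics.IsBigO.of_bound 1 ?_
  filter_upwards [eventually_ge_atTop 0] with y hy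
  rw [Function.comp, nome_mul_I, Complex.norm_real, one_mul, Real.norm_eq_abs, Real.norm_eq_abs,
    Real.abs_exp, Real.abs_exp, Real.exp_le_exp]
  nlinarith [Real.pi_gt_three]

/-- On τ = iy the period relation reads f(iy) − K = N·y²·(f(i/(Ny)) − K), and f(i/(Ny)) is bounded
as y tends to 0. The coefficients cₙ/n³ shift the argument of the L-function by 3, so the value at 0
becomes L(F,3). -/
lemma period_eq (v : MukaiCase) {τ : ℂ} (hτ : 0 < τ.im) :
    v.eich (nome τ) + v.level * τ ^ 2 * v.eich (nome (-1 / (v.level * τ))) =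
      v.lFun 3 * (1 + v.level * τ ^ 2) := by
  obtain ⟨K, hK⟩ := v.exists_period_eich
  have hN : (0 : ℝ) < v.level := by exact_mod_cast v.level_pos
  have hNc : (v.level : ℂ) ≠ 0 := by exact_mod_cast v.level_pos.ne'
  have him : ∀ y : ℝ, 0 < y → 0 < (y * Complex.I : ℂ).im := fun y hy => by simpa using hy
  suffices v.lFun 3 = K by rw [this]; exact hK τ hτ
  have := eq_of_mellin (c := fun n => PowerSeries.coeff n v.formFSeries / (n : ℂ) ^ 3)
    (g := fun y : ℝ => v.eich (nome (y * Complex.I))) (K := K) (L := fun s => v.lFun (s + 3))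
    (by simp) (fun y hy => ?_) (v.differentiable_lFun.comp (differentiable_id.add_const 3))
    (fun s hs => ?_) (fun y hy => ?_) v.eich_isBigO_atTop ?_
  · simpa using this
  · refine HasSum.of_eq (v.evalOn_eich _ (norm_nome_lt_one (him y hy))) (fun n => ?_) rfl
    rw [PowerSeries.coeff_mk, nome_mul_I, ← Complex.ofReal_pow, ← Real.exp_nat_mul]
    ring_nf
  · refine HasSum.of_eq (v.lFun_isLFunction.2 (s + 3) (by simp; linarith)) (fun n => ?_) rfl
    rcases eq_or_ne n 0 with rfl | hn
    · simp
    · rw [LSeries.term_of_ne_zero hn, LSeries.term_of_ne_zero hn,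
        Complex.cpow_add _ _ (by exact_mod_cast hn), div_div, mul_comm ((n : ℂ) ^ s)]
      norm_cast
  · exact ((v.hasDerivAt_eich_nome (him y hy)).continuousAt.comp
      (f := fun y : ℝ => (y * Complex.I : ℂ)) (by fun_prop)).continuousWithinAt
  · have hinv : Tendsto (fun y : ℝ => ((v.level : ℝ) * y)⁻¹) (𝓝[>] 0) atTop := by
      refine tendsto_inv_nhdsGT_zero.comp (tendsto_nhdsWithin_iff.mpr ⟨?_, ?_⟩)
      · have : Tendsto (fun y : ℝ => (v.level : ℝ) * y) (𝓝 0) (𝓝 (v.level * 0)) :=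
          tendsto_id.const_mul _
        rw [mul_zero] at this
        exact this.mono_left nhdsWithin_le_nhds
      · filter_upwards [self_mem_nhdsWithin] with y hy using mul_pos hN hy
    have h1 : (fun y : ℝ => v.eich (nome ((((v.level : ℝ) * y)⁻¹ : ℝ) * Complex.I))) =O[𝓝[>] 0]
        fun _ => (1 : ℝ) := by
      have : (fun t : ℝ => Real.exp (-1 * t)) =O[atTop] fun _ => (1 : ℝ) := by
        simpa using Real.tendsto_exp_neg_atTop_nhds_zero.isBigO_one ℝ
      exact (v.eich_isBigO_atTop.trans this).comp_tendsto hinv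
    have h2 : (fun y : ℝ => (y : ℂ) ^ 2) =O[𝓝[>] 0] fun y : ℝ => y := by
      refine Asymptotics.IsBigO.of_bound 1 ?_
      filter_upwards [Ioo_mem_nhdsGT (zero_lt_one' ℝ)] with y hy
      rw [norm_pow, Complex.norm_real, Real.norm_of_nonneg hy.1.le]
      nlinarith [hy.1, hy.2]
    have h3 := h2.mul ((h1.const_mul_left (v.level : ℂ)).sub
      (Asymptotics.isBigO_const_const (K * v.level) one_ne_zero (𝓝[>] (0 : ℝ))))
    simp only [mul_one] at h3
    refine h3.congr' ?_ EventuallyEq.rfl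
    filter_upwards [self_mem_nhdsWithin] with y hy
    have h := hK _ (him y hy)
    have hy0 : (y : ℂ) ≠ 0 := by exact_mod_cast (ne_of_gt hy)
    have e : (-1 / (v.level * (y * Complex.I)) : ℂ) =
        (((v.level : ℝ) * y)⁻¹ : ℝ) * Complex.I := by
      push_cast
      field_simp
      simp
    rw [e, mul_pow, Complex.I_sq] at h
    linear_combination -h

lemma phi_mul_eich_fricke (v : MukaiCase) {τ : ℂ} (hτ : 0 < τ.im) :
    v.phi (nome (-1 / (v.level * τ))) * (v.eich (nome (-1 / (v.level * τ))) - v.lFun 3) =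
      v.phi (nome τ) * (v.eich (nome τ) - v.lFun 3) := by
  rw [v.phi_fricke hτ]
  linear_combination -v.phi (nome τ) * v.period_eq hτ

end MukaiCase

/-! ### Growth of the coefficients -/

namespace MukaiCase

/-- The real solutions of the recurrence attached to the operator. -/
def recSeq (v : MukaiCase) (x0 x1 : ℝ) : ℕ → ℝ
  | 0 => x0
  | 1 => x1
  | n + 2 => ((2 * n + 3) * (v.al * (n + 1) * (n + 2) + v.be) * recSeq v x0 x1 (n + 1) -
      v.ka * (n + 1) ^ 3 * recSeq v x0 x1 n) / (n + 2) ^ 3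

lemma recSeq_succ_succ (v : MukaiCase) (x0 x1 : ℝ) (n : ℕ) :
    (n + 2) ^ 3 * v.recSeq x0 x1 (n + 2) =
      (2 * n + 3) * (v.al * (n + 1) * (n + 2) + v.be) * v.recSeq x0 x1 (n + 1) -
      v.ka * (n + 1) ^ 3 * v.recSeq x0 x1 n := by
  have : (n + 2 : ℝ) ≠ 0 := by positivity
  rw [recSeq]
  field_simp

lemma eq_recSeq (v : MukaiCase) {p : ℕ → ℂ} {x0 x1 : ℝ} (h0 : p 0 = x0) (h1 : p 1 = x1)
    (h : ∀ n, PowerSeries.coeff (n + 2) (v.op tMul theta (PowerSeries.mk p)) = 0) (n : ℕ) :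
    p n = v.recSeq x0 x1 n := by
  induction n using Nat.twoStepInduction with
  | zero => exact h0
  | one => exact h1
  | more n ih1 ih2 =>
    have h2 := h n
    rw [coeff_op_succ_succ] at h2
    simp only [PowerSeries.coeff_mk] at h2
    have h3 : ((n : ℂ) + 2) ≠ 0 := by exact_mod_cast (Nat.succ_ne_zero (n + 1))
    have h4 := congrArg (fun x : ℝ => (x : ℂ)) (v.recSeq_succ_succ x0 x1 n)
    push_cast at h4
    apply mul_left_cancel₀ (pow_ne_zero 3 h3)
    rw [h4, ← ih1, ← ih2]
    linear_combination h2

/-- The coefficients of the holomorphic solution. -/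
def aSeq (v : MukaiCase) : ℕ → ℝ := v.recSeq 1 v.be

/-- The coefficients of the solution of the inhomogeneous equation. -/
def bSeq (v : MukaiCase) : ℕ → ℝ := v.recSeq 0 1

lemma IsSolutionA.eq_aSeq {v : MukaiCase} {a : ℕ → ℂ} (ha : v.IsSolutionA a) (n : ℕ) :
    a n = v.aSeq n := by
  refine v.eq_recSeq (by simpa using ha.1) ?_ (fun n => by rw [ha.2, map_zero]) n
  have := v.coeff_op_one (PowerSeries.mk a)
  rw [ha.2, map_zero, PowerSeries.coeff_mk, PowerSeries.coeff_mk, ha.1] at this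
  push_cast
  linear_combination -this

lemma IsSolutionB.eq_bSeq {v : MukaiCase} {b : ℕ → ℂ} (hb : v.IsSolutionB b) (n : ℕ) :
    b n = v.bSeq n :=
  v.eq_recSeq (by simpa using hb.1) (by simpa using hb.2.1) (fun n => by
    rw [hb.op_eq, PowerSeries.coeff_X, if_neg (by omega)]) n

/-- The middle term of the recurrence drops out of the determinant, so each step contributes only
the factor κ(n+1)³/(n+2)³. -/
lemma casoratian (v : MukaiCase) (n : ℕ) :
    (n + 1) ^ 3 * (v.bSeq (n + 1) * v.aSeq n - v.aSeq (n + 1) * v.bSeq n) = v.ka ^ n := by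
  induction n with
  | zero => simp [aSeq, bSeq, recSeq]
  | succ n ih =>
    have h1 := v.recSeq_succ_succ 1 v.be n
    have h2 := v.recSeq_succ_succ 0 1 n
    change (n + 2 : ℝ) ^ 3 * v.aSeq (n + 2) = _ * v.aSeq (n + 1) - _ * v.aSeq n at h1
    change (n + 2 : ℝ) ^ 3 * v.bSeq (n + 2) = _ * v.bSeq (n + 1) - _ * v.bSeq n at h2
    push_cast
    rw [pow_succ (v.ka : ℝ) n, ← ih]
    linear_combination v.aSeq (n + 1) * h2 - v.bSeq (n + 1) * h1

/-- A ratio of at least 3 controls the term with κ > 0 well enough to give ratio 6 at the next step;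
only the initial ratio, equal to β, can fall below 6. The value 6 is chosen for 6² > 27 ≥ |κ|, which
makes the Casoratian series converge geometrically. -/
lemma aSeq_aux (v : MukaiCase) (n : ℕ) : 0 < v.aSeq n ∧ 3 * v.aSeq n ≤ v.aSeq (n + 1) ∧
    6 * v.aSeq (n + 1) ≤ v.aSeq (n + 2) := by
  have step : ∀ n, 0 < v.aSeq n → 3 * v.aSeq n ≤ v.aSeq (n + 1) →
      6 * v.aSeq (n + 1) ≤ v.aSeq (n + 2) := by
    intro n h1 h2
    have h := v.recSeq_succ_succ 1 v.be n
    change (n + 2 : ℝ) ^ 3 * v.aSeq (n + 2) = _ * v.aSeq (n + 1) - _ * v.aSeq n at h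
    have h3 : 0 ≤ v.aSeq (n + 1) := by linarith
    have hn : (0 : ℝ) ≤ n := Nat.cast_nonneg n
    refine le_of_mul_le_mul_left (a := (n + 2 : ℝ) ^ 3) ?_ (by positivity)
    rw [h]
    have h4 : (n + 1 : ℝ) ^ 3 * v.aSeq n ≤ (n + 1) ^ 3 * (v.aSeq (n + 1) / 3) := by
      gcongr; linarith
    have h5 : 0 ≤ (n + 1 : ℝ) ^ 3 * v.aSeq n := by positivity
    cases v
    · have : 0 ≤ ((2 * n + 3) * (17 * (n + 1) * (n + 2) + 5) - (n + 1) ^ 3 / 3 - 6 * (n + 2) ^ 3)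
        * V12.aSeq (n + 1) := mul_nonneg (by ring_nf; positivity) h3
      simp only [al, be, ka]; push_cast; linarith
    · have : 0 ≤ ((2 * n + 3) * (12 * (n + 1) * (n + 2) + 4) - 16 * (n + 1) ^ 3 / 3 -
        6 * (n + 2) ^ 3) * V16.aSeq (n + 1) := mul_nonneg (by ring_nf; positivity) h3
      simp only [al, be, ka]; push_cast; linarith
    · have : 0 ≤ ((2 * n + 3) * (9 * (n + 1) * (n + 2) + 3) -
        6 * (n + 2) ^ 3) * V18.aSeq (n + 1) := mul_nonneg (by ring_nf; positivity) h3
      simp only [al, be, ka]; push_cast; linarith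
  induction n with
  | zero =>
    have h0 : v.aSeq 0 = 1 := rfl
    have h1 : v.aSeq 1 = v.be := rfl
    have h2 : 3 * v.aSeq 0 ≤ v.aSeq 1 := by rw [h0, h1]; cases v <;> norm_num [be]
    exact ⟨by simp [h0], h2, step 0 (by simp [h0]) h2⟩
  | succ n ih =>
    have h1 : 0 < v.aSeq (n + 1) := by linarith [ih.1, ih.2.1]
    have h2 : 3 * v.aSeq (n + 1) ≤ v.aSeq (n + 1 + 1) := by linarith [ih.2.2]
    exact ⟨h1, h2, step (n + 1) h1 h2⟩

lemma aSeq_pos (v : MukaiCase) (n : ℕ) : 0 < v.aSeq n := (v.aSeq_aux n).1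

/-- The factor 2 pays for the initial ratio, known only to be at least 3. -/
lemma pow_mul_aSeq_le (v : MukaiCase) (n k : ℕ) : 6 ^ k * v.aSeq n ≤ 2 * v.aSeq (n + k) := by
  induction k with
  | zero => simp; linarith [v.aSeq_pos n]
  | succ k ih =>
    rcases Nat.eq_zero_or_pos (n + k) with h | h
    · obtain ⟨rfl, rfl⟩ : n = 0 ∧ k = 0 := by omega
      have := (v.aSeq_aux 0).2.1
      simp at this ⊢
      linarith
    · obtain ⟨m, hm⟩ := Nat.exists_eq_add_of_lt h
      rw [zero_add] at hm
      have := (v.aSeq_aux m).2.2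
      rw [← add_assoc, hm, pow_succ]
      rw [hm] at ih
      linarith

lemma aSeq_mul_pow_le (v : MukaiCase) {T : ℝ} (hT : 0 < T) (hT9 : T ≤ 1 / 9)
    (hP : 1 - 2 * v.al * T + v.ka * T ^ 2 = 0) (n : ℕ) : v.aSeq n * T ^ n ≤ 1 := by
  have of_ratio (h : ∀ n, T * v.aSeq (n + 1) ≤ v.aSeq n) : v.aSeq n * T ^ n ≤ 1 := by
    induction n with
    | zero => exact (mul_one (1 : ℝ)).le
    | succ n ih =>
      calc v.aSeq (n + 1) * T ^ (n + 1) = (T * v.aSeq (n + 1)) * T ^ n := by ring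
        _ ≤ v.aSeq n * T ^ n := by gcongr; exact h n
        _ ≤ 1 := ih
  -- For κ ≥ 0 the ratios aₙ₊₁/aₙ stay below 1/T: P(T) = 0 cancels the leading terms of the
  -- recurrence, and the remainder has a sign.
  have ratio (hka : (0 : ℝ) ≤ v.ka) (hka' : v.ka * T ≤ v.al) (hab : (v.be : ℝ) ≤ v.al) (hbe : T * v.be ≤ 1)
      (n : ℕ) : T * v.aSeq (n + 1) ≤ v.aSeq n := by
    induction n with
    | zero => exact hbe
    | succ n ih =>
      have h := v.recSeq_succ_succ 1 v.be n
      change (n + 2 : ℝ) ^ 3 * v.aSeq (n + 2) = _ * v.aSeq (n + 1) - _ * v.aSeq n at h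
      refine le_of_mul_le_mul_left (a := (n + 2 : ℝ) ^ 3) ?_ (by positivity)
      have h1 : v.ka * (n + 1) ^ 3 * T * (T * v.aSeq (n + 1)) ≤ v.ka * (n + 1) ^ 3 * T * v.aSeq n := by
        gcongr
      have h2 : 0 ≤ T * ((v.al - v.ka * T) * (3 * (n + 1) ^ 2 + 3 * (n + 1) + 1) +
        (v.al - v.be) * (2 * (n + 1) + 1)) * v.aSeq (n + 1) := by
        have := (v.aSeq_pos (n + 1)).le
        have := sub_nonneg.mpr hka'
        have := sub_nonneg.mpr hab
        positivity
      have h3 : 0 = (1 - 2 * v.al * T + v.ka * T ^ 2) * ((n + 2) ^ 3 * v.aSeq (n + 1)) := by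
        rw [hP, zero_mul]
      linear_combination h1 + h2 + h3 + T * h
  cases v
  · refine of_ratio (ratio ?_ ?_ ?_ ?_) <;> norm_num [al, be, ka] <;> linarith
  · refine of_ratio (ratio ?_ ?_ ?_ ?_) <;> norm_num [al, be, ka] <;> linarith
  -- For negative κ the ratio argument fails, as the two recurrence terms have the same sign. They
  -- can then be bounded separately, so aₙTⁿ ≤ 1 is proved directly, with P(T) = 0 eliminating T².
  · simp only [al, ka] at hP
    push_cast at hP
    clear of_ratio ratio
    induction n using Nat.twoStepInduction with
    | zero => exact (mul_one (1 : ℝ)).le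
    | one =>
      have : V18.aSeq 1 = 3 := by simp [aSeq, recSeq, be]
      rw [this]; linarith
    | more n ih1 ih2 =>
      have h := V18.recSeq_succ_succ 1 V18.be n
      change (n + 2 : ℝ) ^ 3 * V18.aSeq (n + 2) = _ * V18.aSeq (n + 1) - _ * V18.aSeq n at h
      simp only [al, be, ka] at h
      push_cast at h
      refine le_of_mul_le_mul_left (a := (n + 2 : ℝ) ^ 3) ?_ (by positivity)
      have h1 : (2 * n + 3) * (9 * (n + 1) * (n + 2) + 3) * T * (V18.aSeq (n + 1) * T ^ (n + 1)) ≤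
        (2 * n + 3) * (9 * (n + 1) * (n + 2) + 3) * T * 1 := by gcongr
      have h2 : 27 * (n + 1) ^ 3 * T ^ 2 * (V18.aSeq n * T ^ n) ≤ 27 * (n + 1) ^ 3 * T ^ 2 * 1 := by
        gcongr
      have h3 : (27 * (n + 1) ^ 2 + 15 * (n + 1) + 3) * T ≤
        (27 * (n + 1 : ℝ) ^ 2 + 15 * (n + 1) + 3) * (1 / 9) := by gcongr
      have h4 : T ^ (n + 2) * ((n + 2 : ℝ) ^ 3 * V18.aSeq (n + 2)) = _ :=
        congrArg (T ^ (n + 2) * ·) h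
      have h5 : (1 - 2 * 9 * T + -27 * T ^ 2) * ((n : ℝ) + 1) ^ 3 = 0 := by rw [hP, zero_mul]
      have hn : (0 : ℝ) ≤ n := Nat.cast_nonneg n
      linear_combination h1 + h2 + h3 + h4 - h5 + (4 / 3) * hn

/-- The ratios `bₙ / aₙ` converge, at a rate better than the radius of convergence predicts. -/
lemma exists_limit (v : MukaiCase) :
    ∃ l : ℝ, ∀ n, |v.bSeq n - l * v.aSeq n| ≤ 8 / 3 * (9 / 2) ^ n := by
  have hne n : v.aSeq n ≠ 0 := (v.aSeq_pos n).ne'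
  set x : ℕ → ℝ := fun n => v.bSeq n / v.aSeq n with hx
  have hdist (n k : ℕ) :
      dist (x (n + k)) (x (n + (k + 1))) ≤ 2 / 3 * (9 / 2) ^ n / v.aSeq n * (3 / 4) ^ k := by
    set m := n + k with hm
    -- The factor aₙ is kept rather than estimated, since the final bound multiplies the distance
    -- from bₙ/aₙ to the limit by aₙ.
    have h1 : (v.aSeq m)⁻¹ ≤ 2 / (6 ^ k * v.aSeq n) := by
      rw [inv_le_comm₀ (v.aSeq_pos m) (by have := v.aSeq_pos n; positivity), inv_div]
      linarith [v.pow_mul_aSeq_le n k]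
    have h2 : (v.aSeq (m + 1))⁻¹ ≤ 2 / 6 ^ (m + 1) := by
      rw [inv_le_comm₀ (v.aSeq_pos _) (by positivity), inv_div]
      have := v.pow_mul_aSeq_le 0 (m + 1)
      rw [show v.aSeq 0 = 1 from rfl, zero_add] at this
      linarith
    have h3 : |v.bSeq (m + 1) * v.aSeq m - v.aSeq (m + 1) * v.bSeq m| ≤ 27 ^ m := by
      have h4 : |(v.ka : ℝ)| ^ m ≤ 27 ^ m :=
        pow_le_pow_left₀ (abs_nonneg _) (by cases v <;> norm_num [ka]) m
      rw [← abs_pow, ← v.casoratian m, abs_mul, abs_of_nonneg (by positivity)] at h4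
      refine (le_mul_of_one_le_left (abs_nonneg _) (one_le_pow₀ ?_)).trans h4
      linarith [(Nat.cast_nonneg m : (0 : ℝ) ≤ m)]
    have h5 : x (m + 1) - x m = (v.bSeq (m + 1) * v.aSeq m - v.aSeq (m + 1) * v.bSeq m) *
        ((v.aSeq m)⁻¹ * (v.aSeq (m + 1))⁻¹) := by
      simp only [hx]
      have := hne m
      have := hne (m + 1)
      field_simp
    have hp := v.aSeq_pos n
    have hp1 := v.aSeq_pos m
    have hp2 := v.aSeq_pos (m + 1)
    rw [← add_assoc, ← hm, dist_comm, Real.dist_eq, h5, abs_mul,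
      abs_of_pos (a := (v.aSeq m)⁻¹ * _) (by positivity)]
    calc _ ≤ 27 ^ m * (2 / (6 ^ k * v.aSeq n) * (2 / 6 ^ (m + 1))) := by gcongr
      _ = 2 / 3 * (27 / 6) ^ n / v.aSeq n * (27 / 36) ^ k := by
        rw [hm, show (36 : ℝ) = 6 * 6 by norm_num, div_pow, div_pow, mul_pow]
        field_simp
        ring
      _ = _ := by norm_num
  have hc : CauchySeq x := by
    refine cauchySeq_of_le_geometric (3 / 4) (2 / 3 * (9 / 2) ^ 0 / v.aSeq 0) (by norm_num) fun n => ?_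
    simpa using hdist 0 n
  obtain ⟨l, hl⟩ := cauchySeq_tendsto_of_complete hc
  refine ⟨l, fun n => ?_⟩
  -- Summing the geometric tail gives the constant 8/3 = (2/3)/(1 − 3/4).
  have h1 := dist_le_of_le_geometric_of_tendsto₀ (3 / 4) _ (by norm_num) (hdist n)
    (hl.comp (tendsto_add_atTop_nat n |>.congr fun k => add_comm k n))
  have h2 : v.bSeq n - l * v.aSeq n = (x n - l) * v.aSeq n := by
    simp only [hx]
    rw [sub_mul, div_mul_cancel₀ _ (hne n)]
  rw [add_zero, Real.dist_eq] at h1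
  rw [h2, abs_mul, abs_of_pos (v.aSeq_pos n), ← le_div_iff₀ (v.aSeq_pos n)]
  refine h1.trans (le_of_eq ?_)
  ring

end MukaiCase

/-! ### Behaviour on the real axis -/

lemma eis2_ofReal_im (i : ℕ) (x : ℝ) : (eis2 i x).im = 0 := by
  have : eis2 i x = ((-(1 / 24) * i *
      (1 - 24 * ∑' n : ℕ, (ArithmeticFunction.sigma 1 (n + 1) : ℝ) * x ^ (i * (n + 1))) : ℝ) : ℂ) := by
    rw [eis2]
    push_cast
    rfl
  rw [this, Complex.ofReal_im]

lemma eisComb_ofReal_im (N : ℕ) {c : ℕ → ℂ} (hc : ∀ i, (c i).im = 0) (x : ℝ) :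
    (eisComb N c x).im = 0 := by
  rw [eisComb, Complex.im_sum]
  exact Finset.sum_eq_zero fun i _ => by rw [Complex.mul_im, hc, eis2_ofReal_im]; ring

lemma twist2_ofReal_im (x : ℝ) : (twist2 x).im = 0 := by
  have : twist2 x = ((∑' n : ℕ, (legendreSym 3 ((n + 1 : ℕ) : ℤ) : ℝ) *
      (ArithmeticFunction.sigma 1 (n + 1) : ℝ) * x ^ (n + 1) : ℝ) : ℂ) := by
    rw [twist2]
    push_cast
    rfl
  rw [this, Complex.ofReal_im]

lemma forall_pos_of_ne_zero {f : ℝ → ℝ} {s : ℝ} (hf : ContinuousOn f (Set.Ico 0 s)) (h0 : 0 < f 0)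
    (h : ∀ x ∈ Set.Ico 0 s, f x ≠ 0) : ∀ x ∈ Set.Ico 0 s, 0 < f x := by
  intro x hx
  by_contra! hneg
  obtain ⟨y, hy, hy0⟩ := intermediate_value_Icc' hx.1
    (hf.mono fun y hy => ⟨hy.1, hy.2.trans_lt hx.2⟩) ⟨hneg, h0.le⟩
  exact h y ⟨hy.1, hy.2.trans_lt hx.2⟩ hy0

namespace MukaiCase

lemma phi_ofReal_im (v : MukaiCase) (x : ℝ) : (v.phi x).im = 0 := by
  rw [phi_eq]
  exact eisComb_ofReal_im _ (fun i => by
    cases v <;> simp only [phiCoeff] <;> split_ifs <;> norm_num) x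

lemma w_ofReal_im (v : MukaiCase) (x : ℝ) : (v.w x).im = 0 :=
  eisComb_ofReal_im _ (fun i => by
    cases v <;> simp only [wCoeff] <;> split_ifs <;> norm_num) x

lemma psi_ofReal_im (v : MukaiCase) (x : ℝ) : (v.psi x).im = 0 := by
  cases v
  · exact eisComb_ofReal_im _ (fun i => by simp only [psiCoeff]; split_ifs <;> norm_num) x
  · exact eisComb_ofReal_im _ (fun i => by simp only [psiCoeff]; split_ifs <;> norm_num) x
  · exact twist2_ofReal_im x

lemma t_ofReal_im (v : MukaiCase) (x : ℝ) : (v.t x).im = 0 := by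
  rw [t, Complex.div_im, phi_ofReal_im, psi_ofReal_im]; simp

lemma ofReal_t_re (v : MukaiCase) (x : ℝ) : ((v.t x).re : ℂ) = v.t x :=
  Complex.ext rfl (by simp [t_ofReal_im])

lemma norm_ofReal_lt_one {x : ℝ} (hx : x ∈ Set.Ico (0 : ℝ) 1) : ‖(x : ℂ)‖ < 1 := by
  rw [Complex.norm_real, Real.norm_of_nonneg hx.1]; exact hx.2

lemma continuousOn_re_ofReal {f : ℂ → ℂ} (hf : DifferentiableOn ℂ f (Metric.ball 0 1)) :
    ContinuousOn (fun x : ℝ => (f x).re) (Set.Ico 0 1) :=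
  Complex.continuous_re.comp_continuousOn (hf.continuousOn.comp
    Complex.continuous_ofReal.continuousOn fun x hx => by simpa using norm_ofReal_lt_one hx)

lemma symbol_t_nonneg (v : MukaiCase) {x : ℝ} (hx : x ∈ Set.Ico (0 : ℝ) 1) :
    0 ≤ 1 - 2 * v.al * (v.t x).re + v.ka * (v.t x).re ^ 2 := by
  have h := v.w_sq (norm_ofReal_lt_one hx)
  have hw : ((v.w x).re : ℂ) = v.w x := Complex.ext rfl (by simp [w_ofReal_im])
  have hp : ((v.phi x).re : ℂ) = v.phi x := Complex.ext rfl (by simp [phi_ofReal_im])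
  have hp0 : (v.phi x).re ≠ 0 := fun h0 => v.phi_ne_zero (norm_ofReal_lt_one hx)
    (by rw [← hp, h0, Complex.ofReal_zero])
  rw [← hw, ← hp, ← ofReal_t_re] at h
  have h' : (v.w x).re ^ 2 = (v.phi x).re ^ 2 *
      (1 - 2 * v.al * (v.t x).re + v.ka * (v.t x).re ^ 2) := by exact_mod_cast h
  have : 0 < (v.phi x).re ^ 2 := by positivity
  exact nonneg_of_mul_nonneg_right (h' ▸ sq_nonneg _) this

/-- By continuity t would have to cross 1/9, but P(1/9) < 0 in all three cases whereas P(t) = (w/Φ)²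
≥ 0 for real q. -/
lemma t_re_lt (v : MukaiCase) {x : ℝ} (hx : x ∈ Set.Ico (0 : ℝ) 1) : (v.t x).re < 1 / 9 := by
  have := forall_pos_of_ne_zero (f := fun x : ℝ => 1 / 9 - (v.t x).re)
    (continuousOn_const.sub (continuousOn_re_ofReal v.differentiableOn_t)) (by simp [t_zero])
    (fun y hy h0 => ?_) x hx
  · linarith
  · have h := v.symbol_t_nonneg hy
    rw [show (v.t y).re = 1 / 9 by linarith] at h
    revert h
    cases v <;> norm_num [al, ka]

/-- The quotient t/q is real, equals 1 at the origin and has no zeros on [0,1), so it keeps its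
sign. -/
lemma t_re_pos (v : MukaiCase) {x : ℝ} (hx : x ∈ Set.Ioo (0 : ℝ) 1) : 0 < (v.t x).re := by
  have hmul : ∀ y : ℝ, y * (v.tQuot y).re = (v.t y).re := fun y => by
    rw [← v.mul_tQuot, Complex.re_ofReal_mul]
  have h1 := forall_pos_of_ne_zero (f := fun x : ℝ => (v.tQuot x).re)
    (continuousOn_re_ofReal v.differentiableOn_tQuot) (by simp [tQuot_zero])
    (fun y hy h0 => ?_) x ⟨hx.1.le, hx.2⟩
  · rw [← hmul]; exact mul_pos hx.1 h1
  · rcases hy.1.eq_or_lt with rfl | hy0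
    · simp [tQuot_zero] at h0
    · refine v.t_ne_zero (norm_ofReal_lt_one hy) (by exact_mod_cast hy0.ne') ?_
      rw [← ofReal_t_re, ← hmul, h0, mul_zero, Complex.ofReal_zero]

/-- The fixed point of the Fricke involution. -/
def tau0 (v : MukaiCase) : ℂ := Complex.I / (√(v.level : ℝ) : ℝ)

lemma tau0_eq (v : MukaiCase) : v.tau0 = ((√(v.level : ℝ))⁻¹ : ℝ) * Complex.I := by
  rw [tau0]; push_cast; ring

lemma tau0_im_pos (v : MukaiCase) : 0 < v.tau0.im := by
  have : (0 : ℝ) < v.level := by exact_mod_cast v.level_pos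
  rw [tau0_eq, Complex.im_ofReal_mul, Complex.I_im, mul_one]
  positivity

lemma level_mul_tau0_sq (v : MukaiCase) : v.level * v.tau0 ^ 2 = -1 := by
  have h : (0 : ℝ) < v.level := by exact_mod_cast v.level_pos
  have h2 : ((√(v.level : ℝ) : ℝ) : ℂ) ^ 2 = v.level := by
    exact_mod_cast Real.sq_sqrt h.le
  have h3 : (v.level : ℂ) ≠ 0 := by exact_mod_cast v.level_pos.ne'
  rw [tau0, div_pow, h2, Complex.I_sq]
  field_simp

lemma fricke_tau0 (v : MukaiCase) : -1 / (v.level * v.tau0) = v.tau0 := by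
  have h3 : (v.level : ℂ) ≠ 0 := by exact_mod_cast v.level_pos.ne'
  have h0 : v.tau0 ≠ 0 := fun h => by simpa [h] using v.tau0_im_pos
  rw [div_eq_iff (mul_ne_zero h3 h0)]
  linear_combination -v.level_mul_tau0_sq

/-- The value of `q` at the fixed point of the Fricke involution. -/
def q0 (v : MukaiCase) : ℝ := Real.exp (-(2 * Real.pi) * (√(v.level : ℝ))⁻¹)

lemma nome_tau0 (v : MukaiCase) : nome v.tau0 = v.q0 := by rw [tau0_eq, nome_mul_I, q0]

lemma q0_mem (v : MukaiCase) : v.q0 ∈ Set.Ioo (0 : ℝ) 1 := by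
  refine ⟨Real.exp_pos _, ?_⟩
  have := norm_nome_lt_one v.tau0_im_pos
  rw [nome_tau0, Complex.norm_real, q0, Real.norm_of_nonneg (Real.exp_pos _).le] at this
  exact this

/-- At the fixed point Nτ² = −1, so the Fricke law, whose sign for w is +1, reads w = −w. -/
lemma w_q0 (v : MukaiCase) : v.w v.q0 = 0 := by
  have h := v.w_fricke v.tau0_im_pos
  rw [fricke_tau0, level_mul_tau0_sq, nome_tau0] at h
  exact self_eq_neg.mp (by linear_combination h)

lemma P_t_q0 (v : MukaiCase) : v.P (v.t v.q0) = 0 := by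
  have hq := norm_ofReal_lt_one (Set.Ioo_subset_Ico_self v.q0_mem)
  have h := v.w_sq hq
  rw [w_q0, zero_pow two_ne_zero] at h
  exact (mul_eq_zero.mp h.symm).resolve_left (pow_ne_zero 2 (v.phi_ne_zero hq))

/-- The singular point of the differential equation closest to the origin. -/
def t0 (v : MukaiCase) : ℝ := (v.t v.q0).re

lemma t_q0 (v : MukaiCase) : v.t v.q0 = v.t0 := (v.ofReal_t_re _).symm

lemma t0_pos (v : MukaiCase) : 0 < v.t0 := v.t_re_pos v.q0_mem

lemma t0_lt (v : MukaiCase) : v.t0 < 1 / 9 := v.t_re_lt (Set.Ioo_subset_Ico_self v.q0_mem)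

lemma P_t0 (v : MukaiCase) : 1 - 2 * v.al * v.t0 + v.ka * v.t0 ^ 2 = 0 := by
  have h := v.P_t_q0
  rw [t_q0, P] at h
  exact_mod_cast h

lemma norm_t_le (v : MukaiCase) {x : ℝ} (hx : x ∈ Set.Icc 0 v.q0) : ‖v.t x‖ ≤ v.t0 := by
  rcases hx.1.eq_or_lt with rfl | hx0
  · simpa [t_zero] using v.t0_pos.le
  have hx1 : x ∈ Set.Ioo (0 : ℝ) 1 := ⟨hx0, hx.2.trans_lt v.q0_mem.2⟩
  have h1 := v.t_re_pos hx1
  have h2 := v.t_re_lt (Set.Ioo_subset_Ico_self hx1)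
  have h3 := v.symbol_t_nonneg (Set.Ioo_subset_Ico_self hx1)
  have h4 := v.t0_lt
  have h5 := v.t0_pos
  rw [← ofReal_t_re, Complex.norm_real, Real.norm_of_nonneg h1.le]
  by_contra! hlt
  -- This product is P(t₀) − P(t). Below 1/9 the polynomial P is decreasing, so t > t₀ would force
  -- P(t) < 0.
  have h6 : 0 < ((v.t x).re - v.t0) * (2 * v.al - v.ka * ((v.t x).re + v.t0)) := by
    refine mul_pos (sub_pos.mpr hlt) ?_
    cases v <;> norm_num [al, ka] <;> linarith
  linarith [v.P_t0]

/-! ### Analytic continuation to the Fricke fixed point -/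

/-- Analytic continuation along the real segment from 0 to q₀, where |t| ≤ t₀ < r keeps the argument
inside the disc of convergence. -/
lemma hasSum_near_tau0 (v : MukaiCase) {p : ℂ⟦X⟧} {y Φ : ℂ → ℂ} {r : ℝ} (hp : EvalOn p y r)
    (hr : v.t0 < r) (hΦ : DifferentiableOn ℂ Φ (Metric.ball 0 1))
    (h0 : ∀ᶠ q in 𝓝 0, y (v.t q) = Φ q) :
    ∀ᶠ τ in 𝓝 v.tau0, HasSum (fun n => PowerSeries.coeff n p * v.t (nome τ) ^ n)
      (Φ (nome τ)) := by
  set U : Set ℂ := Metric.ball 0 1 ∩ v.t ⁻¹' Metric.ball 0 r with hU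
  have hUo : IsOpen U :=
    v.differentiableOn_t.continuousOn.isOpen_inter_preimage Metric.isOpen_ball Metric.isOpen_ball
  set K : Set ℂ := (fun x : ℝ => (x : ℂ)) '' Set.Icc 0 v.q0 with hK
  have hKc : IsPreconnected K :=
    isPreconnected_Icc.image _ Complex.continuous_ofReal.continuousOn
  have hKU : K ⊆ U := by
    rintro _ ⟨x, hx, rfl⟩
    refine ⟨?_, ?_⟩
    · simpa using norm_ofReal_lt_one ⟨hx.1, hx.2.trans_lt v.q0_mem.2⟩
    · simpa using (v.norm_t_le hx).trans_lt hr
  have h0K : (0 : ℂ) ∈ K := ⟨0, ⟨le_rfl, v.q0_mem.1.le⟩, by simp⟩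
  set C := connectedComponentIn U 0 with hC
  have hCo : IsOpen C := hUo.connectedComponentIn
  have hCU : C ⊆ U := connectedComponentIn_subset U 0
  have hKC : K ⊆ C := hKc.subset_connectedComponentIn h0K hKU
  have d1 : DifferentiableOn ℂ (fun q => y (v.t q)) C :=
    hp.differentiableOn.comp (v.differentiableOn_t.mono fun q hq => (hCU hq).1)
      fun q hq => (hCU hq).2
  have d2 : DifferentiableOn ℂ Φ C := hΦ.mono fun q hq => (hCU hq).1
  have heq := (d1.analyticOnNhd hCo).eqOn_of_preconnected_of_eventuallyEq (d2.analyticOnNhd hCo)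
    isPreconnected_connectedComponentIn (hKC h0K) h0
  have hq : C ∈ 𝓝 (nome v.tau0) := by
    rw [nome_tau0]
    exact hCo.mem_nhds (hKC ⟨v.q0, ⟨v.q0_mem.1.le, le_rfl⟩, rfl⟩)
  filter_upwards [(hasDerivAt_nome v.tau0).continuousAt hq] with τ hτ
  have := hp (v.t (nome τ)) (by simpa using (hCU hτ).2)
  rwa [show y (v.t (nome τ)) = Φ (nome τ) from heq hτ] at this

/-- A function of t inherits the Fricke invariance of t. Near its fixed point the involution stays
in the region of convergence, and 1 + Nτ² vanishes only at the fixed point and its negative, so a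
suitable τ is available. -/
lemma exists_fricke_eq (v : MukaiCase) {c : ℕ → ℂ} {Φ : ℂ → ℂ}
    (h : ∀ᶠ τ in 𝓝 v.tau0, HasSum (fun n => c n * v.t (nome τ) ^ n) (Φ (nome τ))) :
    ∃ τ : ℂ, 0 < τ.im ∧ 1 + v.level * τ ^ 2 ≠ 0 ∧
      Φ (nome (-1 / (v.level * τ))) = Φ (nome τ) := by
  have hN : (v.level : ℂ) ≠ 0 := by exact_mod_cast v.level_pos.ne'
  have hne : v.tau0 ≠ 0 := fun h => by simpa [h] using v.tau0_im_pos
  have hS : Tendsto (fun τ : ℂ => -1 / (v.level * τ)) (𝓝 v.tau0) (𝓝 v.tau0) := by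
    have : ContinuousAt (fun τ : ℂ => -1 / (v.level * τ)) v.tau0 :=
      continuousAt_const.div (by fun_prop) (mul_ne_zero hN hne)
    simpa [ContinuousAt, v.fricke_tau0] using this
  have him : ∀ᶠ τ in 𝓝 v.tau0, 0 < τ.im := isOpen_im_pos.mem_nhds v.tau0_im_pos
  obtain ⟨τ, ⟨⟨h1, h2⟩, h3⟩, h4⟩ := ((((h.and (hS.eventually h)).and him).filter_mono
    nhdsWithin_le_nhds).and (self_mem_nhdsWithin (s := {v.tau0}ᶜ))).exists
  refine ⟨τ, h3, fun h5 => ?_, ?_⟩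
  · have h6 : τ ^ 2 = v.tau0 ^ 2 := by
      apply mul_left_cancel₀ hN
      linear_combination h5 - v.level_mul_tau0_sq
    rcases sq_eq_sq_iff_eq_or_eq_neg.mp h6 with h7 | h7
    · exact h4 h7
    · have := v.tau0_im_pos
      rw [h7, Complex.neg_im] at h3
      linarith
  · rw [v.t_fricke h3] at h2
    exact h2.unique h1

end MukaiCase

/-! ### Radii of convergence -/

lemma le_convRadius {u : ℕ → ℂ} {C : ℝ} {r : NNReal} (h : ∀ n, ‖u n‖ * (r : ℝ) ^ n ≤ C) :
    (r : ENNReal) ≤ convRadius u :=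
  FormalMultilinearSeries.le_radius_of_bound _ C fun n => by
    rw [FormalMultilinearSeries.ofScalars_norm]; exact h n

lemma exists_evalOn_of_lt_convRadius {u : ℕ → ℂ} {s : NNReal} (h : (s : ENNReal) < convRadius u) :
    ∃ r > (s : ℝ), EvalOn (PowerSeries.mk u) (fun z => ∑' n, u n * z ^ n) r := by
  obtain ⟨r, hr, hr'⟩ := ENNReal.lt_iff_exists_nnreal_btwn.mp h
  have hsr : s < r := by exact_mod_cast hr
  have hr0 : (0 : ℝ) < r := by exact_mod_cast (bot_le (a := s)).trans_lt hsr
  obtain ⟨C, -, hC⟩ := FormalMultilinearSeries.norm_mul_pow_le_of_lt_radius _ hr'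
  refine ⟨r, by exact_mod_cast hsr, ?_⟩
  have := evalOn_of_bound (p := PowerSeries.mk u) (C := C) (inv_pos.mpr hr0) fun n => ?_
  · simpa using this
  · have h1 := hC n
    rw [FormalMultilinearSeries.ofScalars_norm] at h1
    rw [PowerSeries.coeff_mk, inv_pow, ← div_eq_mul_inv, le_div_iff₀ (by positivity)]
    exact h1

namespace MukaiCase

variable {v : MukaiCase} {a b : ℕ → ℂ}

lemma enorm_t_q0 (v : MukaiCase) : ‖v.t v.q0‖ₑ = (v.t0.toNNReal : ENNReal) := by
  rw [t_q0, ← ofReal_norm, Complex.norm_real, Real.norm_of_nonneg v.t0_pos.le]; rfl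

/-- The bound aₙt₀ⁿ ≤ 1 gives one inequality. A larger radius would make Φ Fricke invariant near the
fixed point, contradicting its factor −Nτ² and its nonvanishing. -/
lemma IsSolutionA.convRadius_eq (ha : v.IsSolutionA a) : convRadius a = ‖v.t v.q0‖ₑ := by
  have hcoe : ((v.t0.toNNReal : NNReal) : ℝ) = v.t0 := Real.coe_toNNReal _ v.t0_pos.le
  rw [enorm_t_q0]
  refine le_antisymm ?_ (le_convRadius (C := 1) fun n => ?_)
  · by_contra! hlt
    obtain ⟨r, hr, h⟩ := exists_evalOn_of_lt_convRadius hlt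
    rw [hcoe] at hr
    obtain ⟨s, hs, hphi⟩ := ha.hasSum_phi
    obtain ⟨τ, hτ, h1, h2⟩ := v.exists_fricke_eq (v.hasSum_near_tau0 h hr v.differentiableOn_phi (by
      filter_upwards [Metric.ball_mem_nhds 0 hs] with q hq using (hphi q (by simpa using hq)).tsum_eq))
    rw [v.phi_fricke hτ] at h2
    refine mul_ne_zero h1 (v.phi_ne_zero (norm_nome_lt_one hτ)) ?_
    linear_combination -h2
  · rw [hcoe, ha.eq_aSeq, Complex.norm_real, Real.norm_of_nonneg (v.aSeq_pos n).le]
    exact v.aSeq_mul_pow_le v.t0_pos v.t0_lt.le v.P_t0 n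

lemma hasSum_sub (ha : v.IsSolutionA a) (hb : v.IsSolutionB b) (l : ℂ) :
    ∀ᶠ q in 𝓝 (0 : ℂ), HasSum (fun n => (b n - l * a n) * v.t q ^ n)
      (v.phi q * (v.eich q - l)) := by
  obtain ⟨r, hr, h1⟩ := ha.hasSum_phi
  obtain ⟨s, hs, h2⟩ := hb.hasSum_eichler
  filter_upwards [Metric.ball_mem_nhds 0 hr, Metric.ball_mem_nhds 0 hs] with q hq hq'
  refine HasSum.of_eq ((h2 q (by simpa using hq')).sub ((h1 q (by simpa using hq)).mul_left l))
    (fun n => ?_) ?_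
  · ring
  · rw [eich]; ring

lemma norm_sub_le_of_abs_sub_le {l C : ℝ}
    (h : ∀ n, |v.bSeq n - l * v.aSeq n| ≤ C * (9 / 2) ^ n) (ha : v.IsSolutionA a)
    (hb : v.IsSolutionB b) (n : ℕ) : ‖b n - l * a n‖ ≤ C * (9 / 2) ^ n := by
  rw [ha.eq_aSeq, hb.eq_bSeq]
  have : ((v.bSeq n - l * v.aSeq n : ℝ) : ℂ) = v.bSeq n - l * v.aSeq n := by push_cast; rfl
  rw [← this, Complex.norm_real]
  exact h n

/-- The Apéry limit l already yields a series with radius at least 2/9, which exceeds t₀ < 1/9. Its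
continuation makes Φ(f − l) Fricke invariant; subtracting the period relation leaves (1 + Nτ²)·Φ·(l
− L(F,3)) = 0 at a point where the first two factors are nonzero. -/
lemma convRadius_lt_and_hasSum (ha : v.IsSolutionA a) (hb : v.IsSolutionB b) :
    ‖v.t v.q0‖ₑ < convRadius (fun n => b n - v.lFun 3 * a n) ∧
    ∀ᶠ τ in 𝓝 v.tau0, HasSum (fun n => (b n - v.lFun 3 * a n) * v.t (nome τ) ^ n)
      (v.phi (nome τ) * (v.eich (nome τ) - v.lFun 3)) := by
  obtain ⟨l, hl⟩ := v.exists_limit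
  have hbd := norm_sub_le_of_abs_sub_le hl ha hb
  have hev := evalOn_of_bound (p := PowerSeries.mk fun n => b n - l * a n) (C := 8 / 3)
    (M := 9 / 2) (by norm_num) fun n => by rw [PowerSeries.coeff_mk]; exact hbd n
  have hnear := v.hasSum_near_tau0 hev (by linarith [v.t0_lt])
    (v.differentiableOn_phi.mul (v.evalOn_eich.differentiableOn.sub_const (l : ℂ))) (by
      filter_upwards [hasSum_sub ha hb l] with q hq
      simpa using hq.tsum_eq)
  obtain ⟨τ, hτ, h1, h2⟩ := v.exists_fricke_eq hnear
  have hL : (l : ℂ) = v.lFun 3 := by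
    simp only [Pi.mul_apply] at h2
    rw [v.phi_fricke hτ] at h2
    have h3 := v.period_eq hτ
    apply mul_left_cancel₀ (mul_ne_zero h1 (v.phi_ne_zero (norm_nome_lt_one hτ)))
    linear_combination h2 + v.phi (nome τ) * h3
  rw [← hL]
  refine ⟨?_, by simpa using hnear⟩
  refine lt_of_lt_of_le (b := ((2 / 9 : NNReal) : ENNReal)) ?_ (le_convRadius (C := 8 / 3) fun n => ?_)
  · rw [enorm_t_q0, ENNReal.coe_lt_coe, Real.toNNReal_lt_iff_lt_coe v.t0_pos.le]
    push_cast
    linarith [v.t0_lt]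
  · refine (mul_le_mul_of_nonneg_right (hbd n) (by positivity)).trans (le_of_eq ?_)
    push_cast
    rw [mul_assoc, ← mul_pow]
    norm_num

end MukaiCase

end

theorem mainTheorem4 (v : MukaiCase) (a b g : ℕ → ℂ)
    (ha : v.IsSolutionA a) (hb : v.IsSolutionB b) (hg : v.IsSolutionLog a g) :
    -- the inverse `t(q)` of the modular parameter `q(t)`, a modular function on the unit disc
    ∃ t : ℂ → ℂ, DifferentiableOn ℂ t (Metric.ball 0 1) ∧ t 0 = 0 ∧
      (∀ᶠ q in 𝓝 (0 : ℂ), Summable (fun n => g n * t q ^ n) ∧ modularParam a g (t q) = q) ∧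
      (∀ γ ∈ CongruenceSubgroup.Gamma0 v.level, ∀ τ : ℍ,
        t (nome ↑(γ • τ)) = t (nome τ)) ∧
      (∀ τ : ℂ, 0 < τ.im → t (nome (-1 / (v.level * τ))) = t (nome τ)) ∧
    -- (i)
      (∀ᶠ q in 𝓝 (0 : ℂ), HasSum (fun n => a n * t q ^ n) (v.phi q)) ∧
      (∃ Φ : ModularForm (CongruenceSubgroup.Gamma0 v.level) 2,
        ∀ τ : ℍ, Φ τ = v.phi (nome τ)) ∧
      (∀ τ : ℂ, 0 < τ.im →
        v.phi (nome (-1 / (v.level * τ))) = -(v.level * τ ^ 2) * v.phi (nome τ)) ∧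
    -- (ii)
      ∃ c : ℕ → ℂ,
        (∃ F : ModularForm (CongruenceSubgroup.Gamma0 v.level) 4,
          ∀ τ : ℍ, F τ = v.formF (nome τ)) ∧
        (∀ τ : ℂ, 0 < τ.im → v.formF (nome (-1 / (v.level * τ))) =
          -(τ * (√(v.level : ℝ) : ℝ)) ^ 4 * v.formF (nome τ)) ∧
        c 0 = 0 ∧
        (∀ q : ℂ, ‖q‖ < 1 → HasSum (fun n => c n * q ^ n) (v.formF q)) ∧
        (∀ᶠ q in 𝓝 (0 : ℂ), Summable (fun n => b n * t q ^ n) ∧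
          (∑' n, b n * t q ^ n) / (∑' n, a n * t q ^ n) = eichler c q) ∧
        ∃ L : ℂ → ℂ, IsLFunction c L ∧ v.LShape L ∧
    -- (iii)
          (∀ τ : ℂ, 0 < τ.im →
            v.phi (nome (-1 / (v.level * τ))) *
                (eichler c (nome (-1 / (v.level * τ))) - L 3) =
              v.phi (nome τ) * (eichler c (nome τ) - L 3)) ∧
    -- (iv)
          (∀ᶠ q in 𝓝 (0 : ℂ), HasSum (fun n => (b n - L 3 * a n) * t q ^ n)
            (v.phi q * (eichler c q - L 3))) ∧
          v.symbol (t (nome (Complex.I / (√(v.level : ℝ) : ℝ)))) = 0 ∧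
          convRadius a = ‖t (nome (Complex.I / (√(v.level : ℝ) : ℝ)))‖ₑ ∧
          ‖t (nome (Complex.I / (√(v.level : ℝ) : ℝ)))‖ₑ <
            convRadius (fun n => b n - L 3 * a n) ∧
          (∀ᶠ τ in 𝓝 (Complex.I / (√(v.level : ℝ) : ℝ)),
            HasSum (fun n => (b n - L 3 * a n) * t (nome τ) ^ n)
              (v.phi (nome τ) * (eichler c (nome τ) - L 3))) := by
  have hev {P : ℂ → Prop} (h : ∃ r > 0, ∀ q : ℂ, ‖q‖ < r → P q) : ∀ᶠ q in 𝓝 (0 : ℂ), P q := by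
    obtain ⟨r, hr, h⟩ := h
    filter_upwards [Metric.ball_mem_nhds 0 hr] with q hq using h q (by simpa using hq)
  have hphi := hev ha.hasSum_phi
  have ht0 : v.t (nome (Complex.I / (√(v.level : ℝ) : ℝ))) = v.t v.q0 :=
    congrArg v.t v.nome_tau0
  obtain ⟨hrad, hnear⟩ := MukaiCase.convRadius_lt_and_hasSum ha hb
  refine ⟨v.t, v.differentiableOn_t, v.t_zero, hev (hg.modularParam_t ha),
    fun γ hγ τ => v.t_smul hγ τ, fun τ hτ => v.t_fricke hτ, hphi,
    ⟨(v.isQuasimodular_phi.isModular rfl).toModularForm, fun τ => ?_⟩,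
    fun τ hτ => v.phi_fricke hτ, fun n => PowerSeries.coeff n v.formFSeries,
    ⟨v.isModular_formF.toModularForm, fun τ => ?_⟩, fun τ hτ => v.formF_fricke hτ,
    v.coeff_zero_formFSeries, v.evalOn_formF, ?_, v.lFun, v.lFun_isLFunction, v.lShape_lFun,
    fun τ hτ => v.phi_mul_eich_fricke hτ, MukaiCase.hasSum_sub ha hb _, ?_, ?_, ?_, hnear⟩
  · exact congrFun (IsModular.coe_toModularForm _) τ
  · exact congrFun (IsModular.coe_toModularForm _) τ
  · filter_upwards [hphi, hev hb.hasSum_eichler, Metric.ball_mem_nhds 0 one_pos] with q h1 h2 hq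
    rw [h1.tsum_eq, h2.tsum_eq]
    exact ⟨h2.summable, mul_div_cancel_left₀ _ (v.phi_ne_zero (by simpa using hq))⟩
  · rw [ht0, v.symbol_eq, v.P_t_q0]
  · rw [ht0, ha.convRadius_eq]
  · rw [ht0]; exact hrad
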